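/- **Setting.** Let $N$ be a compact connected smooth 4-manifold with $\partial N=\partial_0M\cup\partial_0W$, and fix a homomorphism $\gamma:\Gamma\to\pi_1N$ and a factorization $\pi_1\partial_0W\to\Gamma\to\pi_1N$. (If $\partial_0W$ is empty or disconnected, homomorphisms from $\pi_1$ are read as functors from the fundamental groupoid.) A *$\Gamma$ decomposition* is a decomposition $N=M\cup W$ along a smooth hypersurface transverse to $\partial N$, with $M\cap\partial N=\partial_0M$, $W\cap\partial N=\partial_0W$ and $W$ connected, together with handlebody structures on $(M,\partial_0M)$ and $(W,\partial_0W)$ with handles of index $\le 2$ and a factorization $\pi_1W\to\Gamma\to\pi_1N$ that extends the given one on $\partial_0W$, such that $\pi_1W\to\Gamma$ is onto. For $n\ge 0$ put $\Gamma_n(W)=\pi_1W/\ker(\pi_1W\to\Gamma)^{(n)}$, where $K^{(0)}=K$, $K^{(n+1)}=[K^{(n)},K^{(n)}]$; let $\gamma_n:\Gamma_n(W)\to\pi_1N$ and $\gamma_{n+1,n}:\Gamma_{n+1}(W)\to\Gamma_n(W)$ be the natural maps. Chains are singular chains of the corresponding coverings. If $Y\subset X$, $l:H\to G$ is a homomorphism,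 $X$ has a $G$-covering, and $Y$ has an $H$-covering with a map over $l$ to the $G$-covering, then the *stratified chains* $C_*(X,Y;\mathbb Z[l])$ are the pullback of $$C_*(X,Y;\mathbb Z[G])\xrightarrow{\ \partial\ }C_{*-1}(Y;\mathbb Z[G])\leftarrow C_{*-1}(Y;\mathbb Z[H]).$$ A *homological $\Gamma_n$ equivalence* $(\varphi,f)$ from $M\cup W$ to $M'\cup W'$ consists of 1. an isomorphism $\varphi:\Gamma_n(W)\to\Gamma_n(W')$ that commutes with the homomorphisms to $\Gamma$ and from $\pi_1\partial_0W$ (equivalently, together with an isomorphism $\theta$ over $\varphi$ between the restrictions to $\partial_0W$ of the $\Gamma_n$ coverings of $W$ and $W'$, compatible with the maps to the $\Gamma$ covering of $\partial_0W$); and 2. a simple chain homotopy equivalence $f:C_*(W,\partial_0W;\mathbb Z[\Gamma_n(W)])\to C_*(W',\partial_0W;\mathbb Z[\Gamma_n(W')])$ over $\varphi$ ("simple" with respect to the bases given by the handles) that, up to chain homotopy, commutes with the maps to the stratified chains $C_*(N,\partial_0W;\mathbb Z[\gamma_n])$. **Statement.** Let $(\varphi,f)$ be a homological $\Gamma_n$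 equivalence from $M\cup W$ to $M'\cup W'$, $n\ge0$. (a) There is a chain map $g:C_*(W;\mathbb Z[\Gamma_n(W)])\to C_*(W';\mathbb Z[\Gamma_n(W')])$ over $\varphi$ that is the identity on the chains of $\partial_0W$ (the map induced by $\theta$) and induces $f$ on the relative chains. (b) Let $g$ be any such map, and let $w,w'$ be the base points of $W$, $W'$ and of their coverings. There are $1$-chains $c$ of the $\Gamma_n$ covering of $W'$ with $\partial c=g(w)-w'$. For each such $c$ there are a unique isomorphism $\hat\varphi:\Gamma_{n+1}(W)\to\Gamma_{n+1}(W')$ that lifts $\varphi$, and a unique lift $\hat\theta$ of $\theta$ to an isomorphism over $\hat\varphi$ between the restrictions to $\partial_0W$ of the $\Gamma_{n+1}$ coverings, which are induced by $g$ in the following sense. If $S$ is a path in the $\Gamma_{n+1}$ covering of $W$ from $a\cdot w$ to $w$, $a\in\Gamma_{n+1}(W)$, and $S'$ is a path in that of $W'$ from $\hat\varphi(a)\cdot w'$ to $w'$, then in the $\Gamma_n$ covering of $W'$ the chains $g(S)$ and $S'+c-\varphi([a])\,c$ differ by a boundary, where $[a]=\gamma_{n+1,n}(a)$; and if $S$ is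 a path from a point $b$ over $\partial_0W$ to $w$, and $S'$ a path from $\hat\theta(b)$ to $w'$, then $g(S)$ and $S'+c$ differ by a boundary. (c) The pairs $(\hat\varphi,\hat\theta)$ and $(\hat\varphi_1,\hat\theta_1)$ that belong to two chains $c,c_1$ and the same $g$ differ only by an element $\kappa\in\ker(\Gamma_{n+1}(W')\to\Gamma_n(W'))$: $\hat\varphi_1=\kappa\hat\varphi\kappa^{-1}$ and $\hat\theta_1=\kappa\hat\theta$. (d) For each such $(\hat\varphi,\hat\theta)$, $f$ lifts to a chain homotopy equivalence over $\hat\varphi$ of stratified chains $$\hat f:C_*(W,\partial_0W;\mathbb Z[\gamma_{n+1,n}])\to C_*(W',\partial_0W;\mathbb Z[\gamma_{n+1,n}]),$$ whose components are a chain map chain homotopic to $f$ and the map $C_{*-1}(\partial_0W;\mathbb Z[\Gamma_{n+1}(W)])\to C_{*-1}(\partial_0W;\mathbb Z[\Gamma_{n+1}(W')])$ induced by $\hat\theta$. -/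

import Mathlib

open CategoryTheory Topology Set
open scoped Manifold ContDiff unitInterval

namespace DualDec

noncomputable section

/-! ## Chain complexes over integral group rings

A `ℤ[G]`-module is an abelian group with an additive action of `G`. A homomorphism of such modules
which is semilinear over `ℤ[φ] : ℤ[G] → ℤ[G']` is an additive map `f` with `f (g • x) = φ g • f x`. -/

/-- A chain complex of `ℤ[G]`-modules, in degrees `≥ 0`. -/
structure GComplex (G : Type*) [Group G] where
  X : ℕ → Type*
  [grp : ∀ k, AddCommGroup (X k)]
  [act : ∀ k, DistribMulAction G (X k)]
  d : ∀ k, X (k + 1) →+ X k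
  d_smul : ∀ k (g : G) x, d k (g • x) = g • d k x
  d_d : ∀ k x, d k (d (k + 1) x) = 0

attribute [instance] GComplex.grp GComplex.act

/-- A chain map which is semilinear over `ℤ[φ]`. -/
structure GHom {G G' : Type*} [Group G] [Group G'] (φ : G →* G')
    (A : GComplex G) (B : GComplex G') where
  f : ∀ k, A.X k →+ B.X k
  comm : ∀ k x, f k (A.d k x) = B.d k (f (k + 1) x)
  smul : ∀ k (g : G) x, f k (g • x) = φ g • f k x

/-- A chain homotopy, semilinear over `ℤ[φ]`, between two families of maps:
`a - b = ∂ h + h ∂`. -/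
structure GHomotopy {G G' : Type*} [Group G] [Group G'] (φ : G →* G')
    {A : GComplex G} {B : GComplex G'} (a b : ∀ k, A.X k →+ B.X k) where
  h : ∀ k, A.X k →+ B.X (k + 1)
  smul : ∀ k (g : G) x, h k (g • x) = φ g • h k x
  zero : ∀ x, a 0 x - b 0 x = B.d 0 (h 0 x)
  succ : ∀ k x, a (k + 1) x - b (k + 1) x = B.d (k + 1) (h (k + 1) x) + h k (A.d k x)

/-- `f` is a chain homotopy equivalence over the isomorphism `ℤ[φ] : ℤ[G] ≅ ℤ[G']`. -/
def GHom.IsEquivalence {G G' : Type*} [Group G] [Group G'] {φ : G ≃* G'}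
    {A : GComplex G} {B : GComplex G'} (f : GHom φ.toMonoidHom A B) : Prop :=
  ∃ e : GHom φ.symm.toMonoidHom B A,
    Nonempty (GHomotopy (MonoidHom.id G) (A := A) (B := A)
      (fun k => (e.f k).comp (f.f k)) (fun k => AddMonoidHom.id (A.X k))) ∧
    Nonempty (GHomotopy (MonoidHom.id G') (A := B) (B := B)
      (fun k => (f.f k).comp (e.f k)) (fun k => AddMonoidHom.id (B.X k)))

/-- The composition of a linear and a semilinear chain map. -/
def GHom.compLin {G G' : Type*} [Group G] [Group G'] {φ : G →* G'} {A B : GComplex G}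
    {C : GComplex G'} (a : GHom (MonoidHom.id G) A B) (b : GHom φ B C) : GHom φ A C where
  f k := (b.f k).comp (a.f k)
  comm k x := (congrArg (b.f k) (a.comm k x)).trans (b.comm k _)
  smul k g x := (congrArg (b.f k) (a.smul k g x)).trans (b.smul k g _)

/-- The action of a group ring element on a `G`-module. -/
def ringAct {G : Type*} [Group G] {A : Type*} [AddCommGroup A] [DistribMulAction G A]
    (r : MonoidAlgebra ℤ G) (x : A) : A :=
  Finsupp.sum r.coeff fun g m => m • (g • x)

theorem alternating_sum_sq {A B C : Type*} [AddCommGroup A] [AddCommGroup B] [AddCommGroup C]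
    (n : ℕ) (δ : Fin (n + 3) → A →+ B) (ε : Fin (n + 2) → B →+ C)
    (h : ∀ (i j : Fin (n + 2)), i ≤ j → ∀ x, ε i (δ j.succ x) = ε j (δ i.castSucc x)) (x : A) :
    ∑ i : Fin (n + 2), (-1 : ℤ) ^ (i : ℕ) •
      ε i (∑ j : Fin (n + 3), (-1 : ℤ) ^ (j : ℕ) • δ j x) = 0 := by
  simp only [map_sum, map_zsmul, Finset.smul_sum, ← Finset.sum_product']
  let P := Fin (n + 2) × Fin (n + 3)
  let S : Finset P := {ij : P | (ij.2 : ℕ) ≤ (ij.1 : ℕ)}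
  rw [Finset.univ_product_univ, ← Finset.sum_add_sum_compl S, ← eq_neg_iff_add_eq_zero,
    ← Finset.sum_neg_distrib]
  let φ : ∀ ij : P, ij ∈ S → P := fun ij hij =>
    (Fin.castLT ij.2 (lt_of_le_of_lt (Finset.mem_filter.mp hij).right (Fin.is_lt ij.1)),
      ij.1.succ)
  apply Finset.sum_bij φ
  · intro ij hij
    simp_rw [S, φ, Finset.compl_filter, Finset.mem_filter_univ, Fin.val_succ,
      Fin.val_castLT] at hij ⊢
    lia
  · rintro ⟨i, j⟩ hij ⟨i', j'⟩ hij' h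
    rw [Prod.mk_inj]
    exact ⟨by simpa [φ] using! congr_arg Prod.snd h,
      by simpa [φ, Fin.castSucc_castLT] using! congr_arg Fin.castSucc (congr_arg Prod.fst h)⟩
  · rintro ⟨i', j'⟩ hij'
    simp_rw [S, Finset.compl_filter, Finset.mem_filter_univ, not_le] at hij'
    refine ⟨(j'.pred <| ?_, Fin.castSucc i'), ?_, ?_⟩
    · rintro rfl
      simp only [Fin.val_zero, not_lt_zero] at hij'
    · simpa [S] using! Nat.le_sub_one_of_lt hij'
    · simp only [φ, Fin.castLT_castSucc, Fin.succ_pred]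
  · rintro ⟨i, j⟩ hij
    have hle : Fin.castLT j (lt_of_le_of_lt (Finset.mem_filter.mp hij).right (Fin.is_lt i)) ≤ i :=
      (Finset.mem_filter.mp hij).right
    have key := h _ _ hle x
    rw [Fin.castSucc_castLT] at key
    simp only [φ, key, Fin.val_castLT, Fin.val_succ, pow_succ, smul_smul, mul_neg, mul_one,
      ← neg_smul, neg_neg]
    rw [mul_comm]

/-! ## Principal coverings and their singular chains -/

/-- A principal covering of `X` with group `G`, given by its fibres and the transport along paths:
`pull p` carries the fibre over the end of `p` to the fibre over its start. The group acts freely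
and transitively on each fibre. -/
structure Cov (X : Type*) [TopologicalSpace X] (G : Type*) [Group G] where
  fib : X → Type*
  [act : ∀ x, MulAction G (fib x)]
  pull : ∀ {x y : X}, Path.Homotopic.Quotient x y → fib y → fib x
  pull_refl : ∀ (x : X) (a : fib x), pull (Path.Homotopic.Quotient.refl x) a = a
  pull_trans : ∀ {x y z : X} (p : Path.Homotopic.Quotient x y) (q : Path.Homotopic.Quotient y z)
    (a : fib z), pull (p.trans q) a = pull p (pull q a)
  pull_smul : ∀ {x y : X} (p : Path.Homotopic.Quotient x y) (g : G) (a : fib y),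
    pull p (g • a) = g • pull p a
  torsor : ∀ {x : X} (a b : fib x), ∃! g : G, g • a = b

attribute [instance] Cov.act

/-- The points of the covering space. -/
abbrev Cov.Tot {X : Type*} [TopologicalSpace X] {G : Type*} [Group G] (C : Cov X G) :=
  Σ x : X, C.fib x

/-- The restriction (pullback) of a covering along a continuous map. -/
def Cov.restrict {X Y : Type*} [TopologicalSpace X] [TopologicalSpace Y] {G : Type*} [Group G]
    (C : Cov X G) (i : C(Y, X)) : Cov Y G where
  fib y := C.fib (i y)
  pull p := C.pull (p.map i)
  pull_refl y a := C.pull_refl (i y) a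
  pull_trans p q a := by
    induction p using Path.Homotopic.Quotient.ind with | mk p => ?_
    induction q using Path.Homotopic.Quotient.ind with | mk q => ?_
    rw [← C.pull_trans]
    simp only [← Path.Homotopic.Quotient.mk_trans, ← Path.Homotopic.Quotient.mk_map,
      Path.map_trans]
  pull_smul p g a := C.pull_smul _ g a
  torsor a b := C.torsor a b

/-- A map of coverings of `X`, over the identity of `X` and equivariant over `φ`. -/
structure CovHom {X : Type*} [TopologicalSpace X] {G G' : Type*} [Group G] [Group G']
    (φ : G →* G') (C : Cov X G) (C' : Cov X G') where
  f : ∀ {x : X}, C.fib x → C'.fib x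
  smul : ∀ {x : X} (g : G) (a : C.fib x), f (g • a) = φ g • f a
  pull : ∀ {x y : X} (p : Path.Homotopic.Quotient x y) (a : C.fib y),
    f (C.pull p a) = C'.pull p (f a)

/-- The restriction of a map of coverings. -/
def CovHom.restrict {X Y : Type*} [TopologicalSpace X] [TopologicalSpace Y]
    {G G' : Type*} [Group G] [Group G'] {φ : G →* G'} {C : Cov X G} {C' : Cov X G'}
    (m : CovHom φ C C') (i : C(Y, X)) : CovHom φ (C.restrict i) (C'.restrict i) where
  f a := m.f a
  smul g a := m.smul g a
  pull p a := m.pull (p.map i) a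

/-- The restriction of a map of coverings over `F : X → X'` to a space `Y` over `X`. -/
def CovHom.restrictComp {X X' Y : Type*} [TopologicalSpace X] [TopologicalSpace X']
    [TopologicalSpace Y] {G G' : Type*} [Group G] [Group G'] {φ : G →* G'} {C : Cov X G}
    {C' : Cov X' G'} {F : C(X, X')} (m : CovHom φ C (C'.restrict F)) (i : C(Y, X)) :
    CovHom φ (C.restrict i) (C'.restrict (F.comp i)) where
  f a := m.f a
  smul g a := m.smul g a
  pull p a := by
    induction p using Path.Homotopic.Quotient.ind with | mk p => ?_
    exact m.pull (Path.Homotopic.Quotient.mk (p.map i.continuous)) a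

/-- The standard `k`-simplex. -/
abbrev Δ (k : ℕ) := stdSimplex ℝ (Fin (k + 1))

/-- A singular simplex of the covering space: a singular simplex of `X` together with a lift to
the covering. Lifts are functions to the set of points which are compatible with the
transport along all paths. -/
structure Simplex {X : Type*} [TopologicalSpace X] {G : Type*} [Group G] (C : Cov X G)
    (k : ℕ) where
  toFun : Δ k → C.Tot
  cont : Continuous fun t => (toFun t).1
  compat : ∀ {s t : Δ k} (p : Path s t),
    C.pull (Path.Homotopic.Quotient.mk (p.map cont)) (toFun t).2 = (toFun s).2

namespace Simplex

variable {X Y : Type*} [TopologicalSpace X] [TopologicalSpace Y] {G G' : Type*} [Group G]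
  [Group G'] {C : Cov X G} {k l : ℕ}

theorem ext' {s t : Simplex C k} (h : ∀ v, s.toFun v = t.toFun v) : s = t := by
  cases s; cases t; simp only [mk.injEq]; exact funext h

/-- The composition of a singular simplex with a map of standard simplices. -/
def precomp (s : Simplex C k) (a : C(Δ l, Δ k)) : Simplex C l where
  toFun t := s.toFun (a t)
  cont := s.cont.comp a.continuous
  compat p := s.compat (p.map a.continuous)

/-- The `i`-th face. -/
def face (i : Fin (k + 2)) (s : Simplex C (k + 1)) : Simplex C k :=
  s.precomp ⟨stdSimplex.map (Fin.succAbove i), stdSimplex.continuous_map _⟩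

theorem face_face (i j : Fin (k + 2)) (h : i ≤ j) (s : Simplex C (k + 2)) :
    face i (face j.succ s) = face j (face i.castSucc s) := by
  apply ext'
  intro v
  change s.toFun (stdSimplex.map (Fin.succAbove j.succ) (stdSimplex.map (Fin.succAbove i) v)) =
    s.toFun (stdSimplex.map (Fin.succAbove i.castSucc) (stdSimplex.map (Fin.succAbove j) v))
  rw [stdSimplex.map_comp_apply, stdSimplex.map_comp_apply]
  congr 2
  funext m
  simp only [Function.comp, Fin.succAbove, Fin.lt_def, Fin.ext_iff, Fin.le_def] at *
  split_ifs <;> simp_all <;> omega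

/-- The group acts on the singular simplices of the covering space. -/
instance : MulAction G (Simplex C k) where
  smul g s :=
    { toFun := fun t => ⟨(s.toFun t).1, g • (s.toFun t).2⟩
      cont := s.cont
      compat := fun p => by rw [C.pull_smul]; exact congrArg _ (s.compat p) }
  one_smul s := ext' fun v => Sigma.ext rfl (heq_of_eq (one_smul G _))
  mul_smul g h s := ext' fun v => Sigma.ext rfl (heq_of_eq (mul_smul g h _))

theorem face_smul (i : Fin (k + 2)) (g : G) (s : Simplex C (k + 1)) :
    face i (g • s) = g • face i s := rfl

/-- The `0`-simplex at a point of the covering. -/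
def point (z : C.Tot) : Simplex C 0 where
  toFun _ := z
  cont := continuous_const
  compat p := C.pull_refl z.1 z.2

/-- The map on simplices that is induced by a map of coverings. -/
def map {φ : G →* G'} {C' : Cov X G'} (m : CovHom φ C C') (s : Simplex C k) : Simplex C' k where
  toFun t := ⟨(s.toFun t).1, m.f (s.toFun t).2⟩
  cont := s.cont
  compat p := by rw [← m.pull]; exact congrArg _ (s.compat p)

theorem face_map {φ : G →* G'} {C' : Cov X G'} (m : CovHom φ C C') (i : Fin (k + 2))
    (s : Simplex C (k + 1)) : face i (map m s) = map m (face i s) := rfl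

theorem map_smul {φ : G →* G'} {C' : Cov X G'} (m : CovHom φ C C') (g : G)
    (s : Simplex C k) : map m (g • s) = φ g • map m s :=
  ext' fun _ => Sigma.ext rfl (heq_of_eq (m.smul g _))

/-- The map on simplices from a restricted covering to the covering. -/
def push (i : C(Y, X)) (s : Simplex (C.restrict i) k) : Simplex C k where
  toFun t := ⟨i (s.toFun t).1, (s.toFun t).2⟩
  cont := i.continuous.comp s.cont
  compat p := s.compat p

theorem face_push (i : C(Y, X)) (j : Fin (k + 2)) (s : Simplex (C.restrict i) (k + 1)) :
    face j (push i s) = push i (face j s) := rfl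

theorem push_smul (i : C(Y, X)) (g : G) (s : Simplex (C.restrict i) k) :
    push i (g • s) = g • push i s := rfl

theorem push_injective {i : C(Y, X)} (hi : Function.Injective i) :
    Function.Injective (push i : Simplex (C.restrict i) k → Simplex C k) := by
  intro s t h
  apply ext'
  intro v
  have h1 : (push i s).toFun v = (push i t).toFun v := by rw [h]
  have hinj : Function.Injective
      (Sigma.map i (fun _ a => a) : (C.restrict i).Tot → C.Tot) :=
    Function.Injective.sigma_map hi fun _ _ _ h => h
  exact hinj h1

theorem exists_push {i : C(Y, X)} (hi : IsEmbedding i) (s : Simplex C k)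
    (h : ∀ v, (s.toFun v).1 ∈ Set.range i) :
    ∃ y : Simplex (C.restrict i) k, push i y = s := by
  have h' : ∀ v, ∃ q : (C.restrict i).Tot, (⟨i q.1, q.2⟩ : C.Tot) = s.toFun v := by
    intro v
    obtain ⟨y, hy⟩ := h v
    generalize s.toFun v = z at hy
    obtain ⟨x, a⟩ := z
    subst hy
    exact ⟨⟨y, a⟩, rfl⟩
  choose q hq using h'
  obtain ⟨f, hc, hf⟩ := s
  obtain rfl : (fun v => (⟨i (q v).1, (q v).2⟩ : C.Tot)) = f := funext hq
  exact ⟨⟨q, hi.continuous_iff.2 hc, fun p => hf p⟩, rfl⟩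

end Simplex

section chains

variable {X Y X' Y' : Type*} [TopologicalSpace X] [TopologicalSpace Y] [TopologicalSpace X']
  [TopologicalSpace Y'] {G G' H : Type*} [Group G] [Group G'] [Group H]

theorem mapDomain_comm {A B B' D : Type*} (p : B → D) (q : A → B) (q' : B' → D) (p' : A → B')
    (h : ∀ a, p (q a) = q' (p' a)) (x : A →₀ ℤ) :
    Finsupp.mapDomain p (Finsupp.mapDomain q x) =
      Finsupp.mapDomain q' (Finsupp.mapDomain p' x) := by
  rw [← Finsupp.mapDomain_comp, ← Finsupp.mapDomain_comp]
  congr 1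
  funext a
  exact h a

/-- The boundary map of singular chains, the alternating sum of the faces. -/
def bdry (C : Cov X G) (k : ℕ) : (Simplex C (k + 1) →₀ ℤ) →+ (Simplex C k →₀ ℤ) :=
  ∑ i : Fin (k + 2), (-1 : ℤ) ^ (i : ℕ) • Finsupp.mapDomain.addMonoidHom (Simplex.face i)

theorem bdry_apply (C : Cov X G) (k : ℕ) (x : Simplex C (k + 1) →₀ ℤ) :
    bdry C k x = ∑ i : Fin (k + 2), (-1 : ℤ) ^ (i : ℕ) • Finsupp.mapDomain (Simplex.face i) x := by
  simp only [bdry, AddMonoidHom.finsetSum_apply, AddMonoidHom.smul_apply,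
    Finsupp.mapDomain.addMonoidHom_apply]

theorem bdry_bdry (C : Cov X G) (k : ℕ) (x : Simplex C (k + 2) →₀ ℤ) :
    bdry C k (bdry C (k + 1) x) = 0 := by
  have h := alternating_sum_sq k
    (fun i => Finsupp.mapDomain.addMonoidHom (M := ℤ) (Simplex.face (C := C) (k := k + 1) i))
    (fun i => Finsupp.mapDomain.addMonoidHom (M := ℤ) (Simplex.face (C := C) (k := k) i))
    (fun i j h x => by
      simp only [Finsupp.mapDomain.addMonoidHom_apply, ← Finsupp.mapDomain_comp]
      congr 1
      funext s
      exact Simplex.face_face i j h s) x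
  rw [bdry_apply, bdry_apply]
  exact h

theorem bdry_mapDomain {C : Cov X G} {C' : Cov X' G'} {k : ℕ}
    (F : Simplex C k → Simplex C' k) (F' : Simplex C (k + 1) → Simplex C' (k + 1))
    (h : ∀ i s, Simplex.face i (F' s) = F (Simplex.face i s)) (x : Simplex C (k + 1) →₀ ℤ) :
    bdry C' k (Finsupp.mapDomain F' x) = Finsupp.mapDomain F (bdry C k x) := by
  rw [bdry_apply, bdry_apply, Finsupp.mapDomain_finsetSum]
  refine Finset.sum_congr rfl fun i _ => ?_
  rw [Finsupp.mapDomain_smul, ← Finsupp.mapDomain_comp, ← Finsupp.mapDomain_comp]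
  congr 2
  funext s
  exact h i s

/-- The singular chain complex of a covering space of `X`: the chains of `X` with `ℤ[G]`
coefficients. -/
def chains (C : Cov X G) : GComplex G where
  X k := Simplex C k →₀ ℤ
  act _ := Finsupp.comapDistribMulAction
  d := bdry C
  d_smul k g x := bdry_mapDomain (g • ·) (g • ·) (fun _ _ => rfl) x
  d_d k x := bdry_bdry C k x

/-- The chain map that is induced by a map of coverings. -/
def chainsMap {φ : G →* G'} {C : Cov X G} {C' : Cov X G'} (m : CovHom φ C C') :
    GHom φ (chains C) (chains C') where
  f _ := Finsupp.mapDomain.addMonoidHom (Simplex.map m)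
  comm _ x := (bdry_mapDomain (Simplex.map m) (Simplex.map m) (fun _ _ => rfl) x).symm
  smul _ g x := mapDomain_comm (Simplex.map m) (g • ·) (φ g • ·) (Simplex.map m)
    (Simplex.map_smul m g) x

/-- The chain map from the chains of a subspace (or of any space over `X`). -/
def chainsPush (C : Cov X G) (i : C(Y, X)) :
    GHom (MonoidHom.id G) (chains (C.restrict i)) (chains C) where
  f _ := Finsupp.mapDomain.addMonoidHom (Simplex.push i)
  comm _ x := (bdry_mapDomain (Simplex.push i) (Simplex.push i) (fun _ _ => rfl) x).symm
  smul _ g x := mapDomain_comm (Simplex.push i) (g • ·) (g • ·) (Simplex.push i)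
    (fun _ => rfl) x

/-! ### Relative chains -/

/-- The singular simplices of the covering that do not lie over the subspace `Y`. They form a
basis of the relative chains of `(X, Y)`. -/
abbrev RelSimplex (C : Cov X G) (i : C(Y, X)) (k : ℕ) :=
  {s : Simplex C k // s ∉ Set.range (Simplex.push i : Simplex (C.restrict i) k → Simplex C k)}

/-- The component in the relative chains of a chain of `X`. -/
def prRel (C : Cov X G) (i : C(Y, X)) (k : ℕ) :
    (Simplex C k →₀ ℤ) →+ (RelSimplex C i k →₀ ℤ) :=
  Finsupp.subtypeDomainAddMonoidHom

/-- The component in the chains of `Y` of a chain of `X`. -/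
def prSub (C : Cov X G) {i : C(Y, X)} (hi : IsEmbedding i) (k : ℕ) :
    (Simplex C k →₀ ℤ) →+ (Simplex (C.restrict i) k →₀ ℤ) :=
  Finsupp.comapDomain.addMonoidHom (Simplex.push_injective hi.injective)

/-- The chain of `X` with the given relative component and vanishing component in `Y`. -/
def extRel (C : Cov X G) (i : C(Y, X)) (k : ℕ) :
    (RelSimplex C i k →₀ ℤ) →+ (Simplex C k →₀ ℤ) :=
  Finsupp.mapDomain.addMonoidHom Subtype.val

theorem prRel_extRel (C : Cov X G) (i : C(Y, X)) (k : ℕ) (x) :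
    prRel C i k (extRel C i k x) = x := by
  ext s
  exact Finsupp.mapDomain_apply Subtype.val_injective x s

theorem prRel_push (C : Cov X G) (i : C(Y, X)) (k : ℕ) (x : Simplex (C.restrict i) k →₀ ℤ) :
    prRel C i k (Finsupp.mapDomain (Simplex.push i) x) = 0 := by
  ext s
  exact Finsupp.mapDomain_of_notMem_range x s.1 s.2

theorem prSub_push (C : Cov X G) {i : C(Y, X)} (hi : IsEmbedding i) (k : ℕ)
    (x : Simplex (C.restrict i) k →₀ ℤ) :
    prSub C hi k (Finsupp.mapDomain (Simplex.push i) x) = x := by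
  ext s
  exact Finsupp.mapDomain_apply (Simplex.push_injective hi.injective) x s

theorem prSub_extRel (C : Cov X G) {i : C(Y, X)} (hi : IsEmbedding i) (k : ℕ) (x) :
    prSub C hi k (extRel C i k x) = 0 := by
  ext s
  refine Finsupp.mapDomain_of_notMem_range x _ ?_
  rintro ⟨t, ht⟩
  exact t.2 ⟨s, ht.symm⟩

theorem rel_decomp (C : Cov X G) {i : C(Y, X)} (hi : IsEmbedding i) (k : ℕ)
    (x : Simplex C k →₀ ℤ) :
    extRel C i k (prRel C i k x) + Finsupp.mapDomain (Simplex.push i) (prSub C hi k x) = x := by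
  ext s
  rw [Finsupp.add_apply]
  by_cases h : s ∈ Set.range (Simplex.push i : Simplex (C.restrict i) k → Simplex C k)
  · obtain ⟨y, rfl⟩ := h
    have h1 : extRel C i k (prRel C i k x) (Simplex.push i y) = 0 := by
      refine Finsupp.mapDomain_of_notMem_range _ _ ?_
      rintro ⟨t, ht⟩
      exact t.2 ⟨y, ht.symm⟩
    rw [h1, zero_add]
    exact Finsupp.mapDomain_apply (Simplex.push_injective hi.injective) _ y
  · rw [Finsupp.mapDomain_of_notMem_range _ _ h, add_zero]
    exact Finsupp.mapDomain_apply Subtype.val_injective _ (⟨s, h⟩ : RelSimplex C i k)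

theorem prSub_mapDomain {C : Cov X G} {C' : Cov X' G'} {i : C(Y, X)} (hi : IsEmbedding i)
    {i' : C(Y', X')} (hi' : IsEmbedding i') {k : ℕ}
    (F : Simplex C k → Simplex C' k) (FY : Simplex (C.restrict i) k → Simplex (C'.restrict i') k)
    (FR : RelSimplex C i k → RelSimplex C' i' k)
    (hY : ∀ y, F (Simplex.push i y) = Simplex.push i' (FY y)) (hR : ∀ s, F s.1 = (FR s).1)
    (x : Simplex C k →₀ ℤ) :
    prSub C' hi' k (Finsupp.mapDomain F x) = Finsupp.mapDomain FY (prSub C hi k x) := by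
  conv_lhs => rw [← rel_decomp C hi k x]
  have h1 : Finsupp.mapDomain F (extRel C i k (prRel C i k x)) =
      extRel C' i' k (Finsupp.mapDomain FR (prRel C i k x)) := by
    simp only [extRel, Finsupp.mapDomain.addMonoidHom_apply]
    rw [← Finsupp.mapDomain_comp, ← Finsupp.mapDomain_comp]
    congr 1
    funext s
    exact hR s
  have h2 : Finsupp.mapDomain F (Finsupp.mapDomain (Simplex.push i) (prSub C hi k x)) =
      Finsupp.mapDomain (Simplex.push i') (Finsupp.mapDomain FY (prSub C hi k x)) := by
    rw [← Finsupp.mapDomain_comp, ← Finsupp.mapDomain_comp]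
    congr 1
    funext s
    exact hY s
  rw [Finsupp.mapDomain_add, map_add, h1, h2, prSub_extRel, prSub_push, zero_add]

theorem prRel_mapDomain {C : Cov X G} {C' : Cov X' G'} {i : C(Y, X)} (hi : IsEmbedding i)
    {i' : C(Y', X')} {k : ℕ}
    (F : Simplex C k → Simplex C' k) (FY : Simplex (C.restrict i) k → Simplex (C'.restrict i') k)
    (FR : RelSimplex C i k → RelSimplex C' i' k)
    (hY : ∀ y, F (Simplex.push i y) = Simplex.push i' (FY y)) (hR : ∀ s, F s.1 = (FR s).1)
    (x : Simplex C k →₀ ℤ) :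
    prRel C' i' k (Finsupp.mapDomain F x) = Finsupp.mapDomain FR (prRel C i k x) := by
  conv_lhs => rw [← rel_decomp C hi k x]
  have h1 : Finsupp.mapDomain F (extRel C i k (prRel C i k x)) =
      extRel C' i' k (Finsupp.mapDomain FR (prRel C i k x)) := by
    simp only [extRel, Finsupp.mapDomain.addMonoidHom_apply]
    rw [← Finsupp.mapDomain_comp, ← Finsupp.mapDomain_comp]
    congr 1
    funext s
    exact hR s
  have h2 : Finsupp.mapDomain F (Finsupp.mapDomain (Simplex.push i) (prSub C hi k x)) =
      Finsupp.mapDomain (Simplex.push i') (Finsupp.mapDomain FY (prSub C hi k x)) := by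
    rw [← Finsupp.mapDomain_comp, ← Finsupp.mapDomain_comp]
    congr 1
    funext s
    exact hY s
  rw [Finsupp.mapDomain_add, map_add, h1, h2, prRel_extRel, prRel_push, add_zero]

instance (C : Cov X G) (i : C(Y, X)) (k : ℕ) : MulAction G (RelSimplex C i k) where
  smul g s := ⟨g • s.1, by
    rintro ⟨y, hy⟩
    exact s.2 ⟨g⁻¹ • y, by rw [Simplex.push_smul, hy, inv_smul_smul]⟩⟩
  one_smul s := Subtype.ext (one_smul G s.1)
  mul_smul g h s := Subtype.ext (mul_smul g h s.1)

/-- The boundary map of the relative chains. -/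
def relBdry (C : Cov X G) (i : C(Y, X)) (k : ℕ) :
    (RelSimplex C i (k + 1) →₀ ℤ) →+ (RelSimplex C i k →₀ ℤ) :=
  ((prRel C i k).comp (bdry C k)).comp (extRel C i (k + 1))

/-- The component in `Y` of the boundary of a relative chain. -/
def subBdry (C : Cov X G) {i : C(Y, X)} (hi : IsEmbedding i) (k : ℕ) :
    (RelSimplex C i (k + 1) →₀ ℤ) →+ (Simplex (C.restrict i) k →₀ ℤ) :=
  ((prSub C hi k).comp (bdry C k)).comp (extRel C i (k + 1))

theorem bdry_extRel (C : Cov X G) {i : C(Y, X)} (hi : IsEmbedding i) (k : ℕ) (x) :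
    bdry C k (extRel C i (k + 1) x) = extRel C i k (relBdry C i k x) +
      Finsupp.mapDomain (Simplex.push i) (subBdry C hi k x) :=
  (rel_decomp C hi k _).symm

theorem bdry_push (C : Cov X G) (i : C(Y, X)) (k : ℕ) (y : Simplex (C.restrict i) (k + 1) →₀ ℤ) :
    bdry C k (Finsupp.mapDomain (Simplex.push i) y) =
      Finsupp.mapDomain (Simplex.push i) (bdry (C.restrict i) k y) :=
  bdry_mapDomain (Simplex.push i) (Simplex.push i) (fun _ _ => rfl) y

theorem relBdry_relBdry (C : Cov X G) {i : C(Y, X)} (hi : IsEmbedding i) (k : ℕ) (x) :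
    relBdry C i k (relBdry C i (k + 1) x) = 0 := by
  have h := bdry_bdry C k (extRel C i (k + 2) x)
  rw [bdry_extRel C hi, map_add, bdry_push] at h
  have h' := congrArg (prRel C i k) h
  rw [map_add, prRel_push, add_zero, map_zero] at h'
  exact h'

theorem subBdry_relBdry (C : Cov X G) {i : C(Y, X)} (hi : IsEmbedding i) (k : ℕ) (x) :
    subBdry C hi k (relBdry C i (k + 1) x) = - bdry (C.restrict i) k (subBdry C hi (k + 1) x) := by
  have h := bdry_bdry C k (extRel C i (k + 2) x)
  rw [bdry_extRel C hi, map_add, bdry_push] at h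
  have h' := congrArg (prSub C hi k) h
  rw [map_add, prSub_push, map_zero] at h'
  exact eq_neg_of_add_eq_zero_left h'

theorem extRel_map {C : Cov X G} {C' : Cov X' G'} {i : C(Y, X)} {i' : C(Y', X')} {k : ℕ}
    (F : Simplex C k → Simplex C' k) (FR : RelSimplex C i k → RelSimplex C' i' k)
    (hR : ∀ s, F s.1 = (FR s).1) (x : RelSimplex C i k →₀ ℤ) :
    extRel C' i' k (Finsupp.mapDomain FR x) = Finsupp.mapDomain F (extRel C i k x) := by
  simp only [extRel, Finsupp.mapDomain.addMonoidHom_apply]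
  rw [← Finsupp.mapDomain_comp, ← Finsupp.mapDomain_comp]
  congr 1
  funext s
  exact (hR s).symm

theorem relBdry_map {C : Cov X G} {C' : Cov X' G'} {i : C(Y, X)} (hi : IsEmbedding i)
    {i' : C(Y', X')}
    (F : ∀ k, Simplex C k → Simplex C' k)
    (FY : ∀ k, Simplex (C.restrict i) k → Simplex (C'.restrict i') k)
    (FR : ∀ k, RelSimplex C i k → RelSimplex C' i' k)
    (hY : ∀ k y, F k (Simplex.push i y) = Simplex.push i' (FY k y))
    (hR : ∀ k s, F k s.1 = (FR k s).1)
    (hF : ∀ k j s, Simplex.face j (F (k + 1) s) = F k (Simplex.face j s))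
    (k : ℕ) (x : RelSimplex C i (k + 1) →₀ ℤ) :
    relBdry C' i' k (Finsupp.mapDomain (FR (k + 1)) x) =
      Finsupp.mapDomain (FR k) (relBdry C i k x) := by
  change prRel C' i' k (bdry C' k (extRel C' i' (k + 1) _)) = _
  rw [extRel_map (F (k + 1)) (FR (k + 1)) (hR _), bdry_mapDomain (F k) (F (k + 1)) (hF k),
    prRel_mapDomain hi (F k) (FY k) (FR k) (hY k) (hR k)]
  rfl

theorem subBdry_map {C : Cov X G} {C' : Cov X' G'} {i : C(Y, X)} (hi : IsEmbedding i)
    {i' : C(Y', X')} (hi' : IsEmbedding i')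
    (F : ∀ k, Simplex C k → Simplex C' k)
    (FY : ∀ k, Simplex (C.restrict i) k → Simplex (C'.restrict i') k)
    (FR : ∀ k, RelSimplex C i k → RelSimplex C' i' k)
    (hY : ∀ k y, F k (Simplex.push i y) = Simplex.push i' (FY k y))
    (hR : ∀ k s, F k s.1 = (FR k s).1)
    (hF : ∀ k j s, Simplex.face j (F (k + 1) s) = F k (Simplex.face j s))
    (k : ℕ) (x : RelSimplex C i (k + 1) →₀ ℤ) :
    subBdry C' hi' k (Finsupp.mapDomain (FR (k + 1)) x) =
      Finsupp.mapDomain (FY k) (subBdry C hi k x) := by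
  change prSub C' hi' k (bdry C' k (extRel C' i' (k + 1) _)) = _
  rw [extRel_map (F (k + 1)) (FR (k + 1)) (hR _), bdry_mapDomain (F k) (F (k + 1)) (hF k),
    prSub_mapDomain hi hi' (F k) (FY k) (FR k) (hY k) (hR k)]
  rfl

/-- The relative singular chain complex of `(X, Y)` with coefficients in the covering. -/
def relChains (C : Cov X G) {i : C(Y, X)} (hi : IsEmbedding i) : GComplex G where
  X k := RelSimplex C i k →₀ ℤ
  act _ := Finsupp.comapDistribMulAction
  d := relBdry C i
  d_smul k g x := relBdry_map hi (fun _ => (g • ·)) (fun _ => (g • ·)) (fun _ => (g • ·))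
    (fun _ _ => rfl) (fun _ _ => rfl) (fun _ _ _ => rfl) k x
  d_d k x := relBdry_relBdry C hi k x

/-- The projection from the chains of `X` to the relative chains. -/
def toRel (C : Cov X G) {i : C(Y, X)} (hi : IsEmbedding i) :
    GHom (MonoidHom.id G) (chains C) (relChains C hi) where
  f := prRel C i
  comm k x := by
    change prRel C i k (bdry C k x) = prRel C i k (bdry C k (extRel C i (k + 1) (prRel C i _ x)))
    conv_lhs => rw [← rel_decomp C hi (k + 1) x, map_add, bdry_push, map_add, prRel_push, add_zero]
  smul k g x := prRel_mapDomain hi (g • ·) (g • ·) (g • ·) (fun _ => rfl) (fun _ => rfl) x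

/-! ### Suspension, pullback and stratified chains -/

/-- The groups of the suspension. -/
def suspX (A : GComplex G) : ℕ → Type _
  | 0 => PUnit
  | k + 1 => A.X k

instance suspGrp (A : GComplex G) : ∀ k, AddCommGroup (suspX A k)
  | 0 => inferInstanceAs (AddCommGroup PUnit)
  | k + 1 => A.grp k

instance suspAct (A : GComplex G) : ∀ k, DistribMulAction G (suspX A k)
  | 0 => inferInstanceAs (DistribMulAction G PUnit)
  | k + 1 => A.act k

/-- The suspension of a complex: the groups are shifted by one degree, and the boundary changes
its sign. -/
def susp (A : GComplex G) : GComplex G where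
  X := suspX A
  d
    | 0 => 0
    | k + 1 => -A.d k
  d_smul
    | 0, _, _ => rfl
    | k + 1, g, x => (congrArg Neg.neg (A.d_smul k g x)).trans (smul_neg g (A.d k x)).symm
  d_d
    | 0, _ => rfl
    | k + 1, x => (congrArg Neg.neg (map_neg (A.d k) (A.d (k + 1) x))).trans
      ((neg_neg (A.d k (A.d (k + 1) x))).trans (A.d_d k x))

/-- The suspension of a chain map. -/
def GHom.susp {φ : G →* G'} {A : GComplex G} {B : GComplex G'} (f : GHom φ A B) :
    GHom φ (DualDec.susp A) (DualDec.susp B) where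
  f
    | 0 => 0
    | k + 1 => f.f k
  comm
    | 0, _ => rfl
    | k + 1, x => (map_neg (f.f k) (A.d k x)).trans (congrArg Neg.neg (f.comm k x))
  smul
    | 0, _, _ => rfl
    | k + 1, g, x => f.smul k g x

/-- The boundary chain map `C_*(X, Y) → C_{*-1}(Y)`. -/
def bdMap (C : Cov X G) {i : C(Y, X)} (hi : IsEmbedding i) :
    GHom (MonoidHom.id G) (relChains C hi) (susp (chains (C.restrict i))) where
  f
    | 0 => 0
    | k + 1 => subBdry C hi k
  comm
    | 0, _ => rfl
    | k + 1, x => subBdry_relBdry C hi k x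
  smul
    | 0, _, _ => rfl
    | k + 1, g, x => subBdry_map hi hi (fun _ => (g • ·)) (fun _ => (g • ·)) (fun _ => (g • ·))
      (fun _ _ => rfl) (fun _ _ => rfl) (fun _ _ _ => rfl) k x

/-- The groups in the pullback of `A → C ← B`. -/
def pullbackSub {l : H →* G} {A C : GComplex G} {B : GComplex H}
    (a : GHom (MonoidHom.id G) A C) (b : GHom l B C) (k : ℕ) : AddSubgroup (A.X k × B.X k) :=
  AddMonoidHom.eqLocus ((a.f k).comp (AddMonoidHom.fst _ _))
    ((b.f k).comp (AddMonoidHom.snd _ _))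

instance pullbackAct {l : H →* G} {A C : GComplex G} {B : GComplex H}
    (a : GHom (MonoidHom.id G) A C) (b : GHom l B C) (k : ℕ) :
    DistribMulAction H (pullbackSub a b k) where
  smul h x := ⟨(l h • x.1.1, h • x.1.2), by
    have hx : a.f k x.1.1 = b.f k x.1.2 := x.2
    change a.f k (l h • x.1.1) = b.f k (h • x.1.2)
    rw [a.smul, b.smul, hx]; rfl⟩
  one_smul x := Subtype.ext (Prod.ext (by change l 1 • x.1.1 = _; rw [map_one, one_smul])
    (one_smul H x.1.2))
  mul_smul g h x := Subtype.ext (Prod.ext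
    (by change l (g * h) • x.1.1 = l g • l h • x.1.1; rw [map_mul, mul_smul])
    (mul_smul g h x.1.2))
  smul_zero h := Subtype.ext (Prod.ext (smul_zero (l h)) (smul_zero h))
  smul_add h x y := Subtype.ext (Prod.ext (smul_add (l h) _ _) (smul_add h _ _))

/-- The pullback of `A → C ← B`, where `A` and `C` are complexes over `ℤ[G]`, which are regarded
as complexes over `ℤ[H]` through `l : H → G`, and `B` is a complex over `ℤ[H]`. -/
def pullback {l : H →* G} {A C : GComplex G} {B : GComplex H}
    (a : GHom (MonoidHom.id G) A C) (b : GHom l B C) : GComplex H where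
  X k := pullbackSub a b k
  d k := (((A.d k).prodMap (B.d k)).comp (pullbackSub a b (k + 1)).subtype).codRestrict
    (pullbackSub a b k) fun x => by
      have hx : a.f (k + 1) x.1.1 = b.f (k + 1) x.1.2 := x.2
      change a.f k (A.d k x.1.1) = b.f k (B.d k x.1.2)
      rw [a.comm, b.comm, hx]
  d_smul k g x := Subtype.ext (Prod.ext (A.d_smul k (l g) x.1.1) (B.d_smul k g x.1.2))
  d_d k x := Subtype.ext (Prod.ext (A.d_d k x.1.1) (B.d_d k x.1.2))

/-- The chain map to a pullback that is given by its two components. -/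
def pullbackLift {K : Type*} [Group K] {P : GComplex K} {l : H →* G} {A C : GComplex G}
    {B : GComplex H} (a : GHom (MonoidHom.id G) A C) (b : GHom l B C)
    {α : K →* G} {β : K →* H} (hαβ : ∀ g, l (β g) = α g)
    (p : GHom α P A) (q : GHom β P B) (h : ∀ k x, a.f k (p.f k x) = b.f k (q.f k x)) :
    GHom β P (pullback a b) where
  f k := ((p.f k).prod (q.f k)).codRestrict (pullbackSub a b k) (h k)
  comm k x := Subtype.ext (Prod.ext (p.comm k x) (q.comm k x))
  smul k g x := Subtype.ext (Prod.ext
    (by change p.f k (g • x) = l (β g) • p.f k x; rw [p.smul, hαβ]) (q.smul k g x))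

/-- The stratified chains `C_*(X, Y; ℤ[l])` for a homomorphism `l : H → G`, a covering `C` of `X`
with group `G`, and a covering `E` of `Y` with group `H` with a map over `l` to the restriction
of `C`: the pullback of `C_*(X, Y; ℤ[G]) → C_{*-1}(Y; ℤ[G]) ← C_{*-1}(Y; ℤ[H])`. -/
def stratChains (C : Cov X G) {i : C(Y, X)} (hi : IsEmbedding i) {l : H →* G} {E : Cov Y H}
    (m : CovHom l E (C.restrict i)) : GComplex H :=
  pullback (bdMap C hi) (chainsMap m).susp

/-- The map of relative singular simplices that is induced by an injective map of pairs
`F : (X, Y) → (X', Y)`, together with a map of coverings. -/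
def relSimplexMap {φ : G →* G'} {C : Cov X G} {i : C(Y, X)} (hi : IsEmbedding i) {C' : Cov X' G'}
    {i' : C(Y, X')} {F : C(X, X')} (hF : Function.Injective F) (hFi : F.comp i = i')
    (m : CovHom φ C (C'.restrict F)) {k : ℕ} (s : RelSimplex C i k) : RelSimplex C' i' k :=
  ⟨Simplex.push F (Simplex.map m s.1), by
    subst hFi
    rintro ⟨y, hy⟩
    refine s.2 (Simplex.exists_push hi s.1 fun v => ⟨(y.toFun v).1, hF ?_⟩)
    exact congrArg Sigma.fst (congrArg (fun z => Simplex.toFun z v) hy)⟩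

theorem simplexMap_aux {φ : G →* G'} {C : Cov X G} {i : C(Y, X)} {C' : Cov X' G'}
    {i' : C(Y, X')} {F : C(X, X')}
    (m : CovHom φ C (C'.restrict F)) (mY : CovHom φ (C.restrict i) (C'.restrict i'))
    (hm : ∀ (y : Y) (a : C.fib (i y)), (⟨i' y, mY.f a⟩ : C'.Tot) = ⟨F (i y), m.f a⟩)
    {k : ℕ} (y : Simplex (C.restrict i) k) :
    Simplex.push F (Simplex.map m (Simplex.push i y)) = Simplex.push i' (Simplex.map mY y) :=
  Simplex.ext' fun v => (hm (y.toFun v).1 (y.toFun v).2).symm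

/-- The chain map of relative chains that is induced by an injective map of pairs
`F : (X, Y) → (X', Y)`, together with a map `m` of coverings, whose restriction to `Y` is `mY`. -/
def relChainsMap {φ : G →* G'} {C : Cov X G} {i : C(Y, X)} (hi : IsEmbedding i) {C' : Cov X' G'}
    {i' : C(Y, X')} (hi' : IsEmbedding i') {F : C(X, X')} (hF : Function.Injective F)
    (hFi : F.comp i = i') (m : CovHom φ C (C'.restrict F))
    (mY : CovHom φ (C.restrict i) (C'.restrict i'))
    (hm : ∀ (y : Y) (a : C.fib (i y)), (⟨i' y, mY.f a⟩ : C'.Tot) = ⟨F (i y), m.f a⟩) :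
    GHom φ (relChains C hi) (relChains C' hi') where
  f _ := Finsupp.mapDomain.addMonoidHom (relSimplexMap hi hF hFi m)
  comm k x := (relBdry_map hi (fun _ s => Simplex.push F (Simplex.map m s))
    (fun _ => Simplex.map mY) (fun _ => relSimplexMap hi hF hFi m)
    (fun _ => simplexMap_aux m mY hm) (fun _ _ => rfl) (fun _ _ _ => rfl) k x).symm
  smul _ g x := mapDomain_comm (relSimplexMap hi hF hFi m) (g • ·) (φ g • ·)
    (relSimplexMap hi hF hFi m) (fun s => Subtype.ext
      (congrArg (Simplex.push F) (Simplex.map_smul m g s.1))) x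

theorem bdMap_relChainsMap {φ : G →* G'} {C : Cov X G} {i : C(Y, X)} (hi : IsEmbedding i)
    {C' : Cov X' G'}
    {i' : C(Y, X')} (hi' : IsEmbedding i') {F : C(X, X')} (hF : Function.Injective F)
    (hFi : F.comp i = i') (m : CovHom φ C (C'.restrict F))
    (mY : CovHom φ (C.restrict i) (C'.restrict i'))
    (hm : ∀ (y : Y) (a : C.fib (i y)), (⟨i' y, mY.f a⟩ : C'.Tot) = ⟨F (i y), m.f a⟩) :
    ∀ k x, (bdMap C' hi').f k ((relChainsMap hi hi' hF hFi m mY hm).f k x) =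
      (chainsMap mY).susp.f k ((bdMap C hi).f k x)
  | 0, _ => rfl
  | k + 1, x => subBdry_map hi hi' (fun _ s => Simplex.push F (Simplex.map m s))
    (fun _ => Simplex.map mY) (fun _ => relSimplexMap hi hF hFi m)
    (fun _ => simplexMap_aux m mY hm) (fun _ _ => rfl) (fun _ _ _ => rfl) k x

end chains

/-! ## Coverings from paths and from monodromy -/

section paths

variable {X : Type*} [TopologicalSpace X] {G : Type*} [Group G]

/-- The group element that a functor from the fundamental groupoid to a group assigns to a path
class. -/
def hol (ρ : FundamentalGroupoid X ⥤ SingleObj G) {x y : X}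
    (p : Path.Homotopic.Quotient x y) : G :=
  ρ.map (X := ⟨x⟩) (Y := ⟨y⟩) p

theorem hol_refl (ρ : FundamentalGroupoid X ⥤ SingleObj G) (x : X) :
    hol ρ (Path.Homotopic.Quotient.refl x) = 1 :=
  ρ.map_id ⟨x⟩

theorem hol_trans (ρ : FundamentalGroupoid X ⥤ SingleObj G) {x y z : X}
    (p : Path.Homotopic.Quotient x y) (q : Path.Homotopic.Quotient y z) :
    hol ρ (p.trans q) = hol ρ q * hol ρ p :=
  ρ.map_comp (X := ⟨x⟩) (Y := ⟨y⟩) (Z := ⟨z⟩) p q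

/-- The homomorphism `π₁(X, w) → G` that is the restriction of a functor from the fundamental
groupoid. -/
def holAt (ρ : FundamentalGroupoid X ⥤ SingleObj G) (w : X) : FundamentalGroup X w →* G where
  toFun p := hol ρ (FundamentalGroup.toPath p)
  map_one' := hol_refl ρ w
  map_mul' p q := hol_trans ρ (FundamentalGroup.toPath q) (FundamentalGroup.toPath p)

/-- The principal covering with a given monodromy: each fibre is a copy of `G`. -/
def holCov (ρ : FundamentalGroupoid X ⥤ SingleObj G) : Cov X G where
  fib _ := G
  act _ := inferInstance
  pull p a := a * hol ρ p
  pull_refl x a := by rw [hol_refl, mul_one]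
  pull_trans p q a := by rw [hol_trans, mul_assoc]
  pull_smul p g a := mul_assoc g a _
  torsor a b := ⟨b * a⁻¹, by simp, fun g hg => by rw [← hg]; simp⟩

/-- Two classes of paths from `x` to the base point are equivalent modulo `K`. -/
def pathSetoid {w : X} (K : Subgroup (FundamentalGroup X w)) (x : X) :
    Setoid (Path.Homotopic.Quotient x w) where
  r a b := ∃ k ∈ K, b = a.trans (FundamentalGroup.toPath k)
  iseqv :=
    { refl := fun a => ⟨1, K.one_mem, (Path.Homotopic.Quotient.trans_refl a).symm⟩
      symm := by
        rintro a b ⟨k, hk, rfl⟩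
        refine ⟨k⁻¹, K.inv_mem hk, ?_⟩
        rw [Path.Homotopic.Quotient.trans_assoc]
        change a = a.trans (k⁻¹ * k : FundamentalGroup X w)
        rw [inv_mul_cancel]
        exact (Path.Homotopic.Quotient.trans_refl a).symm
      trans := by
        rintro a b c ⟨k, hk, rfl⟩ ⟨l, hl, rfl⟩
        exact ⟨l * k, K.mul_mem hl hk, Path.Homotopic.Quotient.trans_assoc _ _ _⟩ }

/-- The covering of `X` that corresponds to a normal subgroup `K` of the fundamental group: the
points over `x` are the classes of paths from `x` to the base point, modulo `K`. -/
def pathCov (w : X) (K : Subgroup (FundamentalGroup X w)) [hK : K.Normal] :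
    Cov X (FundamentalGroup X w ⧸ K) where
  fib x := Quotient (pathSetoid K x)
  act x :=
    { smul := fun g a => Quotient.liftOn₂' g a
        (fun (g : FundamentalGroup X w) a => Quotient.mk (pathSetoid K x)
          (a.trans (FundamentalGroup.toPath g))) (by
        rintro g a g' a' hg ⟨k, hk, rfl⟩
        rw [QuotientGroup.leftRel_apply] at hg
        refine Quotient.sound ⟨g' * k * g⁻¹, ?_, ?_⟩
        · have h1 := K.mul_mem (hK.conj_mem _ hg g) (hK.conj_mem _ hk g)
          have h2 : g * (g⁻¹ * g') * g⁻¹ * (g * k * g⁻¹) = g' * k * g⁻¹ := by group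
          rwa [h2] at h1
        · have h3 : (a.trans (FundamentalGroup.toPath k)).trans (FundamentalGroup.toPath g') =
              a.trans (FundamentalGroup.toPath (g' * k)) :=
            Path.Homotopic.Quotient.trans_assoc _ _ _
          have h4 : (a.trans (FundamentalGroup.toPath g)).trans
              (FundamentalGroup.toPath (g' * k * g⁻¹)) =
              a.trans (FundamentalGroup.toPath (g' * k * g⁻¹ * g)) :=
            Path.Homotopic.Quotient.trans_assoc _ _ _
          rw [inv_mul_cancel_right] at h4
          exact h3.trans h4.symm)
      one_smul := by
        rintro ⟨a⟩
        exact congrArg (Quotient.mk (pathSetoid K x)) (Path.Homotopic.Quotient.trans_refl a)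
      mul_smul := by
        rintro ⟨g⟩ ⟨h⟩ ⟨a⟩
        exact congrArg (Quotient.mk (pathSetoid K x))
          (Path.Homotopic.Quotient.trans_assoc a h g).symm }
  pull p a := Quotient.map (sa := pathSetoid K _) (sb := pathSetoid K _) (fun a => p.trans a)
    (by
      rintro a b ⟨k, hk, rfl⟩
      exact ⟨k, hk, (Path.Homotopic.Quotient.trans_assoc _ _ _).symm⟩) a
  pull_refl x := by
    rintro ⟨a⟩
    exact congrArg (Quotient.mk (pathSetoid K x)) (Path.Homotopic.Quotient.refl_trans a)
  pull_trans p q := by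
    rintro ⟨a⟩
    exact congrArg (Quotient.mk (pathSetoid K _)) (Path.Homotopic.Quotient.trans_assoc p q a)
  pull_smul p := by
    rintro ⟨g⟩ ⟨a⟩
    exact congrArg (Quotient.mk (pathSetoid K _))
      (Path.Homotopic.Quotient.trans_assoc p a g).symm
  torsor := by
    rintro x ⟨a⟩ ⟨b⟩
    have hab : a.trans (a.symm.trans b) = b := by
      rw [← Path.Homotopic.Quotient.trans_assoc, Path.Homotopic.Quotient.trans_symm,
        Path.Homotopic.Quotient.refl_trans]
    refine ⟨QuotientGroup.mk (FundamentalGroup.fromPath (a.symm.trans b)),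
      congrArg (Quotient.mk (pathSetoid K x)) hab, ?_⟩
    rintro ⟨g⟩ hg
    obtain ⟨k, hk, hk'⟩ := Quotient.exact (s := pathSetoid K x) hg
    have hk'' : b = (a.trans (FundamentalGroup.toPath g)).trans (FundamentalGroup.toPath k) := hk'
    have h1 : FundamentalGroup.fromPath (a.symm.trans b) = k * g := by
      rw [hk'', Path.Homotopic.Quotient.trans_assoc, ← Path.Homotopic.Quotient.trans_assoc a.symm,
        Path.Homotopic.Quotient.symm_trans, Path.Homotopic.Quotient.refl_trans]
      rfl
    rw [h1]
    refine QuotientGroup.eq.2 ?_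
    have h2 := hK.conj_mem k hk g⁻¹
    rwa [inv_inv, mul_assoc] at h2

/-- The base point of the covering: the class of the constant path. -/
def pathCovBase (w : X) (K : Subgroup (FundamentalGroup X w)) [K.Normal] : (pathCov w K).fib w :=
  Quotient.mk (pathSetoid K w) (Path.Homotopic.Quotient.refl w)

/-- The point of the covering that is given by a class of paths. -/
def pathCovMk (w : X) (K : Subgroup (FundamentalGroup X w)) [K.Normal] {x : X}
    (a : Path.Homotopic.Quotient x w) : (pathCov w K).fib x :=
  Quotient.mk (pathSetoid K x) a

/-- The quotient map of coverings for an inclusion `K ≤ L`. -/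
def pathCovRed (w : X) {K L : Subgroup (FundamentalGroup X w)} [K.Normal] [L.Normal]
    (h : K ≤ L) : CovHom (QuotientGroup.map K L (MonoidHom.id _) h) (pathCov w K)
      (pathCov w L) where
  f {x} a := Quotient.map (sa := pathSetoid K x) (sb := pathSetoid L x) id
    (fun _ _ ⟨k, hk, e⟩ => ⟨k, h hk, e⟩) a
  smul := by
    rintro x ⟨g⟩ ⟨a⟩
    rfl
  pull := by
    rintro x y p ⟨a⟩
    rfl

/-- The map from a fibre of the covering to `G` that is given by a functor `ρ` on path classes, if
`K` lies in the kernel of `ρ` on the fundamental group. -/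
def pathHol (ρ : FundamentalGroupoid X ⥤ SingleObj G) (w : X)
    {K : Subgroup (FundamentalGroup X w)} [K.Normal] (hK : K ≤ (holAt ρ w).ker) {x : X}
    (a : (pathCov w K).fib x) : G :=
  Quotient.lift (s := pathSetoid K x) (fun a => hol ρ a) (by
    rintro a b ⟨k, hk, rfl⟩
    have h1 : hol ρ (FundamentalGroup.toPath k) = 1 := hK hk
    change hol ρ a = hol ρ (a.trans (FundamentalGroup.toPath k))
    rw [hol_trans, h1, one_mul]) a

/-- For a covering of `X'` given by a monodromy `τ`, a map `F : X → X'`, and a homomorphism `γ`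
with `γ ∘ ρ = τ ∘ F_*`, the map of coverings over `F` from the covering for a subgroup `K` of the
kernel of `ρ` on the fundamental group. -/
def pathCovToHol {X' : Type*} [TopologicalSpace X'] {G' : Type*} [Group G']
    (ρ : FundamentalGroupoid X ⥤ SingleObj G) (τ : FundamentalGroupoid X' ⥤ SingleObj G')
    (γ : G →* G') (F : C(X, X'))
    (hF : ∀ {x y : X} (p : Path.Homotopic.Quotient x y), γ (hol ρ p) = hol τ (p.map F))
    (w : X) {K : Subgroup (FundamentalGroup X w)} [K.Normal] (hK : K ≤ (holAt ρ w).ker) :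
    CovHom (γ.comp (QuotientGroup.lift K (holAt ρ w) hK)) (pathCov w K)
      ((holCov τ).restrict F) where
  f a := (γ (pathHol ρ w hK a) : G')
  smul := by
    rintro x ⟨g⟩ ⟨a⟩
    exact (congrArg γ (hol_trans ρ a (FundamentalGroup.toPath g))).trans (map_mul γ _ _)
  pull := by
    rintro x y p ⟨a⟩
    change γ (hol ρ (p.trans a)) = γ (hol ρ a) * hol τ (p.map F)
    rw [hol_trans, map_mul, ← hF p]

/-! ### Derived quotients -/

/-- The iterated commutator subgroups of the kernel of a homomorphism: the kernel itself for
`n = 0`, and `[K, K]` for `n + 1`, where `K` is the subgroup for `n`. -/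
def kerDerived {P : Type*} [Group P] (f : P →* G) : ℕ → Subgroup P
  | 0 => f.ker
  | n + 1 => ⁅kerDerived f n, kerDerived f n⁆

instance kerDerived_normal {P : Type*} [Group P] (f : P →* G) : ∀ n, (kerDerived f n).Normal
  | 0 => inferInstanceAs f.ker.Normal
  | n + 1 =>
    have := kerDerived_normal f n
    inferInstanceAs (⁅kerDerived f n, kerDerived f n⁆).Normal

theorem kerDerived_succ_le {P : Type*} [Group P] (f : P →* G) (n : ℕ) :
    kerDerived f (n + 1) ≤ kerDerived f n :=
  Subgroup.commutator_le_left _ _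

theorem kerDerived_le_ker {P : Type*} [Group P] (f : P →* G) : ∀ n, kerDerived f n ≤ f.ker
  | 0 => le_rfl
  | n + 1 => (kerDerived_succ_le f n).trans (kerDerived_le_ker f n)

end paths

/-! ## Dual decompositions of 4-manifolds -/

section manifold

variable {N : Type*} [TopologicalSpace N] [ChartedSpace (EuclideanHalfSpace 4) N]

/-- A handlebody structure on the pair `(A, A₀)` with handles of index `≤ 2`, where `A` is a subset
of the 4-manifold `N` and `A₀` is the part of the boundary of `N` that lies in `A`: a collar of
`A₀`, followed by handles of index `0`, then `1`, then `2`. A handle of index `k` is an embedded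
copy of `D^k × D^(4-k)`, which is smoothly embedded away from its attaching region
`S^(k-1) × D^(4-k)`. (At the attaching region the handle has to fit to the corners of the
previous stage.) -/
structure Handlebody (A A₀ : Set N) where
  /-- The sets of handles of index `0`, `1`, `2`. -/
  ι : Fin 3 → Type
  [fin : ∀ k, Fintype (ι k)]
  [dec : ∀ k, DecidableEq (ι k)]
  collar : N × ℝ → N
  collar_cont : ContinuousOn collar (A₀ ×ˢ Icc 0 1)
  collar_inj : InjOn collar (A₀ ×ˢ Icc 0 1)
  collar_zero : ∀ x ∈ A₀, collar (x, 0) = x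
  collar_interior : ∀ x ∈ A₀, ∀ t ∈ Ioc (0 : ℝ) 1, collar (x, t) ∉ (𝓡∂ 4).boundary N
  handle : ∀ k : Fin 3, ι k →
    EuclideanSpace ℝ (Fin k) × EuclideanSpace ℝ (Fin (4 - k)) → N
  handle_cont : ∀ (k : Fin 3) (i : ι k), ContinuousOn (handle k i) (Metric.closedBall 0 1 ×ˢ Metric.closedBall 0 1)
  handle_inj : ∀ (k : Fin 3) (i : ι k), InjOn (handle k i) (Metric.closedBall 0 1 ×ˢ Metric.closedBall 0 1)
  handle_smooth : ∀ (k : Fin 3) (i : ι k),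
    ContMDiffOn 𝓘(ℝ, EuclideanSpace ℝ (Fin k) × EuclideanSpace ℝ (Fin (4 - k))) (𝓡∂ 4) ∞
      (handle k i) (Metric.ball 0 1 ×ˢ Metric.closedBall 0 1)
  handle_immersion : ∀ (k : Fin 3) (i : ι k), ∀ p ∈ Metric.ball (0 : EuclideanSpace ℝ (Fin k)) 1 ×ˢ
      Metric.closedBall (0 : EuclideanSpace ℝ (Fin (4 - k))) 1,
    Function.Injective
      (mfderivWithin 𝓘(ℝ, EuclideanSpace ℝ (Fin k) × EuclideanSpace ℝ (Fin (4 - k))) (𝓡∂ 4)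
        (handle k i) (Metric.ball 0 1 ×ˢ Metric.closedBall 0 1) p)
  handle_interior : ∀ (k : Fin 3) (i : ι k), ∀ p ∈ Metric.closedBall (0 : EuclideanSpace ℝ (Fin k)) 1 ×ˢ
      Metric.closedBall (0 : EuclideanSpace ℝ (Fin (4 - k))) 1,
    handle k i p ∉ (𝓡∂ 4).boundary N
  handle_disjoint : ∀ (k : Fin 3) (i j : ι k), i ≠ j →
    Disjoint (handle k i '' (Metric.closedBall 0 1 ×ˢ Metric.closedBall 0 1))
      (handle k j '' (Metric.closedBall 0 1 ×ˢ Metric.closedBall 0 1))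
  /-- `skel 0` is the collar, and `skel (k + 1)` is the union of `skel k` and the `k`-handles. -/
  skel : ℕ → Set N
  skel_zero : skel 0 = collar '' (A₀ ×ˢ Icc 0 1)
  skel_succ : ∀ k : Fin 3, skel (k + 1) =
    skel k ∪ ⋃ i, handle k i '' (Metric.closedBall 0 1 ×ˢ Metric.closedBall 0 1)
  attach : ∀ (k : Fin 3) (i : ι k), ∀ p ∈ Metric.closedBall (0 : EuclideanSpace ℝ (Fin k)) 1 ×ˢ
      Metric.closedBall (0 : EuclideanSpace ℝ (Fin (4 - k))) 1,
    (handle k i p ∈ skel k ↔ ‖p.1‖ = 1)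
  skel_three : skel 3 = A

attribute [instance] Handlebody.fin Handlebody.dec

/-- The fixed data: a decomposition `∂N = ∂₀M ∪ ∂₀W`, a homomorphism `γ : Γ → π`, where `π` is the
fundamental group of `N`, and a factorization `π₁ ∂₀W → Γ → π₁ N`.

No base points are chosen: a homomorphism from the fundamental group of a space (which may be
disconnected or empty) is given as a functor from its fundamental groupoid. In particular the
group `π` is identified with the fundamental group of `N` by the functor `ρN`. -/
structure BoundaryData (N : Type*) [TopologicalSpace N] [ChartedSpace (EuclideanHalfSpace 4) N]
    (Γ π : Type*) [Group Γ] [Group π] where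
  dM : Set N
  dW : Set N
  union_eq : dM ∪ dW = (𝓡∂ 4).boundary N
  γ : Γ →* π
  ρN : FundamentalGroupoid N ⥤ SingleObj π
  bijective : ∀ x : N, Function.Bijective (holAt ρN x)
  ρdW : FundamentalGroupoid dW ⥤ SingleObj Γ
  factor : ∀ {x y : dW} (p : Path.Homotopic.Quotient x y),
    γ (hol ρdW p) = hol ρN (p.map ⟨Subtype.val, continuous_subtype_val⟩)

variable {Γ π : Type*} [Group Γ] [Group π]

/-- A dual decomposition `N = M ∪ W` that extends the given decomposition of the boundary: `M` and
`W` are the two sides of a smooth hypersurface that is transverse to the boundary of `N`, and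
`(M, ∂₀M)` and `(W, ∂₀W)` have handlebody structures with handles of index `≤ 2`. -/
structure DualDecomposition (B : BoundaryData N Γ π) where
  M : Set N
  W : Set N
  smooth : ∃ F : N → ℝ, ContMDiff (𝓡∂ 4) 𝓘(ℝ, ℝ) ∞ F ∧ W = {x | F x ≤ 0} ∧ M = {x | 0 ≤ F x} ∧
    (∀ x, F x = 0 → mfderiv (𝓡∂ 4) 𝓘(ℝ, ℝ) F x ≠ 0) ∧
    (∀ x ∈ (𝓡∂ 4).boundary N, F x = 0 → ∃ v : EuclideanSpace ℝ (Fin 4), v 0 = 0 ∧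
      (mfderiv (𝓡∂ 4) 𝓘(ℝ, ℝ) F x : EuclideanSpace ℝ (Fin 4) → ℝ) v ≠ 0)
  M_boundary : M ∩ (𝓡∂ 4).boundary N = B.dM
  W_boundary : W ∩ (𝓡∂ 4).boundary N = B.dW
  handlesM : Handlebody M B.dM
  handlesW : Handlebody W B.dW

/-- A `Γ` decomposition: a dual decomposition `N = M ∪ W` with `W` connected, together with a
factorization `π₁ W → Γ → π₁ N`, such that `π₁ W → Γ` is onto, which extends the given
factorization on `∂₀W`. A base point `w` of `W` is chosen for later use. -/
structure GammaDecomposition (B : BoundaryData N Γ π) extends DualDecomposition B where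
  pathConnected : IsPathConnected W
  ρ : FundamentalGroupoid W ⥤ SingleObj Γ
  factor : ∀ {x y : W} (p : Path.Homotopic.Quotient x y),
    B.γ (hol ρ p) = hol B.ρN (p.map ⟨Subtype.val, continuous_subtype_val⟩)
  extends_dW : ∀ {x y : B.dW} (p : Path.Homotopic.Quotient x y),
    hol ρ (p.map ⟨Set.inclusion (W_boundary ▸ Set.inter_subset_left),
      continuous_inclusion _⟩) = hol B.ρdW p
  w : W
  surjective : Function.Surjective (holAt ρ w)

end manifold

/-! ## Simple equivalences -/

section simple

variable {G : Type*} [Group G]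

/-- Matrices that represent `0` in the Whitehead group before stabilization: products of elementary
matrices and of diagonal matrices with entries in `± G`. -/
def simpleMatrices (G : Type*) [Group G] (a : Type*) [Fintype a] [DecidableEq a] :
    Submonoid (Matrix a a (MonoidAlgebra ℤ G)) :=
  Submonoid.closure
    ({A | ∃ i j r, i ≠ j ∧ A = 1 + Matrix.single i j r} ∪
      {A | ∃ v : a → MonoidAlgebra ℤ G, A = Matrix.diagonal v ∧
        ∀ i, ∃ g : G, v i = MonoidAlgebra.single g 1 ∨ v i = -MonoidAlgebra.single g 1})

/-- The matrix (with respect to some bijection of rows and columns) represents the trivial element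
of the Whitehead group of `G`. -/
def WhiteheadTrivial {a b : Type*} [Fintype a] [DecidableEq a]
    (T : Matrix a b (MonoidAlgebra ℤ G)) : Prop :=
  ∃ (e : a ≃ b) (m : ℕ), Matrix.fromBlocks (T.submatrix id e) 0 0 (1 : Matrix (Fin m) (Fin m) _) ∈
    simpleMatrices G (a ⊕ Fin m)

/-- `F` is a simple chain equivalence of based free complexes `A → B` of dimension two, given by
their boundary matrices (the rows are the boundaries of the basis elements): the mapping cone

`A₂ → A₁ ⊕ B₂ → A₀ ⊕ B₁ → B₀`

has a chain contraction `s`, and the torsion of the cone, the class of the matrix of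
`∂ + s : odd chains → even chains`, is trivial in the Whitehead group. -/
def SimpleMatrixMap {a b : Fin 3 → Type*} [∀ k, Fintype (a k)] [∀ k, DecidableEq (a k)]
    [∀ k, Fintype (b k)] [∀ k, DecidableEq (b k)]
    (A₁ : Matrix (a 1) (a 0) (MonoidAlgebra ℤ G)) (A₂ : Matrix (a 2) (a 1) (MonoidAlgebra ℤ G))
    (B₁ : Matrix (b 1) (b 0) (MonoidAlgebra ℤ G)) (B₂ : Matrix (b 2) (b 1) (MonoidAlgebra ℤ G))
    (F : ∀ k, Matrix (a k) (b k) (MonoidAlgebra ℤ G)) : Prop :=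
  A₁ * F 0 = F 1 * B₁ ∧ A₂ * F 1 = F 2 * B₂ ∧
  let d₁ : Matrix (a 0 ⊕ b 1) (b 0) (MonoidAlgebra ℤ G) := Matrix.fromRows (F 0) B₁
  let d₂ : Matrix (a 1 ⊕ b 2) (a 0 ⊕ b 1) (MonoidAlgebra ℤ G) :=
    Matrix.fromBlocks (-A₁) (F 1) 0 B₂
  let d₃ : Matrix (a 2) (a 1 ⊕ b 2) (MonoidAlgebra ℤ G) := Matrix.fromCols (-A₂) (F 2)
  ∃ (s₀ : Matrix (b 0) (a 0 ⊕ b 1) (MonoidAlgebra ℤ G))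
    (s₁ : Matrix (a 0 ⊕ b 1) (a 1 ⊕ b 2) (MonoidAlgebra ℤ G))
    (s₂ : Matrix (a 1 ⊕ b 2) (a 2) (MonoidAlgebra ℤ G)),
    s₀ * d₁ = 1 ∧ d₁ * s₀ + s₁ * d₂ = 1 ∧ d₂ * s₁ + s₂ * d₃ = 1 ∧ d₃ * s₂ = 1 ∧
    WhiteheadTrivial (Matrix.fromBlocks d₁ s₁ 0 d₃)

end simple

/-! ## Solvable quotients and homological equivalences -/

section tower

variable {N : Type*} [TopologicalSpace N] [ChartedSpace (EuclideanHalfSpace 4) N]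
  {Γ π : Type*} [Group Γ] [Group π] {B : BoundaryData N Γ π}

/-- The inclusion of `∂₀W` in `N`. -/
def BoundaryData.inclN (B : BoundaryData N Γ π) : C(B.dW, N) :=
  ⟨Subtype.val, continuous_subtype_val⟩

theorem BoundaryData.inclN_emb (B : BoundaryData N Γ π) : IsEmbedding B.inclN :=
  IsEmbedding.subtypeVal

/-- The universal covering of `N`. -/
abbrev BoundaryData.univCov (B : BoundaryData N Γ π) : Cov N π := holCov B.ρN

namespace GammaDecomposition

/-- The inclusion of `W` in `N`. -/
def incl (D : GammaDecomposition B) : C(D.W, N) := ⟨Subtype.val, continuous_subtype_val⟩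

/-- The inclusion of `∂₀W` in `W`. -/
def inclW (D : GammaDecomposition B) : C(B.dW, D.W) :=
  ⟨Set.inclusion (D.W_boundary ▸ Set.inter_subset_left), continuous_inclusion _⟩

theorem inclW_emb (D : GammaDecomposition B) : IsEmbedding D.inclW :=
  IsEmbedding.inclusion (D.W_boundary ▸ Set.inter_subset_left)

/-- The subgroup `ker(π₁ W → Γ)^(n)`. -/
abbrev K (D : GammaDecomposition B) (n : ℕ) : Subgroup (FundamentalGroup D.W D.w) :=
  kerDerived (holAt D.ρ D.w) n

/-- The group `Γ_n(W) = π₁ W / ker(π₁ W → Γ)^(n)`. -/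
abbrev Gam (D : GammaDecomposition B) (n : ℕ) := FundamentalGroup D.W D.w ⧸ D.K n

/-- The homomorphism `Γ_n(W) → Γ`. -/
def toΓ (D : GammaDecomposition B) (n : ℕ) : D.Gam n →* Γ :=
  QuotientGroup.lift (D.K n) (holAt D.ρ D.w) (kerDerived_le_ker _ n)

/-- The homomorphism `γ_n : Γ_n(W) → π₁ N`. -/
def toπ (D : GammaDecomposition B) (n : ℕ) : D.Gam n →* π := B.γ.comp (D.toΓ n)

/-- The quotient homomorphism `γ_{n+1,n} : Γ_{n+1}(W) → Γ_n(W)`. -/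
def red (D : GammaDecomposition B) (n : ℕ) : D.Gam (n + 1) →* D.Gam n :=
  QuotientGroup.map (D.K (n + 1)) (D.K n) (MonoidHom.id _) (kerDerived_succ_le _ n)

/-- The `Γ_n(W)` covering of `W`. -/
abbrev cov (D : GammaDecomposition B) (n : ℕ) : Cov D.W (D.Gam n) := pathCov D.w (D.K n)

/-- The restriction to `∂₀W` of the `Γ_n(W)` covering. -/
abbrev covB (D : GammaDecomposition B) (n : ℕ) : Cov B.dW (D.Gam n) := (D.cov n).restrict D.inclW

/-- The base point of the `Γ_n(W)` covering. -/
def base (D : GammaDecomposition B) (n : ℕ) : (D.cov n).fib D.w := pathCovBase D.w (D.K n)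

/-- The map on fibres from the `Γ_n(W)` covering to the `Γ` covering (with monodromy `ρ`). -/
def fibΓ (D : GammaDecomposition B) (n : ℕ) {x : D.W} (a : (D.cov n).fib x) : Γ :=
  pathHol D.ρ D.w (kerDerived_le_ker _ n) a

/-- The quotient map from the `Γ_{n+1}(W)` covering to the `Γ_n(W)` covering. -/
def redCov (D : GammaDecomposition B) (n : ℕ) : CovHom (D.red n) (D.cov (n + 1)) (D.cov n) :=
  pathCovRed D.w (kerDerived_succ_le _ n)

/-- The map over `W → N` from the `Γ_n(W)` covering to the universal covering. -/
def covToN (D : GammaDecomposition B) (n : ℕ) :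
    CovHom (D.toπ n) (D.cov n) (B.univCov.restrict D.incl) :=
  pathCovToHol D.ρ B.ρN B.γ D.incl D.factor D.w (kerDerived_le_ker _ n)

/-- The restriction to `∂₀W` of `covToN`. -/
def covBToN (D : GammaDecomposition B) (n : ℕ) :
    CovHom (D.toπ n) (D.covB n) (B.univCov.restrict B.inclN) :=
  (D.covToN n).restrictComp D.inclW

/-- `C_*(W, ∂₀W; ℤ[Γ_n])`. -/
abbrev rel (D : GammaDecomposition B) (n : ℕ) : GComplex (D.Gam n) :=
  relChains (D.cov n) D.inclW_emb

/-- The stratified chains `C_*(N, ∂₀W; ℤ[γ_n])`. -/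
def stratN (D : GammaDecomposition B) (n : ℕ) : GComplex (D.Gam n) :=
  stratChains B.univCov B.inclN_emb (D.covBToN n)

/-- The stratified chains `C_*(W, ∂₀W; ℤ[γ_{n+1,n}])`. -/
def stratW (D : GammaDecomposition B) (n : ℕ) : GComplex (D.Gam (n + 1)) :=
  stratChains (D.cov n) D.inclW_emb ((D.redCov n).restrict D.inclW)

/-- The chain map `C_*(W, ∂₀W; ℤ[Γ_n]) → C_*(N, ∂₀W; ℤ[π₁ N])`. -/
def relToN (D : GammaDecomposition B) (n : ℕ) :
    GHom (D.toπ n) (D.rel n) (relChains B.univCov B.inclN_emb) :=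
  relChainsMap D.inclW_emb B.inclN_emb (F := D.incl) Subtype.val_injective rfl (D.covToN n)
    (D.covBToN n) (fun _ _ => rfl)

theorem bdMap_relToN (D : GammaDecomposition B) (n k : ℕ) (x : (D.rel n).X k) :
    (bdMap B.univCov B.inclN_emb).f k ((D.relToN n).f k x) =
      (chainsMap (D.covBToN n)).susp.f k ((bdMap (D.cov n) D.inclW_emb).f k x) :=
  bdMap_relChainsMap D.inclW_emb B.inclN_emb (F := D.incl) Subtype.val_injective rfl (D.covToN n)
    (D.covBToN n) (fun _ _ => rfl) k x

/-- The chain map `C_*(W, ∂₀W; ℤ[Γ_n]) → C_*(N, ∂₀W; ℤ[γ_n])` to the stratified chains. -/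
def toStratN (D : GammaDecomposition B) (n : ℕ) :
    GHom (MonoidHom.id _) (D.rel n) (D.stratN n) :=
  pullbackLift _ _ (fun _ => rfl) (D.relToN n) (bdMap (D.cov n) D.inclW_emb) (D.bdMap_relToN n)

/-- The singular simplex is the core of the handle. -/
def IsCore (D : GammaDecomposition B) {n : ℕ} {k : Fin 3} (i : D.handlesW.ι k)
    (s : RelSimplex (D.cov n) D.inclW k) : Prop :=
  ∃ η : Δ k ≃ₜ Metric.closedBall (0 : EuclideanSpace ℝ (Fin k)) 1,
    ∀ t, ((s.1.toFun t).1 : N) = D.handlesW.handle k i (η t, 0)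

/-- The chain is a chain of the subset `A`. -/
def SupportedIn (D : GammaDecomposition B) {n k : ℕ} (A : Set N) (x : (D.rel n).X k) : Prop :=
  ∀ s ∈ Finsupp.support (x : RelSimplex (D.cov n) D.inclW k →₀ ℤ),
    ∀ t, ((s.1.toFun t).1 : N) ∈ A

/-- The relative chain that consists of one singular simplex. -/
def relBasis (D : GammaDecomposition B) {n k : ℕ} (s : RelSimplex (D.cov n) D.inclW k) :
    (D.rel n).X k :=
  (Finsupp.single s 1 : RelSimplex (D.cov n) D.inclW k →₀ ℤ)

/-- The chain represents the class of the `k`-handle in `H_k(W^(k), W^(k-1); ℤ[Γ_n])`, for some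
lift of the core to the covering and some orientation of the core: it is the sum of the core, a
chain of `W^(k-1)`, and a boundary in `W^(k)`. -/
def IsHandleChain (D : GammaDecomposition B) {n : ℕ} {k : Fin 3} (i : D.handlesW.ι k)
    (x : (D.rel n).X k) : Prop :=
  ∃ s : RelSimplex (D.cov n) D.inclW k, D.IsCore i s ∧
    ∃ (y : (D.rel n).X k) (z : (D.rel n).X (k + 1)),
      D.SupportedIn (D.handlesW.skel k) y ∧ D.SupportedIn (D.handlesW.skel (k + 1)) z ∧
      x = D.relBasis s + y + (D.rel n).d k z

/-- The based free chain complex of the handlebody `(W, ∂₀W)` with coefficients `ℤ[Γ_n]`, whose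
groups are `H_k(W^(k), W^(k-1); ℤ[Γ_n])` with the bases that are given by the handles, together
with a chain map `u` to the singular chains of `(W, ∂₀W)` that carries each basis element to a
representative of its class. -/
structure HandleComplex (D : GammaDecomposition B) (n : ℕ) where
  A₁ : Matrix (D.handlesW.ι 1) (D.handlesW.ι 0) (MonoidAlgebra ℤ (D.Gam n))
  A₂ : Matrix (D.handlesW.ι 2) (D.handlesW.ι 1) (MonoidAlgebra ℤ (D.Gam n))
  u₀ : D.handlesW.ι 0 → (D.rel n).X 0
  u₁ : D.handlesW.ι 1 → (D.rel n).X 1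
  u₂ : D.handlesW.ι 2 → (D.rel n).X 2
  d_one : ∀ i, (D.rel n).d 0 (u₁ i) = ∑ j, ringAct (A₁ i j) (u₀ j)
  d_two : ∀ i, (D.rel n).d 1 (u₂ i) = ∑ j, ringAct (A₂ i j) (u₁ j)
  core₀ : ∀ i, D.IsHandleChain (k := 0) i (u₀ i)
  core₁ : ∀ i, D.IsHandleChain (k := 1) i (u₁ i)
  core₂ : ∀ i, D.IsHandleChain (k := 2) i (u₂ i)

end GammaDecomposition

open GammaDecomposition in
/-- A chain map `f : C_*(W, ∂₀W; ℤ[Γ_n]) → C_*(W', ∂₀W; ℤ[Γ_n])` is simple if the corresponding map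
of the based chain complexes of the handlebodies is a simple equivalence. -/
def IsSimple {D D' : GammaDecomposition B} {n : ℕ} (φ : D.Gam n ≃* D'.Gam n)
    (f : GHom φ.toMonoidHom (D.rel n) (D'.rel n)) : Prop :=
  ∃ (P : HandleComplex D n) (P' : HandleComplex D' n)
    (F : ∀ k, Matrix (D.handlesW.ι k) (D'.handlesW.ι k) (MonoidAlgebra ℤ (D'.Gam n)))
    (η₀ : D.handlesW.ι 0 → (D'.rel n).X 1) (η₁ : D.handlesW.ι 1 → (D'.rel n).X 2)
    (η₂ : D.handlesW.ι 2 → (D'.rel n).X 3),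
    let A₁ := P.A₁.map (MonoidAlgebra.mapDomainRingHom ℤ φ.toMonoidHom)
    let A₂ := P.A₂.map (MonoidAlgebra.mapDomainRingHom ℤ φ.toMonoidHom)
    SimpleMatrixMap A₁ A₂ P'.A₁ P'.A₂ F ∧
    (∀ i, f.f 0 (P.u₀ i) - ∑ j, ringAct (F 0 i j) (P'.u₀ j) = (D'.rel n).d 0 (η₀ i)) ∧
    (∀ i, f.f 1 (P.u₁ i) - ∑ j, ringAct (F 1 i j) (P'.u₁ j) =
      (D'.rel n).d 1 (η₁ i) + ∑ j, ringAct (A₁ i j) (η₀ j)) ∧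
    (∀ i, f.f 2 (P.u₂ i) - ∑ j, ringAct (F 2 i j) (P'.u₂ j) =
      (D'.rel n).d 2 (η₂ i) + ∑ j, ringAct (A₂ i j) (η₁ j))

/-- An isomorphism `φ : Γ_n(W) ≅ Γ_n(W')` that commutes with the homomorphisms to `Γ` and with the
homomorphisms from `π₁ ∂₀W`. Since `∂₀W` may be empty or disconnected, the latter is expressed by
an isomorphism `θ` over `φ` of the restrictions to `∂₀W` of the coverings of `W` and of `W'`, which
is compatible with the maps to the given `Γ` covering of `∂₀W`. -/
structure GroupEquivalence (D D' : GammaDecomposition B) (n : ℕ) where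
  φ : D.Gam n ≃* D'.Gam n
  φ_Γ : ∀ a, D'.toΓ n (φ a) = D.toΓ n a
  θ : CovHom φ.toMonoidHom (D.covB n) (D'.covB n)
  θ_Γ : ∀ (y : B.dW) (a : (D.covB n).fib y),
    D'.fibΓ n (x := D'.inclW y) (θ.f a) = D.fibΓ n (x := D.inclW y) a

theorem GroupEquivalence.toπ_φ {D D' : GammaDecomposition B} {n : ℕ}
    (E : GroupEquivalence D D' n) (a : D.Gam n) :
    D'.toπ n (E.φ.toMonoidHom a) = D.toπ n a :=
  congrArg B.γ (E.φ_Γ a)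

theorem GroupEquivalence.susp_θ {D D' : GammaDecomposition B} {n : ℕ}
    (E : GroupEquivalence D D' n) : ∀ k (y : (susp (chains (D.covB n))).X k),
    (chainsMap (D'.covBToN n)).susp.f k ((chainsMap E.θ).susp.f k y) =
      (chainsMap (D.covBToN n)).susp.f k y
  | 0, _ => rfl
  | k + 1, y => by
    refine (Finsupp.mapDomain_comp (f := Simplex.map E.θ)
      (g := Simplex.map (D'.covBToN n)) (v := (y : Simplex (D.covB n) k →₀ ℤ))).symm.trans ?_
    refine congrArg (fun F => Finsupp.mapDomain F (y : Simplex (D.covB n) k →₀ ℤ)) ?_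
    funext s
    exact Simplex.ext' fun v => Sigma.ext rfl
      (heq_of_eq (congrArg B.γ (E.θ_Γ (s.toFun v).1 (s.toFun v).2)))

/-- The chain map `C_*(W, ∂₀W; ℤ[Γ_n]) → C_*(N, ∂₀W; ℤ[γ_n])`, where the groups `Γ_n` of `W` and of
`W'` are identified: its target is the stratified chain complex that is defined by `W'`. -/
def GroupEquivalence.toStratN {D D' : GammaDecomposition B} {n : ℕ}
    (E : GroupEquivalence D D' n) : GHom E.φ.toMonoidHom (D.rel n) (D'.stratN n) :=
  pullbackLift _ _ E.toπ_φ (D.relToN n)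
    ((bdMap (D.cov n) D.inclW_emb).compLin (chainsMap E.θ).susp)
    (fun k x => (D.bdMap_relToN n k x).trans (E.susp_θ k _).symm)

/-- A homological `Γ_n` equivalence `(φ, f)`. -/
structure HomologicalEquivalence (D D' : GammaDecomposition B) (n : ℕ) extends
    GroupEquivalence D D' n where
  f : GHom φ.toMonoidHom (D.rel n) (D'.rel n)
  f_equivalence : f.IsEquivalence
  f_simple : IsSimple φ f
  f_comm : Nonempty (GHomotopy φ.toMonoidHom (A := D.rel n) (B := D'.stratN n)
    (fun k => ((D'.toStratN n).f k).comp (f.f k)) toGroupEquivalence.toStratN.f)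

namespace HomologicalEquivalence

variable {D D' : GammaDecomposition B} {n : ℕ}

/-- A chain map `g : C_*(W; ℤ[Γ_n]) → C_*(W'; ℤ[Γ_n])` which is the identity on the chains of `∂₀W`
and induces `f` on the relative chains. -/
structure AbsoluteMap (E : HomologicalEquivalence D D' n) where
  g : GHom E.φ.toMonoidHom (chains (D.cov n)) (chains (D'.cov n))
  sub : ∀ k y, g.f k ((chainsPush (D.cov n) D.inclW).f k y) =
    (chainsPush (D'.cov n) D'.inclW).f k ((chainsMap E.θ).f k y)
  rel : ∀ k x, (toRel (D'.cov n) D'.inclW_emb).f k (g.f k x) =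
    E.f.f k ((toRel (D.cov n) D.inclW_emb).f k x)

/-- A lift of `φ` to an isomorphism `Γ_{n+1}(W) ≅ Γ_{n+1}(W')`, together with a lift of the
identification `θ` of the coverings of `∂₀W`. -/
structure Lift (E : HomologicalEquivalence D D' n) where
  φ : D.Gam (n + 1) ≃* D'.Gam (n + 1)
  φ_lift : ∀ a, D'.red n (φ a) = E.φ (D.red n a)
  θ : CovHom φ.toMonoidHom (D.covB (n + 1)) (D'.covB (n + 1))
  θ_lift : ∀ (y : B.dW) (a : (D.covB (n + 1)).fib y),
    (D'.redCov n).f (x := D'.inclW y) (θ.f a) = E.θ.f ((D.redCov n).f (x := D.inclW y) a)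

variable {E : HomologicalEquivalence D D' n}

/-- The chain that consists of one singular simplex. -/
def chainBasis {X G : Type*} [TopologicalSpace X] [Group G] (C : Cov X G) {k : ℕ}
    (s : Simplex C k) : (chains C).X k :=
  (Finsupp.single s 1 : Simplex C k →₀ ℤ)

/-- The chain `c` of the `Γ_n` covering of `W'` connects the base point to the image under `g` of
the base point of the `Γ_n` covering of `W`. -/
def AbsoluteMap.IsConnecting (g : AbsoluteMap E) (c : (chains (D'.cov n)).X 1) : Prop :=
  (chains (D'.cov n)).d 0 c =
    g.g.f 0 (chainBasis _ (Simplex.point ⟨D.w, D.base n⟩)) -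
      chainBasis _ (Simplex.point ⟨D'.w, D'.base n⟩)

/-- The image in the chains of the `Γ_n` covering of a path (singular `1`-simplex) in the
`Γ_{n+1}` covering. -/
def pathChain (D : GammaDecomposition B) (n : ℕ) (S : Simplex (D.cov (n + 1)) 1) :
    (chains (D.cov n)).X 1 :=
  chainBasis _ (Simplex.map (D.redCov n) S)

/-- `S` is a path in the `Γ_{n+1}` covering from the point `z` to the base point. -/
def IsPathFrom (D : GammaDecomposition B) (n : ℕ) (S : Simplex (D.cov (n + 1)) 1)
    (z : (D.cov (n + 1)).Tot) : Prop :=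
  S.toFun (stdSimplex.vertex 0) = z ∧ S.toFun (stdSimplex.vertex 1) = ⟨D.w, D.base (n + 1)⟩

/-- The lift is induced by `g`: for a path `S` from `a • base` to the base point in the `Γ_{n+1}`
covering of `W`, and a path `S'` from `φ a • base` to the base point in that of `W'`, the chains
`g S` and `S' + c - φ(a) c` of the `Γ_n` covering are homologous; and for a path `S` from a
point `b` over `∂₀W`, and a path `S'` from `θ b`, the chains `g S` and `S' + c` are homologous. -/
def Lift.IsInduced (L : Lift E) (g : AbsoluteMap E) (c : (chains (D'.cov n)).X 1) : Prop :=
  (∀ (a : D.Gam (n + 1)) S S',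
    IsPathFrom D n S ⟨D.w, a • D.base (n + 1)⟩ →
    IsPathFrom D' n S' ⟨D'.w, L.φ a • D'.base (n + 1)⟩ →
    ∃ z, g.g.f 1 (pathChain D n S) - (pathChain D' n S' + c - E.φ (D.red n a) • c) =
      (chains (D'.cov n)).d 1 z) ∧
  (∀ (y : B.dW) (b : (D.covB (n + 1)).fib y) S S',
    IsPathFrom D n S ⟨D.inclW y, b⟩ →
    IsPathFrom D' n S' ⟨D'.inclW y, L.θ.f b⟩ →
    ∃ z, g.g.f 1 (pathChain D n S) - (pathChain D' n S' + c) = (chains (D'.cov n)).d 1 z)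

/-- `f` lifts to an equivalence of stratified chains over `φ̂`: there is a chain map `f'` that is
chain homotopic to `f`, and a chain homotopy equivalence of stratified chains over `ℤ[φ̂]`, whose
components are `f'` and the map of the chains of `∂₀W` that is induced by `θ̂`. -/
def Lift.HasStratifiedLift (L : Lift E) : Prop :=
  ∃ f' : GHom E.φ.toMonoidHom (D.rel n) (D'.rel n),
    Nonempty (GHomotopy E.φ.toMonoidHom f'.f E.f.f) ∧
    ∃ F : GHom L.φ.toMonoidHom (D.stratW n) (D'.stratW n),
      (∀ k (x : (D.stratW n).X k), (F.f k x).1.1 = f'.f k x.1.1 ∧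
        (F.f k x).1.2 = (chainsMap L.θ).susp.f k x.1.2) ∧
      F.IsEquivalence

end HomologicalEquivalence

end tower

end

end DualDec

/-!
The coverings of `W` are described by paths to the base point, so that everything about `Γ_{n+1}`
can be read off from chains of the `Γ_n` covering. Let `K = ker(π₁W → Γ)^(n)`, so that `Γ_n` is the
quotient by `K` and `Γ_{n+1}` is the quotient by `[K, K]`. A point `z` of the `Γ_{n+1}` covering is
represented by a path to the base point, and the image of its lift in the chains of the `Γ_n`
covering, modulo boundaries, is a class `ptClass z` in `C₁ / ∂C₂`. The Hurewicz theorem for the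
`Γ_n` covering, `K / [K, K] ≅ H₁`, says that this class determines `z` (`liftClass_injective`), and
that every class whose boundary is the base point minus a point occurs (`exists_liftClass`).

The absolute map `g` exists since the homotopy that makes `f` compatible with the stratified chains
of `N` has a component in the suspended chains of `∂₀W`. This component is the homotopy between the
boundary maps of the relative chains which is needed to assemble a map of absolute chains from `f`
and `θ` (`absoluteMap`).

A connecting chain exists if `g(w)` has augmentation one, because the covering is connected. If
`∂₀W` is not empty, `w` can be joined to a point of `∂₀W`, where `g` is given by `θ`; if it is
empty, the relative chains are absolute, and the augmentation can be computed in `N`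
(`AbsoluteMap.aug_base`).

The condition that a pair `(φ̂, θ̂)` is induced by `g` and `c` prescribes the classes of the points
`φ̂(a)` and `θ̂(b)` (`Lift.isInduced_iff`). Hence such a pair is unique, and it exists, is
multiplicative and is compatible with transport by calculations with classes. It is bijective
because `g` induces an isomorphism of first homology groups, by the five lemma for the sequence of
the pair `(W, ∂₀W)` (`ShortExactMap.cl_injective`, `ShortExactMap.cl_surjective`). The difference of
two connecting chains is a `1`-cycle, hence the class of an element `κ` of the kernel of
`Γ_{n+1} → Γ_n`, and the two induced pairs differ by `κ`.

For the stratified chains, the collar of `∂₀W` gives an equivariant section of the boundary map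
`C_{k+1}(W, ∂₀W) → C_k(∂₀W)` of graded groups (`collarSection`): a simplex of `∂₀W` is joined to the
end of the collar. With this section, `f` is deformed to a chain map that commutes strictly with the
boundary maps to the chains of `∂₀W`, and the algebraic form of Dold's theorem
(`exists_inverse_over`) makes it a chain homotopy equivalence relative to these chains. An
equivalence of this kind extends by any isomorphism of the second components to an equivalence of
the pullbacks that define the stratified chains (`pullbackMap_isEquivalence`).
-/

namespace DualDec

open HomologicalEquivalence (chainBasis)

noncomputable section

/-! ### Coordinates of faces of standard simplices -/

theorem stdSimplex_map_injective_apply {k l : ℕ} {f : Fin (k + 1) → Fin (l + 1)}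
    (hf : Function.Injective f) (t : Δ k) (j : Fin (k + 1)) :
    stdSimplex.map f t (f j) = t j := by
  rw [stdSimplex.map_coe, FunOnFinite.linearMap_apply_apply]
  rw [Finset.sum_eq_single j]
  · intro b hb hbj
    exact absurd (hf (Finset.mem_filter.1 hb).2) hbj
  · intro h
    simp at h

theorem stdSimplex_map_apply_of_notMem {k l : ℕ} {f : Fin (k + 1) → Fin (l + 1)}
    (t : Δ k) (j : Fin (l + 1)) (hj : ∀ i, f i ≠ j) : stdSimplex.map f t j = 0 := by
  rw [stdSimplex.map_coe, FunOnFinite.linearMap_apply_apply]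
  refine Finset.sum_eq_zero fun b hb => absurd (Finset.mem_filter.1 hb).2 (hj b)

theorem stdSimplex_face_same {k : ℕ} (i : Fin (k + 2)) (t : Δ k) :
    stdSimplex.map i.succAbove t i = 0 :=
  stdSimplex_map_apply_of_notMem t i fun j => Fin.succAbove_ne i j

theorem stdSimplex_face_succAbove {k : ℕ} (i : Fin (k + 2)) (t : Δ k) (j : Fin (k + 1)) :
    stdSimplex.map i.succAbove t (i.succAbove j) = t j :=
  stdSimplex_map_injective_apply Fin.succAbove_right_injective t j

instance (k : ℕ) : ContractibleSpace (Δ k) :=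
  (convex_stdSimplex ℝ (Fin (k + 1))).contractibleSpace ⟨_, single_mem_stdSimplex ℝ 0⟩

/-! ### Lifts of singular simplices -/

section lifts

variable {X : Type*} [TopologicalSpace X] {G : Type*} [Group G] {C : Cov X G} {k : ℕ}

/-- A lift of a singular simplex to a covering is determined by its value at one point. -/
theorem Simplex.ext_point {s t : Simplex C k} (h : ∀ v, (s.toFun v).1 = (t.toFun v).1) (v₀ : Δ k)
    (h₀ : s.toFun v₀ = t.toFun v₀) : s = t := by
  obtain ⟨f, hf, pf⟩ := s
  obtain ⟨f', hf', pf'⟩ := t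
  obtain ⟨τ, a, rfl⟩ : ∃ (τ : Δ k → X) (a : ∀ v, C.fib (τ v)), f = fun v => ⟨τ v, a v⟩ :=
    ⟨fun v => (f v).1, fun v => (f v).2, rfl⟩
  obtain ⟨τ', a', rfl⟩ : ∃ (τ : Δ k → X) (a : ∀ v, C.fib (τ v)), f' = fun v => ⟨τ v, a v⟩ :=
    ⟨fun v => (f' v).1, fun v => (f' v).2, rfl⟩
  obtain rfl : τ = τ' := funext h
  have h₁ : a v₀ = a' v₀ := by simpa using h₀
  refine Simplex.ext' fun v => Sigma.ext rfl (heq_of_eq ?_)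
  have p : Path v v₀ := PathConnectedSpace.somePath v v₀
  have e := pf p
  have e' := pf' p
  simp only at e e'
  change a v = a' v
  rw [← e, ← e', h₁]

/-- The transport of a point depends only on the underlying map of the path: the starting points of
the two paths need not agree definitionally. -/
theorem Cov.tot_pull_eq (C : Cov X G) {x x' y : X} (p : Path x y) (p' : Path x' y)
    (h : ∀ t, p t = p' t) (a : C.fib y) :
    (⟨x, C.pull (.mk p) a⟩ : C.Tot) = ⟨x', C.pull (.mk p') a⟩ := by
  obtain rfl : x = x' := by rw [← p.source, ← p'.source, h]
  obtain rfl : p = p' := Path.ext (funext h)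
  rfl

/-- The lift of a singular simplex that has the given value at the point `v`. -/
def Simplex.lift (C : Cov X G) (τ : C(Δ k, X)) (v : Δ k) {x : X} (hx : x = τ v) (a : C.fib x) :
    Simplex C k where
  toFun t := ⟨τ t, C.pull (.mk (((PathConnectedSpace.somePath t v).map τ.continuous).cast rfl hx))
    a⟩
  cont := τ.continuous
  compat {s t} p := by
    subst hx
    simp only [Path.cast_rfl_rfl]
    rw [← C.pull_trans]
    refine congrArg (fun q => C.pull q a) ?_
    rw [← Path.Homotopic.Quotient.mk_trans]
    have h : Path.Homotopic (p.trans (PathConnectedSpace.somePath t v))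
        (PathConnectedSpace.somePath s v) := SimplyConnectedSpace.paths_homotopic _ _
    have h' := h.map τ
    rw [Path.map_trans] at h'
    exact Path.Homotopic.Quotient.eq.2 h'

theorem Simplex.lift_self (τ : C(Δ k, X)) (v : Δ k) {x : X} (hx : x = τ v) (a : C.fib x) :
    (Simplex.lift C τ v hx a).toFun v = ⟨x, a⟩ := by
  subst hx
  refine Sigma.ext rfl (heq_of_eq ?_)
  have h : Path.Homotopic (PathConnectedSpace.somePath v v) (Path.refl v) :=
    SimplyConnectedSpace.paths_homotopic _ _
  have h' := Path.Homotopic.Quotient.eq.2 (h.map τ)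
  simp only [Simplex.lift, Path.cast_rfl_rfl]
  rw [h']
  exact C.pull_refl _ a

/-- The value of a singular simplex at `t` is the transport of its value at `v` along the image of
any path from `t` to `v`. -/
theorem Simplex.toFun_eq_pull (s : Simplex C k) {t v : Δ k} (p : Path t v) :
    s.toFun t = ⟨_, C.pull (.mk (p.map s.cont)) (s.toFun v).2⟩ := by
  rw [s.compat p]

/-! ### Singular simplices that are given by paths -/

/-- The coordinate on the standard `1`-simplex. -/
def coord : C(Δ 1, I) := ⟨stdSimplexHomeomorphUnitInterval, map_continuous _⟩

theorem coord_coe (t : Δ 1) : (coord t : ℝ) = t 1 := rfl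

@[simp] theorem coord_zero : coord (stdSimplex.vertex 0) = 0 := rfl

@[simp] theorem coord_one : coord (stdSimplex.vertex 1) = 1 := rfl

/-- The path in the standard `1`-simplex from the vertex `0` to the vertex `1`. -/
def stdPath : Path (stdSimplex.vertex (S := ℝ) (0 : Fin 2)) (stdSimplex.vertex 1) where
  toFun t := stdSimplexHomeomorphUnitInterval.symm t
  continuous_toFun := map_continuous _
  source' := (Homeomorph.symm_apply_eq _).2 rfl
  target' := (Homeomorph.symm_apply_eq _).2 rfl

@[simp] theorem coord_stdPath (t : I) : coord (stdPath t) = t :=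
  stdSimplexHomeomorphUnitInterval.apply_symm_apply t

theorem stdPath_coord (t : Δ 1) : stdPath (coord t) = t :=
  stdSimplexHomeomorphUnitInterval.symm_apply_apply t

/-- The singular `1`-simplex that lifts the path `r` and ends at the point `a` of the covering. -/
def pathSimplex (C : Cov X G) {x y : X} (r : Path x y) (a : C.fib y) : Simplex C 1 :=
  Simplex.lift C (r.toContinuousMap.comp coord) (stdSimplex.vertex 1) (by simp) a

theorem pathSimplex_fst {x y : X} (r : Path x y) (a : C.fib y) (t : Δ 1) :
    ((pathSimplex C r a).toFun t).1 = r (coord t) := rfl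

theorem pathSimplex_one {x y : X} (r : Path x y) (a : C.fib y) :
    (pathSimplex C r a).toFun (stdSimplex.vertex 1) = ⟨y, a⟩ :=
  Simplex.lift_self ..

theorem Simplex.toFun_eq_pull_of_eq (s : Simplex C k) {t v : Δ k} (p : Path t v) {x y : X}
    (r : Path x y) (hr : ∀ u, (s.toFun (p u)).1 = r u) {a : C.fib y} (ha : s.toFun v = ⟨y, a⟩) :
    s.toFun t = ⟨x, C.pull (.mk r) a⟩ := by
  have h := s.toFun_eq_pull p
  obtain ⟨f, hf, pf⟩ := s
  obtain ⟨τ, b, rfl⟩ : ∃ (τ : Δ k → X) (a : ∀ v, C.fib (τ v)), f = fun v => ⟨τ v, a v⟩ :=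
    ⟨fun v => (f v).1, fun v => (f v).2, rfl⟩
  simp only [Sigma.mk.injEq] at ha
  obtain ⟨rfl, ha⟩ := ha
  obtain rfl := eq_of_heq ha
  exact h.trans (C.tot_pull_eq _ _ hr _)

theorem pathSimplex_zero {x y : X} (r : Path x y) (a : C.fib y) :
    (pathSimplex C r a).toFun (stdSimplex.vertex 0) = ⟨x, C.pull (.mk r) a⟩ :=
  Simplex.toFun_eq_pull_of_eq _ stdPath r (fun u => congrArg r (coord_stdPath u))
    (pathSimplex_one r a)

theorem eq_pathSimplex {s : Simplex C 1} {x y : X} (r : Path x y) (a : C.fib y)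
    (h : ∀ t, (s.toFun t).1 = r (coord t)) (h₁ : s.toFun (stdSimplex.vertex 1) = ⟨y, a⟩) :
    s = pathSimplex C r a :=
  Simplex.ext_point h _ (h₁.trans (pathSimplex_one r a).symm)

theorem exists_pathSimplex (s : Simplex C 1) :
    ∃ (x y : X) (r : Path x y) (a : C.fib y), s = pathSimplex C r a :=
  ⟨_, _, stdPath.map s.cont, (s.toFun (stdSimplex.vertex 1)).2,
    eq_pathSimplex _ _ (fun t => by
      change _ = (s.toFun (stdPath (coord t))).1
      rw [stdPath_coord]) rfl⟩

theorem smul_pathSimplex (g : G) {x y : X} (r : Path x y) (a : C.fib y) :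
    g • pathSimplex C r a = pathSimplex C r (g • a) := by
  refine eq_pathSimplex _ _ (fun t => rfl) ?_
  change (⟨((pathSimplex C r a).toFun _).1, g • ((pathSimplex C r a).toFun _).2⟩ : C.Tot) = _
  rw [pathSimplex_one]

theorem map_pathSimplex {G' : Type*} [Group G'] {φ : G →* G'} {C' : Cov X G'}
    (m : CovHom φ C C') {x y : X} (r : Path x y) (a : C.fib y) :
    (pathSimplex C r a).map m = pathSimplex C' r (m.f a) := by
  refine eq_pathSimplex _ _ (fun t => rfl) ?_
  change (⟨((pathSimplex C r a).toFun _).1, m.f ((pathSimplex C r a).toFun _).2⟩ : C'.Tot) = _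
  rw [pathSimplex_one]

theorem push_pathSimplex {Y : Type*} [TopologicalSpace Y] (i : C(Y, X)) {x y : Y} (r : Path x y)
    (a : (C.restrict i).fib y) :
    (pathSimplex (C.restrict i) r a).push i =
      pathSimplex C (r.map i.continuous) (show C.fib (i y) from a) := by
  refine eq_pathSimplex _ _ (fun t => rfl) ?_
  change (⟨i ((pathSimplex (C.restrict i) r a).toFun _).1,
    ((pathSimplex (C.restrict i) r a).toFun _).2⟩ : C.Tot) = _
  rw [pathSimplex_one]

theorem Simplex.face_eq_point_of_face {s : Simplex C 1} (i : Fin 2) (j : Fin 2)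
    (hij : i.succAbove 0 = j) :
    Simplex.face i s = Simplex.point (s.toFun (stdSimplex.vertex j)) := by
  refine Simplex.ext' fun v => ?_
  change s.toFun (stdSimplex.map i.succAbove v) = s.toFun _
  obtain rfl : v = stdSimplex.vertex 0 := Subsingleton.elim _ _
  rw [stdSimplex.map_vertex, hij]

theorem bdry_pathSimplex {x y : X} (r : Path x y) (a : C.fib y) :
    bdry C 0 (.single (pathSimplex C r a) 1) =
      .single (Simplex.point ⟨y, a⟩) 1 - .single (Simplex.point ⟨x, C.pull (.mk r) a⟩) 1 := by
  rw [bdry_apply, Fin.sum_univ_two, Finsupp.mapDomain_single, Finsupp.mapDomain_single,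
    Simplex.face_eq_point_of_face 0 1 rfl, Simplex.face_eq_point_of_face 1 0 rfl,
    pathSimplex_one, pathSimplex_zero]
  simp [sub_eq_add_neg]

/-! ### Triangles -/

theorem bdry_single_two (s : Simplex C 2) :
    bdry C 1 (.single s 1) =
      .single (s.face 0) 1 - .single (s.face 1) 1 + .single (s.face 2) 1 := by
  rw [bdry_apply, Fin.sum_univ_three, Finsupp.mapDomain_single, Finsupp.mapDomain_single,
    Finsupp.mapDomain_single]
  simp [sub_eq_add_neg]

/-- A map of the triangle into `X` with the edges `r`, `s`, `q` gives a relation between the lifts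
of the edges. -/
theorem exists_bdry_of_triangle (m : C(Δ 2, X)) {x y z : X} (r : Path x y) (s : Path y z)
    (q : Path x z) (h₀ : ∀ t : Δ 1, m (stdSimplex.map (Fin.succAbove 0) t) = s (coord t))
    (h₁ : ∀ t : Δ 1, m (stdSimplex.map (Fin.succAbove 1) t) = q (coord t))
    (h₂ : ∀ t : Δ 1, m (stdSimplex.map (Fin.succAbove 2) t) = r (coord t)) (a : C.fib z) :
    ∃ w, bdry C 1 w = .single (pathSimplex C s a) 1 - .single (pathSimplex C q a) 1 +
      .single (pathSimplex C r (C.pull (.mk s) a)) 1 := by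
  have hz : z = m (stdSimplex.vertex 2) := by
    have := h₀ (stdSimplex.vertex 1)
    rw [stdSimplex.map_vertex] at this
    simpa using this.symm
  let τ := Simplex.lift C m (stdSimplex.vertex 2) hz a
  have e₀ : τ.face 0 = pathSimplex C s a := by
    refine eq_pathSimplex _ _ h₀ ?_
    change τ.toFun (stdSimplex.map (Fin.succAbove 0) _) = _
    rw [stdSimplex.map_vertex]
    exact Simplex.lift_self ..
  have e₁ : τ.face 1 = pathSimplex C q a := by
    refine eq_pathSimplex _ _ h₁ ?_
    change τ.toFun (stdSimplex.map (Fin.succAbove 1) _) = _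
    rw [stdSimplex.map_vertex]
    exact Simplex.lift_self ..
  have e₂ : τ.face 2 = pathSimplex C r (C.pull (.mk s) a) := by
    refine eq_pathSimplex _ _ h₂ ?_
    rw [← pathSimplex_zero, ← e₀]
    change τ.toFun (stdSimplex.map (Fin.succAbove 2) _) =
      τ.toFun (stdSimplex.map (Fin.succAbove 0) _)
    rw [stdSimplex.map_vertex, stdSimplex.map_vertex]
    rfl
  exact ⟨.single τ 1, by rw [bdry_single_two, e₀, e₁, e₂]⟩

/-- The edges of a singular triangle, as paths: the long edge is homotopic to the concatenation of
the other two. -/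
theorem exists_edges (τ : Simplex C 2) :
    ∃ (x y z : X) (r : Path x y) (s : Path y z) (q : Path x z) (a : C.fib z),
      Path.Homotopic.Quotient.mk q = (Path.Homotopic.Quotient.mk r).trans (.mk s) ∧
      τ.face 0 = pathSimplex C s a ∧ τ.face 1 = pathSimplex C q a ∧
      τ.face 2 = pathSimplex C r (C.pull (.mk s) a) := by
  let e (i : Fin 3) (u v : Fin 3) (hu : u = i.succAbove 0) (hv : v = i.succAbove 1) :
      Path (stdSimplex.vertex (S := ℝ) u) (stdSimplex.vertex v) :=
    (stdPath.map (stdSimplex.continuous_map i.succAbove)).cast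
      (by rw [stdSimplex.map_vertex, hu]) (by rw [stdSimplex.map_vertex, hv])
  let s₀ := e 0 1 2 rfl rfl
  let q₀ := e 1 0 2 rfl rfl
  let r₀ := e 2 0 1 rfl rfl
  have he : ∀ i u v hu hv t, stdSimplex.map i.succAbove t = e i u v hu hv (coord t) := by
    intro i u v hu hv t
    change _ = stdSimplex.map i.succAbove (stdPath (coord t))
    rw [stdPath_coord]
  have hq : Path.Homotopic q₀ (r₀.trans s₀) := SimplyConnectedSpace.paths_homotopic _ _
  have hq' := hq.map ⟨_, τ.cont⟩
  rw [Path.map_trans] at hq'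
  have e₀ : τ.face 0 = pathSimplex C (s₀.map τ.cont) (τ.toFun (stdSimplex.vertex 2)).2 := by
    refine eq_pathSimplex _ _ (fun t => congrArg (fun p => (τ.toFun p).1) (he 0 1 2 rfl rfl t)) ?_
    change τ.toFun (stdSimplex.map (Fin.succAbove 0) _) = _
    rw [stdSimplex.map_vertex]
    rfl
  refine ⟨_, _, _, r₀.map τ.cont, s₀.map τ.cont, q₀.map τ.cont,
    (τ.toFun (stdSimplex.vertex 2)).2, ?_, e₀, ?_, ?_⟩
  · rw [← Path.Homotopic.Quotient.mk_trans]
    exact Path.Homotopic.Quotient.eq.2 hq'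
  · refine eq_pathSimplex _ _ (fun t => congrArg (fun p => (τ.toFun p).1) (he 1 0 2 rfl rfl t)) ?_
    change τ.toFun (stdSimplex.map (Fin.succAbove 1) _) = _
    rw [stdSimplex.map_vertex]
    rfl
  · refine eq_pathSimplex _ _ (fun t => congrArg (fun p => (τ.toFun p).1) (he 2 0 1 rfl rfl t)) ?_
    rw [← pathSimplex_zero, ← e₀]
    change τ.toFun (stdSimplex.map (Fin.succAbove 2) _) =
      τ.toFun (stdSimplex.map (Fin.succAbove 0) _)
    rw [stdSimplex.map_vertex, stdSimplex.map_vertex]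
    rfl

end lifts

/-! ### One-dimensional chains modulo boundaries -/

section classes

variable {G G' : Type*} [Group G] [Group G'] {φ : G →* G'}

/-- The group `C₁ / ∂ C₂` of classes of `1`-chains modulo boundaries. -/
def GComplex.Cl (A : GComplex G) := A.X 1 ⧸ (A.d 1).range

instance (A : GComplex G) : AddCommGroup A.Cl :=
  inferInstanceAs (AddCommGroup (A.X 1 ⧸ (A.d 1).range))

/-- The class of a `1`-chain. -/
def GComplex.cl (A : GComplex G) : A.X 1 →+ A.Cl := QuotientAddGroup.mk' _

theorem GComplex.cl_surjective (A : GComplex G) : Function.Surjective A.cl :=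
  QuotientAddGroup.mk'_surjective _

theorem GComplex.cl_eq_zero (A : GComplex G) {x : A.X 1} : A.cl x = 0 ↔ ∃ z, A.d 1 z = x :=
  QuotientAddGroup.eq_zero_iff x

/-- The boundary of a class of `1`-chains. -/
def GComplex.bd (A : GComplex G) : A.Cl →+ A.X 0 :=
  QuotientAddGroup.lift _ (A.d 0) (by
    rintro _ ⟨z, rfl⟩
    exact A.d_d 0 z)

theorem GComplex.bd_cl (A : GComplex G) (x : A.X 1) : A.bd (A.cl x) = A.d 0 x := rfl

instance (A : GComplex G) : DistribMulAction G A.Cl where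
  smul g := QuotientAddGroup.map _ _ (DistribSMul.toAddMonoidHom (A.X 1) g) (by
    rintro _ ⟨z, rfl⟩
    exact ⟨g • z, A.d_smul 1 g z⟩)
  one_smul x := by
    obtain ⟨x, rfl⟩ := A.cl_surjective x
    exact congrArg A.cl (one_smul G x)
  mul_smul g h x := by
    obtain ⟨x, rfl⟩ := A.cl_surjective x
    exact congrArg A.cl (mul_smul g h x)
  smul_zero g := map_zero _
  smul_add g := map_add _

theorem GComplex.smul_cl (A : GComplex G) (g : G) (x : A.X 1) : g • A.cl x = A.cl (g • x) := rfl

theorem GComplex.bd_smul (A : GComplex G) (g : G) (x : A.Cl) : A.bd (g • x) = g • A.bd x := by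
  obtain ⟨x, rfl⟩ := A.cl_surjective x
  exact A.d_smul 0 g x

/-- The map of classes of `1`-chains that is induced by a chain map. -/
def GHom.cl {A : GComplex G} {B : GComplex G'} (f : GHom φ A B) : A.Cl →+ B.Cl :=
  QuotientAddGroup.map _ _ (f.f 1) (by
    rintro _ ⟨z, rfl⟩
    exact ⟨f.f 2 z, (f.comm 1 z).symm⟩)

theorem GHom.cl_cl {A : GComplex G} {B : GComplex G'} (f : GHom φ A B) (x : A.X 1) :
    f.cl (A.cl x) = B.cl (f.f 1 x) := rfl

theorem GHom.cl_smul {A : GComplex G} {B : GComplex G'} (f : GHom φ A B) (g : G) (x : A.Cl) :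
    f.cl (g • x) = φ g • f.cl x := by
  obtain ⟨x, rfl⟩ := A.cl_surjective x
  exact congrArg B.cl (f.smul 1 g x)

theorem GHom.bd_cl {A : GComplex G} {B : GComplex G'} (f : GHom φ A B) (x : A.Cl) :
    B.bd (f.cl x) = f.f 0 (A.bd x) := by
  obtain ⟨x, rfl⟩ := A.cl_surjective x
  exact (f.comm 0 x).symm

end classes

/-! ### Lifts of paths as chain classes -/

section pathClass

variable {X : Type*} [TopologicalSpace X] {G : Type*} [Group G] {C : Cov X G}

theorem cl_basis_add (C : Cov X G) {w : (chains C).X 2} {s t u : Simplex C 1}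
    (h : bdry C 1 w = .single s 1 - .single t 1 + .single u 1) :
    (chains C).cl (chainBasis C t) =
      (chains C).cl (chainBasis C u) + (chains C).cl (chainBasis C s) := by
  have h' : (chains C).cl (chainBasis C s - chainBasis C t + chainBasis C u) = 0 :=
    (chains C).cl_eq_zero.2 ⟨w, h⟩
  rw [map_add, map_sub, sub_add_eq_add_sub, sub_eq_zero] at h'
  rw [← h', add_comm]

theorem cl_pathSimplex_refl (x : X) (a : C.fib x) :
    (chains C).cl (chainBasis C (pathSimplex C (Path.refl x) a)) = 0 := by
  obtain ⟨w, h⟩ := exists_bdry_of_triangle (C := C) (.const _ x) (.refl x) (.refl x) (.refl x)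
    (fun _ => rfl) (fun _ => rfl) (fun _ => rfl) a
  have h' := cl_basis_add C h
  rw [show C.pull (.mk (Path.refl x)) a = a from C.pull_refl x a] at h'
  exact left_eq_add.1 h'

theorem stdSimplex_sum_three (u : Δ 2) : u 0 + u 1 + u 2 = 1 := by
  rw [← stdSimplex.sum_eq_one u, Fin.sum_univ_three]

theorem stdSimplex_face_two (t : Δ 1) :
    (stdSimplex.map (Fin.succAbove (0 : Fin 3)) t 1 = t 0 ∧
      stdSimplex.map (Fin.succAbove (0 : Fin 3)) t 2 = t 1) ∧
    (stdSimplex.map (Fin.succAbove (1 : Fin 3)) t 1 = 0 ∧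
      stdSimplex.map (Fin.succAbove (1 : Fin 3)) t 2 = t 1) ∧
    (stdSimplex.map (Fin.succAbove (2 : Fin 3)) t 1 = t 1 ∧
      stdSimplex.map (Fin.succAbove (2 : Fin 3)) t 2 = 0) :=
  ⟨⟨stdSimplex_face_succAbove 0 t 0, stdSimplex_face_succAbove 0 t 1⟩,
    ⟨stdSimplex_face_same 1 t, stdSimplex_face_succAbove 1 t 1⟩,
    ⟨stdSimplex_face_succAbove 2 t 1, stdSimplex_face_same 2 t⟩⟩

theorem continuous_stdSimplex_apply {k : ℕ} (j : Fin (k + 1)) : Continuous fun u : Δ k => u j :=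
  (continuous_apply j).comp continuous_subtype_val

/-- A coordinate of the triangle, with values in the interval. -/
def triCoord (j : Fin 3) : C(Δ 2, I) :=
  ⟨fun u => ⟨u j, stdSimplex.zero_le u j, stdSimplex.le_one u j⟩,
    (continuous_stdSimplex_apply j).subtype_mk _⟩

/-- The sum of the last two coordinates of the triangle. -/
def triSum : C(Δ 2, I) :=
  ⟨fun u => ⟨u 1 + u 2, add_nonneg (stdSimplex.zero_le u 1) (stdSimplex.zero_le u 2), by
    have := stdSimplex_sum_three u
    have := stdSimplex.zero_le u 0
    linarith⟩,
    ((continuous_stdSimplex_apply 1).add (continuous_stdSimplex_apply 2)).subtype_mk _⟩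

/-- The map from the triangle to the interval with the values `0`, `1 / 2`, `1` at the vertices. -/
def triHalf : C(Δ 2, I) :=
  ⟨fun u => ⟨u 1 / 2 + u 2,
    add_nonneg (half_pos_le (stdSimplex.zero_le u 1)) (stdSimplex.zero_le u 2), by
    have := stdSimplex_sum_three u
    have := stdSimplex.zero_le u 0
    have := stdSimplex.zero_le u 1
    linarith⟩,
    (((continuous_stdSimplex_apply 1).div_const 2).add
      (continuous_stdSimplex_apply 2)).subtype_mk _⟩
where
  half_pos_le {a : ℝ} (h : 0 ≤ a) : 0 ≤ a / 2 := by positivity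

theorem cl_pathSimplex_trans {x y z : X} (r : Path x y) (s : Path y z) (a : C.fib z) :
    (chains C).cl (chainBasis C (pathSimplex C (r.trans s) a)) =
      (chains C).cl (chainBasis C (pathSimplex C r (C.pull (.mk s) a))) +
        (chains C).cl (chainBasis C (pathSimplex C s a)) := by
  obtain ⟨w, h⟩ := exists_bdry_of_triangle (C := C) ((r.trans s).toContinuousMap.comp triHalf)
    r s (r.trans s)
    (fun t => by
      obtain ⟨⟨h₁, h₂⟩, -⟩ := stdSimplex_face_two t
      have h₀ := stdSimplex.add_eq_one t
      have hc : 0 ≤ t 1 ∧ t 1 ≤ 1 := ⟨stdSimplex.zero_le t 1, stdSimplex.le_one t 1⟩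
      change (r.trans s) (triHalf _) = _
      have e : triHalf (stdSimplex.map (Fin.succAbove 0) t) =
          ⟨(1 + t 1) / 2, by constructor <;> linarith [hc.1, hc.2]⟩ := by
        apply Subtype.ext
        change _ / 2 + _ = (1 + t 1) / 2
        rw [h₁, h₂]
        linarith
      rw [e, Path.trans_apply]
      split_ifs with hh
      · have h1 : t 1 = 0 := by simp only at hh; linarith [hc.1]
        have h2 : coord t = 0 := Subtype.ext h1
        have h3 : s (coord t) = y := by rw [h2, s.source]
        refine Eq.trans ?_ h3.symm
        convert r.target using 2
        apply Subtype.ext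
        simp [h1]
      · congr 1
        apply Subtype.ext
        simp only [coord_coe]
        ring)
    (fun t => by
      obtain ⟨-, ⟨h₁, h₂⟩, -⟩ := stdSimplex_face_two t
      change (r.trans s) (triHalf _) = _
      congr 1
      apply Subtype.ext
      change _ / 2 + _ = t 1
      rw [h₁, h₂]
      simp)
    (fun t => by
      obtain ⟨-, -, ⟨h₁, h₂⟩⟩ := stdSimplex_face_two t
      change (r.trans s) (triHalf _) = _
      have hc : 0 ≤ t 1 ∧ t 1 ≤ 1 := ⟨stdSimplex.zero_le t 1, stdSimplex.le_one t 1⟩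
      have e : triHalf (stdSimplex.map (Fin.succAbove 2) t) =
          ⟨t 1 / 2, by constructor <;> linarith [hc.1, hc.2]⟩ := by
        apply Subtype.ext
        change _ / 2 + _ = _
        rw [h₁, h₂, add_zero]
      rw [e, Path.trans_apply, dif_pos (by simp only; linarith [hc.2])]
      congr 1
      apply Subtype.ext
      simp only [coord_coe]
      ring) a
  exact cl_basis_add C h

theorem cl_pathSimplex_eq_of_homotopic {x y : X} {r s : Path x y} (h : r.Homotopic s)
    (a : C.fib y) :
    (chains C).cl (chainBasis C (pathSimplex C r a)) =
      (chains C).cl (chainBasis C (pathSimplex C s a)) := by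
  obtain ⟨F⟩ := h
  -- The square is cut along its diagonal into two triangles.
  let δ : Path x y := ⟨⟨fun t => F (t, t), by fun_prop⟩, F.source 0, F.target 1⟩
  obtain ⟨w, h₁⟩ := exists_bdry_of_triangle (C := C)
    (F.toContinuousMap.comp ((triCoord 2).prodMk triSum)) r (.refl y) δ
    (fun t => by
      obtain ⟨⟨h₁, h₂⟩, -⟩ := stdSimplex_face_two t
      change F (triCoord 2 _, triSum _) = y
      have e : triSum (stdSimplex.map (Fin.succAbove 0) t) = 1 := by
        apply Subtype.ext
        change _ + _ = (1 : ℝ)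
        rw [h₁, h₂, stdSimplex.add_eq_one]
      rw [e, F.target])
    (fun t => by
      obtain ⟨-, ⟨h₁, h₂⟩, -⟩ := stdSimplex_face_two t
      refine congrArg F (Prod.ext (Subtype.ext h₂) (Subtype.ext ?_))
      change _ + _ = t 1
      rw [h₁, h₂, zero_add])
    (fun t => by
      obtain ⟨-, -, ⟨h₁, h₂⟩⟩ := stdSimplex_face_two t
      refine Eq.trans ?_ (F.apply_zero (coord t))
      refine congrArg F (Prod.ext (Subtype.ext h₂) (Subtype.ext ?_))
      change _ + _ = t 1
      rw [h₁, h₂, add_zero]) a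
  obtain ⟨w', h₂⟩ := exists_bdry_of_triangle (C := C)
    (F.toContinuousMap.comp (triSum.prodMk (triCoord 2))) (.refl x) s δ
    (fun t => by
      obtain ⟨⟨h₁, h₂⟩, -⟩ := stdSimplex_face_two t
      refine Eq.trans ?_ (F.apply_one (coord t))
      refine congrArg F (Prod.ext (Subtype.ext ?_) (Subtype.ext h₂))
      change _ + _ = (1 : ℝ)
      rw [h₁, h₂, stdSimplex.add_eq_one])
    (fun t => by
      obtain ⟨-, ⟨h₁, h₂⟩, -⟩ := stdSimplex_face_two t
      refine congrArg F (Prod.ext (Subtype.ext ?_) (Subtype.ext h₂))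
      change _ + _ = t 1
      rw [h₁, h₂, zero_add])
    (fun t => by
      obtain ⟨-, -, ⟨h₁, h₂⟩⟩ := stdSimplex_face_two t
      change F (triSum _, triCoord 2 _) = x
      have e : triCoord 2 (stdSimplex.map (Fin.succAbove 2) t) = 0 := Subtype.ext h₂
      rw [e, F.source]) a
  have h₁' := cl_basis_add C h₁
  have h₂' := cl_basis_add C h₂
  rw [cl_pathSimplex_refl, add_zero,
    show C.pull (.mk (Path.refl y)) a = a from C.pull_refl y a] at h₁'
  rw [cl_pathSimplex_refl, zero_add] at h₂'
  rw [← h₁', h₂']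

/-- The class of the lift of a path that ends at the point `a` of the covering. -/
def pathClass (C : Cov X G) {x y : X} (r : Path.Homotopic.Quotient x y) (a : C.fib y) :
    (chains C).Cl :=
  Quotient.lift (s := Path.Homotopic.setoid x y)
    (fun r => (chains C).cl (chainBasis C (pathSimplex C r a)))
    (fun _ _ h => cl_pathSimplex_eq_of_homotopic h a) r

theorem pathClass_mk {x y : X} (r : Path x y) (a : C.fib y) :
    pathClass C (.mk r) a = (chains C).cl (chainBasis C (pathSimplex C r a)) := rfl

theorem pathClass_refl (x : X) (a : C.fib x) : pathClass C (.refl x) a = 0 :=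
  cl_pathSimplex_refl x a

theorem pathClass_trans {x y z : X} (r : Path.Homotopic.Quotient x y)
    (s : Path.Homotopic.Quotient y z) (a : C.fib z) :
    pathClass C (r.trans s) a = pathClass C r (C.pull s a) + pathClass C s a := by
  induction r using Path.Homotopic.Quotient.ind
  induction s using Path.Homotopic.Quotient.ind
  exact cl_pathSimplex_trans _ _ a

theorem smul_chainBasis {k : ℕ} (g : G) (s : Simplex C k) :
    g • chainBasis C s = chainBasis C (g • s) :=
  Finsupp.comapSMul_single g s 1

theorem smul_pathClass {x y : X} (g : G) (r : Path.Homotopic.Quotient x y) (a : C.fib y) :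
    g • pathClass C r a = pathClass C r (g • a) := by
  induction r using Path.Homotopic.Quotient.ind
  rw [pathClass_mk, pathClass_mk, GComplex.smul_cl, smul_chainBasis, smul_pathSimplex]

theorem bd_pathClass {x y : X} (r : Path.Homotopic.Quotient x y) (a : C.fib y) :
    (chains C).bd (pathClass C r a) =
      chainBasis C (Simplex.point ⟨y, a⟩) - chainBasis C (Simplex.point ⟨x, C.pull r a⟩) := by
  induction r using Path.Homotopic.Quotient.ind
  exact bdry_pathSimplex _ a

theorem point_injective : Function.Injective (Simplex.point : C.Tot → Simplex C 0) :=
  fun _ _ h => congrArg (fun s => Simplex.toFun s (stdSimplex.vertex 0)) h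

theorem chainBasis_injective {k : ℕ} :
    Function.Injective (chainBasis C : Simplex C k → (chains C).X k) :=
  Finsupp.single_left_injective one_ne_zero

end pathClass

/-! ### The Hurewicz theorem for the covering of a normal subgroup -/

section hurewicz

variable {X : Type*} [TopologicalSpace X] {w : X}

theorem trans_toPath_injective {x : X} {p : Path.Homotopic.Quotient x w}
    {k l : FundamentalGroup X w} (h : p.trans (FundamentalGroup.toPath k) =
      p.trans (FundamentalGroup.toPath l)) : k = l := by
  have h' := congrArg (fun q => p.symm.trans q) h
  simp only [← Path.Homotopic.Quotient.trans_assoc, Path.Homotopic.Quotient.symm_trans,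
    Path.Homotopic.Quotient.refl_trans] at h'
  exact h'

/-- A function of the path and of the end point of a lifted path depends only on the `1`-simplex. -/
theorem pathSimplex_inj {G : Type*} [Group G] {C : Cov X G} {T : Type*}
    (P : ∀ {x y : X}, Path x y → C.fib y → T) {x y x' y' : X} {r : Path x y} {r' : Path x' y'}
    {a : C.fib y} {a' : C.fib y'} (h : pathSimplex C r a = pathSimplex C r' a') :
    P r a = P r' a' := by
  have hr : ∀ t, r t = r' t := fun t => by
    have := congrArg (fun s => (Simplex.toFun s (stdPath t)).1) h
    simp only [pathSimplex_fst] at this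
    rwa [coord_stdPath] at this
  obtain rfl : x = x' := by rw [← r.source, ← r'.source, hr]
  obtain rfl : y = y' := by rw [← r.target, ← r'.target, hr]
  obtain rfl : r = r' := Path.ext (funext hr)
  have ha := congrArg (fun s => Simplex.toFun s (stdSimplex.vertex 1)) h
  simp only [pathSimplex_one] at ha
  simp only [Sigma.mk.injEq, heq_eq_eq, true_and] at ha
  rw [ha]

theorem le_of_eq_commutator {P : Type*} [Group P] {K L : Subgroup P} [K.Normal] (hL : L = ⁅K, K⁆) :
    L ≤ K := hL ▸ Subgroup.commutator_le_left K K

variable (K : Subgroup (FundamentalGroup X w)) [K.Normal]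

theorem pathCovMk_eq_iff {x : X} {p q : Path.Homotopic.Quotient x w} :
    pathCovMk w K p = pathCovMk w K q ↔ ∃ k ∈ K, q = p.trans (FundamentalGroup.toPath k) :=
  ⟨fun h => Quotient.exact (s := pathSetoid K x) h, fun h => Quotient.sound (s := pathSetoid K x) h⟩

theorem pull_pathCovBase {x : X} (p : Path.Homotopic.Quotient x w) :
    (pathCov w K).pull p (pathCovBase w K) = pathCovMk w K p :=
  congrArg (pathCovMk w K) (Path.Homotopic.Quotient.trans_refl p)

theorem pull_pathCovMk {x y : X} (r : Path.Homotopic.Quotient x y)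
    (p : Path.Homotopic.Quotient y w) :
    (pathCov w K).pull r (pathCovMk w K p) = pathCovMk w K (r.trans p) := rfl

theorem smul_pathCovMk {x : X} (g : FundamentalGroup X w) (p : Path.Homotopic.Quotient x w) :
    (g : FundamentalGroup X w ⧸ K) • pathCovMk w K p =
      pathCovMk w K (p.trans (FundamentalGroup.toPath g)) := rfl

theorem pathCovMk_loop (g : FundamentalGroup X w) :
    pathCovMk w K (FundamentalGroup.toPath g) =
      (g : FundamentalGroup X w ⧸ K) • pathCovBase w K :=
  (congrArg (pathCovMk w K) (Path.Homotopic.Quotient.refl_trans (FundamentalGroup.toPath g))).symm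

theorem pathCovMk_loop_of_mem {g : FundamentalGroup X w} (hg : g ∈ K) :
    pathCovMk w K (FundamentalGroup.toPath g) = pathCovBase w K := by
  rw [pathCovMk_loop, (QuotientGroup.eq_one_iff g).2 hg, one_smul]

/-- The homomorphism from `K` to the classes of `1`-chains that sends a loop to its lift. -/
def loopClass : K →* Multiplicative (chains (pathCov w K)).Cl where
  toFun k := .ofAdd (pathClass (pathCov w K) (FundamentalGroup.toPath k.1) (pathCovBase w K))
  map_one' := congrArg _ (pathClass_refl w _)
  map_mul' k l := by
    rw [← ofAdd_add]
    refine congrArg _ ((pathClass_trans (FundamentalGroup.toPath l.1)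
      (FundamentalGroup.toPath k.1) _).trans ?_)
    rw [pull_pathCovBase, pathCovMk_loop_of_mem K k.2, add_comm]

theorem pathClass_eq_zero_of_mem_commutator {k : FundamentalGroup X w} (hk : k ∈ ⁅K, K⁆) :
    pathClass (pathCov w K) (FundamentalGroup.toPath k) (pathCovBase w K) = 0 := by
  rw [← Subgroup.map_subtype_commutator] at hk
  obtain ⟨k, hk, rfl⟩ := hk
  have h := Abelianization.commutator_subset_ker (loopClass K) hk
  exact Multiplicative.ofAdd.injective h

/-- A path class that represents a point of the covering. -/
def pathRep {x : X} (z : (pathCov w K).fib x) : Path.Homotopic.Quotient x w :=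
  Quotient.out (s := pathSetoid K x) z

theorem pathCovMk_pathRep {x : X} (z : (pathCov w K).fib x) : pathCovMk w K (pathRep K z) = z :=
  Quotient.out_eq (s := pathSetoid K x) z

theorem pathCovMk_surjective (x : X) :
    Function.Surjective (pathCovMk w K : Path.Homotopic.Quotient x w → (pathCov w K).fib x) :=
  fun z => ⟨pathRep K z, pathCovMk_pathRep K z⟩

theorem exists_transition {x y : X} (r : Path.Homotopic.Quotient x y) (a : (pathCov w K).fib y) :
    ∃ k : K, r.trans (pathRep K a) =
      (pathRep K ((pathCov w K).pull r a)).trans (FundamentalGroup.toPath k.1) := by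
  have h : pathCovMk w K (pathRep K ((pathCov w K).pull r a)) =
      pathCovMk w K (r.trans (pathRep K a)) := by
    rw [pathCovMk_pathRep, ← pull_pathCovMk, pathCovMk_pathRep]
  obtain ⟨k, hk, e⟩ := (pathCovMk_eq_iff K).1 h
  exact ⟨⟨k, hk⟩, e⟩

/-- The lift of a path, closed up to a loop in the covering by the chosen paths from its ends to
the base point. -/
def transition {x y : X} (r : Path.Homotopic.Quotient x y) (a : (pathCov w K).fib y) : K :=
  (exists_transition K r a).choose

theorem trans_pathRep {x y : X} (r : Path.Homotopic.Quotient x y) (a : (pathCov w K).fib y) :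
    r.trans (pathRep K a) = (pathRep K ((pathCov w K).pull r a)).trans
      (FundamentalGroup.toPath (transition K r a).1) :=
  (exists_transition K r a).choose_spec

/-- The loops that close up the lifts of two composable paths multiply, in the order that belongs to
the group law of the fundamental group. -/
theorem transition_trans {x y z : X} (r : Path.Homotopic.Quotient x y)
    (s : Path.Homotopic.Quotient y z) (a : (pathCov w K).fib z) :
    transition K (r.trans s) a = transition K s a * transition K r ((pathCov w K).pull s a) := by
  apply Subtype.ext
  refine trans_toPath_injective (p := pathRep K ((pathCov w K).pull (r.trans s) a)) ?_
  rw [← trans_pathRep, Path.Homotopic.Quotient.trans_assoc, trans_pathRep,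
    ← Path.Homotopic.Quotient.trans_assoc, trans_pathRep, Path.Homotopic.Quotient.trans_assoc,
    (pathCov w K).pull_trans]
  rfl

/-- A loop in `K` is closed up by conjugation with the chosen path at the base point, which does not
change its class in the abelianization. -/
theorem transition_loop {k : FundamentalGroup X w} (hk : k ∈ K) :
    Abelianization.of (transition K (FundamentalGroup.toPath k) (pathCovBase w K)) =
      Abelianization.of (⟨k, hk⟩ : K) := by
  let e : FundamentalGroup X w := FundamentalGroup.fromPath (pathRep K (pathCovBase w K))
  have he : e ∈ K := by
    obtain ⟨k, hk, h⟩ := (pathCovMk_eq_iff K).1 (pathCovMk_pathRep K (pathCovBase w K)).symm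
    have : e = k := h.trans (Path.Homotopic.Quotient.refl_trans _)
    rwa [this]
  have h := trans_pathRep K (FundamentalGroup.toPath k) (pathCovBase w K)
  rw [pull_pathCovBase, pathCovMk_loop_of_mem K hk] at h
  have h' : e * k = (transition K (FundamentalGroup.toPath k) (pathCovBase w K)).1 * e := h
  have h'' : (⟨e, he⟩ : K) * ⟨k, hk⟩ =
      transition K (FundamentalGroup.toPath k) (pathCovBase w K) * ⟨e, he⟩ := Subtype.ext h'
  have h₃ := congrArg Abelianization.of h''
  rw [map_mul, map_mul, mul_comm] at h₃
  exact (mul_right_cancel h₃).symm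

/-- The class in the abelianization of `K` of a singular `1`-simplex of the covering, closed up to
a loop. It does not depend on the path and the end point that are chosen to describe the simplex,
by `simplexLoop_pathSimplex`. -/
def simplexLoop (s : Simplex (pathCov w K) 1) : Additive (Abelianization K) :=
  .ofMul (.of (transition K (.mk (exists_pathSimplex s).choose_spec.choose_spec.choose)
    (exists_pathSimplex s).choose_spec.choose_spec.choose_spec.choose))

theorem simplexLoop_pathSimplex {x y : X} (r : Path x y) (a : (pathCov w K).fib y) :
    simplexLoop K (pathSimplex _ r a) = .ofMul (.of (transition K (.mk r) a)) := by
  have h := (exists_pathSimplex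
    (pathSimplex (pathCov w K) r a)).choose_spec.choose_spec.choose_spec.choose_spec
  exact (pathSimplex_inj (C := pathCov w K)
    (fun r a => Additive.ofMul (Abelianization.of (transition K (.mk r) a))) h).symm

/-- The homomorphism from `1`-chains of the covering to the abelianization of `K`. -/
def chainLoop : (Simplex (pathCov w K) 1 →₀ ℤ) →+ Additive (Abelianization K) :=
  (Finsupp.linearCombination ℤ (simplexLoop K)).toAddMonoidHom

theorem chainLoop_single (s : Simplex (pathCov w K) 1) :
    chainLoop K (.single s 1) = simplexLoop K s := by
  change Finsupp.linearCombination ℤ (simplexLoop K) _ = _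
  rw [Finsupp.linearCombination_single, one_smul]

theorem chainLoop_bdry (z : Simplex (pathCov w K) 2 →₀ ℤ) :
    chainLoop K (bdry (pathCov w K) 1 z) = 0 := by
  suffices h : (chainLoop K).comp (bdry (pathCov w K) 1) = 0 from DFunLike.congr_fun h z
  refine Finsupp.addHom_ext' fun s => AddMonoidHom.ext_int ?_
  change chainLoop K (bdry (pathCov w K) 1 (.single s 1)) = 0
  obtain ⟨x, y, z, r, t, q, a, hq, h₀, h₁, h₂⟩ := exists_edges s
  rw [bdry_single_two, map_add, map_sub, chainLoop_single, chainLoop_single, chainLoop_single,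
    h₀, h₁, h₂, simplexLoop_pathSimplex, simplexLoop_pathSimplex, simplexLoop_pathSimplex, hq,
    transition_trans, map_mul, ofMul_mul]
  abel

/-- The homomorphism from classes of `1`-chains of the covering to the abelianization of `K`. -/
def classLoop : (chains (pathCov w K)).Cl →+ Additive (Abelianization K) :=
  QuotientAddGroup.lift _ (chainLoop K) (by
    rintro _ ⟨z, rfl⟩
    exact chainLoop_bdry K z)

theorem classLoop_pathClass {x y : X} (r : Path.Homotopic.Quotient x y)
    (a : (pathCov w K).fib y) :
    classLoop K (pathClass _ r a) = .ofMul (.of (transition K r a)) := by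
  induction r using Path.Homotopic.Quotient.ind
  exact (chainLoop_single K _).trans (simplexLoop_pathSimplex K _ a)

/-- Together with `pathClass_eq_zero_of_mem_commutator`, the injectivity part of the Hurewicz
theorem for the covering: `K / [K, K]` embeds into its first homology group. -/
theorem mem_commutator_of_pathClass_eq_zero {k : FundamentalGroup X w} (hk : k ∈ K)
    (h : pathClass (pathCov w K) (FundamentalGroup.toPath k) (pathCovBase w K) = 0) :
    k ∈ ⁅K, K⁆ := by
  have h' := classLoop_pathClass K (FundamentalGroup.toPath k) (pathCovBase w K)
  rw [h, map_zero, transition_loop K hk] at h'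
  have h'' : Abelianization.of (⟨k, hk⟩ : K) = 1 := Additive.ofMul.injective h'.symm
  rw [← Subgroup.map_subtype_commutator]
  exact ⟨⟨k, hk⟩, (QuotientGroup.eq_one_iff _).1 h'', rfl⟩

/-- The chain class of the chosen path from a point of the covering to the base point. -/
def repClass : (chains (pathCov w K)).X 0 →+ (chains (pathCov w K)).Cl :=
  (Finsupp.linearCombination ℤ fun s : Simplex (pathCov w K) 0 =>
    pathClass (pathCov w K) (pathRep K (s.toFun (stdSimplex.vertex 0)).2)
      (pathCovBase w K)).toAddMonoidHom

theorem repClass_point {x : X} (z : (pathCov w K).fib x) :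
    repClass K (chainBasis (pathCov w K) (Simplex.point ⟨x, z⟩)) =
      pathClass (pathCov w K) (pathRep K z) (pathCovBase w K) :=
  (Finsupp.linearCombination_single ℤ _ _).trans (one_smul ℤ _)

/-- Up to boundaries, every `1`-chain of the covering consists of a loop and of the chosen paths
from its boundary points to the base point. -/
theorem exists_loop (c : (chains (pathCov w K)).Cl) :
    ∃ k : K, c + repClass K ((chains (pathCov w K)).bd c) = (loopClass K k).toAdd := by
  obtain ⟨c, rfl⟩ := (chains (pathCov w K)).cl_surjective c
  rw [GComplex.bd_cl]
  let ψ₀ : (chains (pathCov w K)).X 1 →+ (chains (pathCov w K)).Cl :=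
    (chains (pathCov w K)).cl + (repClass K).comp ((chains (pathCov w K)).d 0)
  let ψ : (Simplex (pathCov w K) 1 →₀ ℤ) →+ (chains (pathCov w K)).Cl := ψ₀
  suffices ∀ c, ∃ k, ψ c = (loopClass K k).toAdd from this c
  intro c
  induction c using Finsupp.induction_linear with
  | zero => exact ⟨1, by rw [map_zero, map_one]; rfl⟩
  | add f g hf hg =>
    obtain ⟨k, hk⟩ := hf
    obtain ⟨l, hl⟩ := hg
    exact ⟨k * l, by rw [map_add, hk, hl, map_mul]; rfl⟩
  | single s n =>
    suffices h : ∃ k, ψ (.single s 1) = (loopClass K k).toAdd by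
      obtain ⟨k, hk⟩ := h
      refine ⟨k ^ n, ?_⟩
      rw [map_zpow, toAdd_zpow, ← hk, ← map_zsmul, Finsupp.smul_single, smul_eq_mul, mul_one]
    obtain ⟨x, y, r, a, rfl⟩ := exists_pathSimplex s
    refine ⟨transition K (.mk r) a, ?_⟩
    have h := trans_pathRep K (.mk r) a
    have h' := congrArg (fun q => pathClass (pathCov w K) q (pathCovBase w K)) h
    simp only [pathClass_trans] at h'
    rw [pull_pathCovBase, pull_pathCovBase, pathCovMk_pathRep,
      pathCovMk_loop_of_mem K (transition K (.mk r) a).2] at h'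
    have e : ψ (.single (pathSimplex (pathCov w K) r a) 1) =
        pathClass (pathCov w K) (.mk r) a + repClass K (bdry (pathCov w K) 0
          (.single (pathSimplex (pathCov w K) r a) 1)) := rfl
    rw [e, bdry_pathSimplex]
    refine (congrArg (pathClass (pathCov w K) (.mk r) a + ·)
      ((map_sub (repClass K) (chainBasis _ _) (chainBasis _ _)).trans
        (congrArg₂ (· - ·) (repClass_point K a) (repClass_point K _)))).trans ?_
    rw [← add_sub_assoc, h', add_sub_cancel_left]
    rfl

variable {K} {L : Subgroup (FundamentalGroup X w)} [L.Normal] (hL : L = ⁅K, K⁆)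

/-- A point of the covering for `L = [K, K]` is given by a path to the base point, up to paths in
`L`. The lift of this path to the covering for `K` defines a chain class. -/
def liftClass {x : X} (z : (pathCov w L).fib x) : (chains (pathCov w K)).Cl :=
  Quotient.lift (s := pathSetoid L x)
    (fun p => pathClass (pathCov w K) p (pathCovBase w K)) (by
      rintro p _ ⟨k, hk, rfl⟩
      have hk' := hk
      rw [hL] at hk
      change pathClass (pathCov w K) p (pathCovBase w K) =
        pathClass (pathCov w K) (p.trans (FundamentalGroup.toPath k)) (pathCovBase w K)
      rw [pathClass_trans, pathClass_eq_zero_of_mem_commutator K hk, add_zero, pull_pathCovBase,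
        pathCovMk_loop_of_mem K (le_of_eq_commutator hL hk')]) z

theorem liftClass_mk {x : X} (p : Path.Homotopic.Quotient x w) :
    liftClass hL (pathCovMk w L p) = pathClass (pathCov w K) p (pathCovBase w K) := rfl

theorem pathCovRed_mk (h : L ≤ K) {x : X} (p : Path.Homotopic.Quotient x w) :
    (pathCovRed w h).f (pathCovMk w L p) = pathCovMk w K p := rfl

theorem bd_liftClass {x : X} (z : (pathCov w L).fib x) :
    (chains (pathCov w K)).bd (liftClass hL z) =
      chainBasis _ (Simplex.point ⟨w, pathCovBase w K⟩) -
        chainBasis _ (Simplex.point ⟨x, (pathCovRed w (le_of_eq_commutator hL)).f z⟩) := by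
  obtain ⟨p, rfl⟩ := pathCovMk_surjective L x z
  rw [liftClass_mk, bd_pathClass, pull_pathCovBase, pathCovRed_mk]

theorem liftClass_base : liftClass hL (pathCovBase w L) = 0 := pathClass_refl w _

/-- The path from `g • z` to the base point runs along the translate of the path from `z`, and then
along the path from `g • w`. -/
theorem liftClass_smul {x : X} (g : FundamentalGroup X w ⧸ L) (z : (pathCov w L).fib x) :
    liftClass hL (g • z) = liftClass hL (g • pathCovBase w L) +
      (QuotientGroup.map L K (MonoidHom.id _) (le_of_eq_commutator hL) g) • liftClass hL z := by
  obtain ⟨p, rfl⟩ := pathCovMk_surjective L x z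
  obtain ⟨g, rfl⟩ := QuotientGroup.mk_surjective g
  rw [smul_pathCovMk, ← pathCovMk_loop, liftClass_mk, liftClass_mk, liftClass_mk, pathClass_trans,
    smul_pathClass, pull_pathCovBase, pathCovMk_loop, add_comm]
  rfl

theorem liftClass_pull {x y : X} (r : Path.Homotopic.Quotient x y) (z : (pathCov w L).fib y) :
    liftClass hL ((pathCov w L).pull r z) =
      pathClass (pathCov w K) r ((pathCovRed w (le_of_eq_commutator hL)).f z) +
        liftClass hL z := by
  obtain ⟨p, rfl⟩ := pathCovMk_surjective L y z
  rw [pull_pathCovMk, liftClass_mk, liftClass_mk, pathClass_trans, pull_pathCovBase, pathCovRed_mk]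

/-- The chain class of a path to the base point in the covering for `K` determines the lift of its
starting point to the covering for `[K, K]`. -/
theorem liftClass_injective {x : X} {z z' : (pathCov w L).fib x}
    (h : liftClass hL z = liftClass hL z') : z = z' := by
  have hb := congrArg (chains (pathCov w K)).bd h
  rw [bd_liftClass, bd_liftClass] at hb
  have hb' := point_injective (chainBasis_injective (sub_right_injective hb))
  simp only [Sigma.mk.injEq, heq_eq_eq, true_and] at hb'
  obtain ⟨p, rfl⟩ := pathCovMk_surjective L x z
  obtain ⟨q, rfl⟩ := pathCovMk_surjective L x z'
  rw [pathCovRed_mk, pathCovRed_mk, pathCovMk_eq_iff] at hb'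
  obtain ⟨k, hk, rfl⟩ := hb'
  rw [liftClass_mk, liftClass_mk, pathClass_trans, pull_pathCovBase, pathCovMk_loop_of_mem K hk,
    left_eq_add] at h
  refine (pathCovMk_eq_iff L).2 ⟨k, ?_, rfl⟩
  rw [hL]
  exact mem_commutator_of_pathClass_eq_zero K hk h

/-- The surjectivity part of the Hurewicz theorem: a class with the boundary of a path to the base
point is the class of such a path, which determines a point of the covering for `[K, K]`. -/
theorem exists_liftClass {x : X} {ξ : (chains (pathCov w K)).Cl} {z : (pathCov w K).fib x}
    (h : (chains (pathCov w K)).bd ξ = chainBasis _ (Simplex.point ⟨w, pathCovBase w K⟩) -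
      chainBasis _ (Simplex.point ⟨x, z⟩)) :
    ∃ y : (pathCov w L).fib x, liftClass hL y = ξ ∧
      (pathCovRed w (le_of_eq_commutator hL)).f y = z := by
  obtain ⟨k, hk⟩ := exists_loop K ξ
  obtain ⟨e, he, he'⟩ :=
    (pathCovMk_eq_iff K).1 (pathCovMk_pathRep K (pathCovBase w K)).symm
  have he₁ : pathRep K (pathCovBase w K) = FundamentalGroup.toPath e :=
    he'.trans (Path.Homotopic.Quotient.refl_trans _)
  have hr : pathClass (pathCov w K) (pathRep K (pathCovBase w K)) (pathCovBase w K) =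
      (loopClass K ⟨e, he⟩).toAdd := by rw [he₁]; rfl
  rw [h, map_sub, repClass_point, repClass_point, hr] at hk
  let m : K := k * ⟨e, he⟩⁻¹
  refine ⟨pathCovMk w L ((pathRep K z).trans (FundamentalGroup.toPath m.1)), ?_, ?_⟩
  · rw [liftClass_mk, pathClass_trans, pull_pathCovBase, pathCovMk_loop_of_mem K m.2]
    have hm : pathClass (pathCov w K) (FundamentalGroup.toPath m.1) (pathCovBase w K) =
        (loopClass K k).toAdd - (loopClass K ⟨e, he⟩).toAdd := by
      rw [← toAdd_div, ← map_div, div_eq_mul_inv]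
      rfl
    rw [hm, ← hk]
    abel
  · rw [pathCovRed_mk]
    refine Eq.trans ?_ (pathCovMk_pathRep K z)
    exact ((pathCovMk_eq_iff K).2 ⟨m.1, m.2, rfl⟩).symm

end hurewicz

/-! ### Maps of short exact sequences of chain complexes -/

section five

variable {G G' : Type*} [Group G] [Group G']

theorem GHom.IsEquivalence.homology_injective {φ : G ≃* G'} {A : GComplex G} {B : GComplex G'}
    {f : GHom φ.toMonoidHom A B} (hf : f.IsEquivalence) {k : ℕ} {x : A.X (k + 1)}
    (hx : A.d k x = 0) {y : B.X (k + 2)} (hy : f.f (k + 1) x = B.d (k + 1) y) :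
    ∃ z, A.d (k + 1) z = x := by
  obtain ⟨e, ⟨h⟩, -⟩ := hf
  refine ⟨e.f _ y - h.h _ x, ?_⟩
  have h₁ := h.succ k x
  simp only [AddMonoidHom.comp_apply, AddMonoidHom.id_apply, hx, map_zero, add_zero, hy,
    e.comm] at h₁
  rw [map_sub, ← h₁, sub_sub_cancel]

theorem GHom.IsEquivalence.homology_surjective {φ : G ≃* G'} {A : GComplex G} {B : GComplex G'}
    {f : GHom φ.toMonoidHom A B} (hf : f.IsEquivalence) {k : ℕ} {y : B.X (k + 1)}
    (hy : B.d k y = 0) : ∃ x z, A.d k x = 0 ∧ y = f.f (k + 1) x + B.d (k + 1) z := by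
  obtain ⟨e, -, ⟨h⟩⟩ := hf
  refine ⟨e.f _ y, - h.h _ y, by rw [← e.comm, hy, map_zero], ?_⟩
  have h₁ := h.succ k y
  simp only [AddMonoidHom.comp_apply, AddMonoidHom.id_apply, hy, map_zero, add_zero] at h₁
  rw [map_neg, ← h₁]
  abel

/-- A map of short exact sequences `S → A → R` of chain complexes. The injectivity of
`S → A` is included for the target only; the five lemma in degree one does not use it for the
source. -/
structure ShortExactMap {φ : G →* G'} {A R S : GComplex G} {A' R' S' : GComplex G'}
    (i : GHom (MonoidHom.id G) S A) (p : GHom (MonoidHom.id G) A R)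
    (i' : GHom (MonoidHom.id G') S' A') (p' : GHom (MonoidHom.id G') A' R')
    (θ : GHom φ S S') (g : GHom φ A A') (f : GHom φ R R') : Prop where
  surj : ∀ k, Function.Surjective (p.f k)
  exact : ∀ k x, p.f k x = 0 → ∃ y, i.f k y = x
  zero : ∀ k y, p.f k (i.f k y) = 0
  inj' : ∀ k, Function.Injective (i'.f k)
  surj' : ∀ k, Function.Surjective (p'.f k)
  exact' : ∀ k x, p'.f k x = 0 → ∃ y, i'.f k y = x
  zero' : ∀ k y, p'.f k (i'.f k y) = 0
  sub : ∀ k y, g.f k (i.f k y) = i'.f k (θ.f k y)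
  rel : ∀ k x, p'.f k (g.f k x) = f.f k (p.f k x)

variable {φ : G ≃* G'} {A R S : GComplex G} {A' R' S' : GComplex G'}
  {i : GHom (MonoidHom.id G) S A} {p : GHom (MonoidHom.id G) A R}
  {i' : GHom (MonoidHom.id G') S' A'} {p' : GHom (MonoidHom.id G') A' R'}
  {θ : GHom φ.toMonoidHom S S'} {g : GHom φ.toMonoidHom A A'} {f : GHom φ.toMonoidHom R R'}

/-- The injectivity part of the five lemma for the first homology groups. -/
theorem ShortExactMap.cl_injective (H : ShortExactMap i p i' p' θ g f)
    (hθ : ∀ k, Function.Bijective (θ.f k)) (hf : f.IsEquivalence) {ξ : A.Cl} (h₀ : A.bd ξ = 0)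
    (h₁ : g.cl ξ = 0) : ξ = 0 := by
  obtain ⟨z, rfl⟩ := A.cl_surjective ξ
  rw [GComplex.bd_cl] at h₀
  obtain ⟨y', hy'⟩ := A'.cl_eq_zero.1 h₁
  obtain ⟨r, hr⟩ := hf.homology_injective (x := p.f 1 z) (by rw [← p.comm, h₀, map_zero])
    (y := p'.f 2 y') (by rw [← p'.comm, hy', H.rel])
  obtain ⟨r, rfl⟩ := H.surj 2 r
  obtain ⟨s, hs⟩ := H.exact 1 (z - A.d 1 r) (by rw [map_sub, p.comm, hr, sub_self])
  have hy₁ : A'.d 1 (y' - g.f 2 r) = i'.f 1 (θ.f 1 s) := by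
    rw [map_sub, hy', ← g.comm, ← map_sub, ← H.sub, hs]
  obtain ⟨v, q, hv, hvq⟩ := hf.homology_surjective (y := p'.f 2 (y' - g.f 2 r))
    (by rw [← p'.comm, hy₁, H.zero'])
  obtain ⟨v, rfl⟩ := H.surj 2 v
  obtain ⟨q, rfl⟩ := H.surj' 3 q
  obtain ⟨s', hs'⟩ := H.exact' 2 (y' - g.f 2 r - g.f 2 v - A'.d 2 q) (by
    rw [map_sub, map_sub, hvq, H.rel, p'.comm]
    abel)
  obtain ⟨t, ht⟩ := H.exact 1 (A.d 1 v) (by rw [p.comm, hv])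
  obtain ⟨s', rfl⟩ := (hθ 2).2 s'
  have e : S.d 1 s' = s - t := by
    apply (hθ 1).1
    apply H.inj' 1
    rw [θ.comm, i'.comm, hs', map_sub, A'.d_d, map_sub, hy₁, ← g.comm, ← ht, H.sub, map_sub,
      map_sub, sub_zero]
  refine A.cl_eq_zero.2 ⟨r + v + i.f 2 s', ?_⟩
  rw [map_add, map_add, ← i.comm, e, map_sub, hs, ht]
  abel

/-- The surjectivity part of the five lemma for the first homology groups. -/
theorem ShortExactMap.cl_surjective (H : ShortExactMap i p i' p' θ g f)
    (hθ : ∀ k, Function.Bijective (θ.f k)) (hf : f.IsEquivalence) {ξ : A'.Cl}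
    (h₀ : A'.bd ξ = 0) : ∃ ζ, A.bd ζ = 0 ∧ g.cl ζ = ξ := by
  obtain ⟨z, rfl⟩ := A'.cl_surjective ξ
  rw [GComplex.bd_cl] at h₀
  obtain ⟨r, q, hr, hrq⟩ := hf.homology_surjective (y := p'.f 1 z)
    (by rw [← p'.comm, h₀, map_zero])
  obtain ⟨r, rfl⟩ := H.surj 1 r
  obtain ⟨q, rfl⟩ := H.surj' 2 q
  obtain ⟨s, hs⟩ := H.exact' 1 (z - g.f 1 r - A'.d 1 q) (by
    rw [map_sub, map_sub, hrq, H.rel, p'.comm]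
    abel)
  obtain ⟨s, rfl⟩ := (hθ 1).2 s
  obtain ⟨t, ht⟩ := H.exact 0 (A.d 0 r) (by rw [p.comm, hr])
  have e : S.d 0 s = - t := by
    apply (hθ 0).1
    apply H.inj' 0
    rw [θ.comm, i'.comm, hs, map_sub, A'.d_d, map_sub, h₀, ← g.comm, ← ht, H.sub, map_neg,
      map_neg]
    abel
  refine ⟨A.cl (r + i.f 1 s), ?_, ?_⟩
  · rw [GComplex.bd_cl, map_add, ← i.comm, e, map_neg, ht]
    abel
  · rw [GHom.cl_cl, ← sub_eq_zero, ← map_sub, A'.cl_eq_zero]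
    refine ⟨-q, ?_⟩
    rw [map_neg, map_add, H.sub, hs]
    abel

end five

/-! ### Chain maps with given relative component -/

section absolute

variable {X X' Y : Type*} [TopologicalSpace X] [TopologicalSpace X'] [TopologicalSpace Y]
  {G G' : Type*} [Group G] [Group G'] {C : Cov X G} {C' : Cov X' G'} {i : C(Y, X)} {i' : C(Y, X')}
  {hi : IsEmbedding i} {hi' : IsEmbedding i'}

/-- The chain of `X` with the given relative component and vanishing component in `Y`, as a map of
the groups of the chain complexes. -/
def relExt (C : Cov X G) (hi : IsEmbedding i) (k : ℕ) :
    (relChains C hi).X k →+ (chains C).X k := extRel C i k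

/-- The component in `Y`, as a map of the groups of the chain complexes. -/
def relSub (C : Cov X G) (hi : IsEmbedding i) (k : ℕ) :
    (chains C).X k →+ (chains (C.restrict i)).X k := prSub C hi k

/-- The component in `Y` of the boundary of a relative chain, as a map of the groups of the chain
complexes. -/
def relSubBdry (C : Cov X G) (hi : IsEmbedding i) (k : ℕ) :
    (relChains C hi).X (k + 1) →+ (chains (C.restrict i)).X k := subBdry C hi k

theorem toRel_relExt (k : ℕ) (x : (relChains C hi).X k) :
    (toRel C hi).f k (relExt C hi k x) = x :=
  prRel_extRel C i k x

theorem toRel_push (k : ℕ) (x : (chains (C.restrict i)).X k) :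
    (toRel C hi).f k ((chainsPush C i).f k x) = 0 :=
  prRel_push C i k x

theorem relSub_push (k : ℕ) (x : (chains (C.restrict i)).X k) :
    relSub C hi k ((chainsPush C i).f k x) = x :=
  prSub_push C hi k x

theorem d_relExt (k : ℕ) (x : (relChains C hi).X (k + 1)) :
    (chains C).d k (relExt C hi (k + 1) x) =
      relExt C hi k ((relChains C hi).d k x) + (chainsPush C i).f k (relSubBdry C hi k x) :=
  bdry_extRel C hi k x

theorem relExt_add_push (k : ℕ) (x : (chains C).X k) :
    relExt C hi k ((toRel C hi).f k x) + (chainsPush C i).f k (relSub C hi k x) = x :=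
  rel_decomp C hi k x

theorem relSub_relExt (k : ℕ) (x : (relChains C hi).X k) : relSub C hi k (relExt C hi k x) = 0 :=
  prSub_extRel C hi k x

theorem relSub_d (k : ℕ) (x : (chains C).X (k + 1)) :
    relSub C hi k ((chains C).d k x) = relSubBdry C hi k ((toRel C hi).f (k + 1) x) +
      (chains (C.restrict i)).d k (relSub C hi (k + 1) x) := by
  conv_lhs => rw [← relExt_add_push (hi := hi) (k + 1) x]
  rw [map_add, map_add, ← (chainsPush C i).comm, relSub_push, d_relExt, map_add, relSub_relExt,
    relSub_push, zero_add]

theorem relExt_smul (k : ℕ) (g : G) (x : (relChains C hi).X k) :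
    relExt C hi k (g • x) = g • relExt C hi k x :=
  extRel_map (g • ·) (g • ·) (fun _ => rfl) x

theorem relSub_smul (k : ℕ) (g : G) (x : (chains C).X k) :
    relSub C hi k (g • x) = g • relSub C hi k x :=
  prSub_mapDomain hi hi (g • ·) (g • ·) (g • ·) (fun _ => rfl) (fun _ => rfl) x

/-- A chain map of relative chains, a map of the coverings of the subspace, and a chain homotopy
between the two maps into the suspended chains of the subspace define a chain map of absolute
chains. -/
def absoluteMap {φ : G →* G'} (f : GHom φ (relChains C hi) (relChains C' hi'))
    (θ : CovHom φ (C.restrict i) (C'.restrict i'))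
    (ψ : ∀ k, (relChains C hi).X k →+ (chains (C'.restrict i')).X k)
    (hψ : ∀ k (g : G) x, ψ k (g • x) = φ g • ψ k x)
    (hd : ∀ k x, relSubBdry C' hi' k (f.f (k + 1) x) - (chainsMap θ).f k (relSubBdry C hi k x) =
      - (chains (C'.restrict i')).d k (ψ (k + 1) x) + ψ k ((relChains C hi).d k x)) :
    GHom φ (chains C) (chains C') where
  f k := (relExt C' hi' k).comp ((f.f k).comp ((toRel C hi).f k)) +
    ((chainsPush C' i').f k).comp (((chainsMap θ).f k).comp (relSub C hi k) +
      (ψ k).comp ((toRel C hi).f k))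
  comm k x := by
    have h := hd k ((toRel C hi).f (k + 1) x)
    rw [sub_eq_iff_eq_add] at h
    simp only [AddMonoidHom.add_apply, AddMonoidHom.comp_apply, map_add, d_relExt, relSub_d, h,
      (toRel C hi).comm, f.comm, ← (chainsPush C' i').comm, map_neg, (chainsMap θ).comm]
    abel
  smul k g x := by
    simp only [AddMonoidHom.add_apply, AddMonoidHom.comp_apply, (toRel C hi).smul, relSub_smul,
      f.smul, (chainsMap θ).smul, relExt_smul, (chainsPush C' i').smul, smul_add, map_add, hψ,
      MonoidHom.id_apply]

theorem absoluteMap_push {φ : G →* G'} (f : GHom φ (relChains C hi) (relChains C' hi'))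
    (θ : CovHom φ (C.restrict i) (C'.restrict i'))
    (ψ : ∀ k, (relChains C hi).X k →+ (chains (C'.restrict i')).X k) (hψ) (hd) (k : ℕ)
    (y : (chains (C.restrict i)).X k) :
    (absoluteMap f θ ψ hψ hd).f k ((chainsPush C i).f k y) =
      (chainsPush C' i').f k ((chainsMap θ).f k y) := by
  simp only [absoluteMap, AddMonoidHom.add_apply, AddMonoidHom.comp_apply, toRel_push, relSub_push,
    map_zero, zero_add, add_zero]

theorem toRel_absoluteMap {φ : G →* G'} (f : GHom φ (relChains C hi) (relChains C' hi'))
    (θ : CovHom φ (C.restrict i) (C'.restrict i'))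
    (ψ : ∀ k, (relChains C hi).X k →+ (chains (C'.restrict i')).X k) (hψ) (hd) (k : ℕ)
    (x : (chains C).X k) :
    (toRel C' hi').f k ((absoluteMap f θ ψ hψ hd).f k x) = f.f k ((toRel C hi).f k x) := by
  simp only [absoluteMap, AddMonoidHom.add_apply, AddMonoidHom.comp_apply, map_add, toRel_relExt,
    toRel_push, add_zero]

theorem toRel_surjective (C : Cov X G) (hi : IsEmbedding i) (k : ℕ) :
    Function.Surjective ((toRel C hi).f k) :=
  fun x => ⟨relExt C hi k x, toRel_relExt k x⟩

theorem exists_push_of_toRel_eq_zero (k : ℕ) (x : (chains C).X k)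
    (h : (toRel C hi).f k x = 0) : ∃ y, (chainsPush C i).f k y = x := by
  refine ⟨relSub C hi k x, ?_⟩
  have e := relExt_add_push (hi := hi) k x
  rwa [h, map_zero, zero_add] at e

theorem chainsPush_injective (hi : IsEmbedding i) (k : ℕ) :
    Function.Injective ((chainsPush C i).f k) :=
  Finsupp.mapDomain_injective (Simplex.push_injective hi.injective)

/-- A map of coverings over an isomorphism of groups is a map of torsors on the fibres. -/
theorem CovHom.bijective {φ : G ≃* G'} {C : Cov X G} {C' : Cov X G'}
    (m : CovHom φ.toMonoidHom C C') (x : X) [hx : Nonempty (C.fib x)] :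
    Function.Bijective (m.f : C.fib x → C'.fib x) := by
  constructor
  · intro a b h
    obtain ⟨g, rfl, -⟩ := C.torsor a b
    have h' : φ g • m.f a = m.f a := (m.smul g a).symm.trans h.symm
    obtain ⟨g₀, -, hg₀⟩ := C'.torsor (m.f a) (m.f a)
    have h₁ : φ g = 1 := (hg₀ _ h').trans (hg₀ 1 (one_smul _ _)).symm
    rw [map_eq_one_iff φ φ.injective] at h₁
    rw [h₁, one_smul]
  · intro b
    obtain ⟨a⟩ := hx
    obtain ⟨g, rfl, -⟩ := C'.torsor (m.f a) b
    refine ⟨φ.symm g • a, (m.smul _ a).trans ?_⟩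
    change φ (φ.symm g) • _ = _
    rw [φ.apply_symm_apply]

/-- The inverse of a map of coverings over an isomorphism of groups. -/
def CovHom.inv {φ : G ≃* G'} {C : Cov X G} {C' : Cov X G'} (m : CovHom φ.toMonoidHom C C')
    (h : ∀ x, Nonempty (C.fib x)) : CovHom φ.symm.toMonoidHom C' C where
  f {x} := have := h x; (Equiv.ofBijective m.f (m.bijective x)).symm
  smul {x} g a := by
    have := h x
    rw [Equiv.symm_apply_eq]
    refine Eq.trans ?_ (m.smul _ _).symm
    rw [Equiv.ofBijective_apply_symm_apply m.f (m.bijective x)]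
    change _ = φ (φ.symm g) • a
    rw [φ.apply_symm_apply]
  pull {x y} p a := by
    have := h x
    have := h y
    rw [Equiv.symm_apply_eq]
    refine Eq.trans ?_ (m.pull p _).symm
    rw [Equiv.ofBijective_apply_symm_apply m.f (m.bijective y)]

theorem CovHom.f_inv {φ : G ≃* G'} {C : Cov X G} {C' : Cov X G'} (m : CovHom φ.toMonoidHom C C')
    (h : ∀ x, Nonempty (C.fib x)) {x : X} (a : C'.fib x) : m.f ((m.inv h).f a) = a :=
  have := h x
  Equiv.ofBijective_apply_symm_apply m.f (m.bijective x) a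

theorem CovHom.inv_f {φ : G ≃* G'} {C : Cov X G} {C' : Cov X G'} (m : CovHom φ.toMonoidHom C C')
    (h : ∀ x, Nonempty (C.fib x)) {x : X} (a : C.fib x) : (m.inv h).f (m.f a) = a :=
  have := h x
  Equiv.ofBijective_symm_apply_apply m.f (m.bijective x) a

theorem chainsMap_comp_of_inverse {φ : G →* G'} {φ' : G' →* G} {C : Cov X G} {C' : Cov X G'}
    (m : CovHom φ C C') (m' : CovHom φ' C' C) (h : ∀ {x : X} (a : C.fib x), m'.f (m.f a) = a)
    (k : ℕ) (x : (chains C).X k) : (chainsMap m').f k ((chainsMap m).f k x) = x := by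
  refine (Finsupp.mapDomain_comp (f := Simplex.map m) (g := Simplex.map m')
    (v := (x : Simplex C k →₀ ℤ))).symm.trans ?_
  have e : Simplex.map m' ∘ Simplex.map m = (id : Simplex C k → Simplex C k) :=
    funext fun s => Simplex.ext' fun v => Sigma.ext rfl (heq_of_eq (h _))
  rw [e]
  exact Finsupp.mapDomain_id

theorem chainsMap_bijective {φ : G ≃* G'} {C : Cov X G} {C' : Cov X G'}
    (m : CovHom φ.toMonoidHom C C') (h : ∀ x, Nonempty (C.fib x)) (k : ℕ) :
    Function.Bijective ((chainsMap m).f k) :=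
  Function.bijective_iff_has_inverse.2 ⟨(chainsMap (m.inv h)).f k,
    chainsMap_comp_of_inverse m (m.inv h) (m.inv_f h) k,
    chainsMap_comp_of_inverse (m.inv h) m (m.f_inv h) k⟩

end absolute

/-! ### Chain homotopy equivalences over a base -/

section dold

variable {G G' : Type*} [Group G] [Group G']

/-- The composition `h ∘ ∂` of the boundary with a family of maps that raise the degree. -/
def dPre {A : GComplex G} {U : ℕ → Type*} [∀ k, AddCommGroup (U k)]
    (h : ∀ k, A.X k →+ U (k + 1)) : ∀ k, A.X k →+ U k
  | 0 => 0
  | k + 1 => (h k).comp (A.d k)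

@[simp]
theorem dPre_zero {A : GComplex G} {U : ℕ → Type*} [∀ k, AddCommGroup (U k)]
    (h : ∀ k, A.X k →+ U (k + 1)) (x : A.X 0) : dPre h 0 x = 0 := rfl

@[simp]
theorem dPre_succ {A : GComplex G} {U : ℕ → Type*} [∀ k, AddCommGroup (U k)]
    (h : ∀ k, A.X k →+ U (k + 1)) (k : ℕ) (x : A.X (k + 1)) :
    dPre h (k + 1) x = h k (A.d k x) := rfl

theorem dPre_smul {A : GComplex G} {U : ℕ → Type*} [∀ k, AddCommGroup (U k)]
    [∀ k, DistribMulAction G' (U k)] {φ : G →* G'} (h : ∀ k, A.X k →+ U (k + 1))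
    (hh : ∀ k (g : G) x, h k (g • x) = φ g • h k x) :
    ∀ k (g : G) x, dPre h k (g • x) = φ g • dPre h k x
  | 0, g, x => (smul_zero (φ g)).symm
  | k + 1, g, x => by rw [dPre_succ, dPre_succ, A.d_smul, hh]

/-- A chain map, changed by the boundary of a family of maps that raise the degree. -/
def GHom.addBoundary {φ : G →* G'} {A : GComplex G} {B : GComplex G'} (f : GHom φ A B)
    (h : ∀ k, A.X k →+ B.X (k + 1)) (hh : ∀ k (g : G) x, h k (g • x) = φ g • h k x) :
    GHom φ A B where
  f k := f.f k + (B.d k).comp (h k) + dPre h k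
  comm k x := by
    cases k <;>
    simp only [AddMonoidHom.add_apply, AddMonoidHom.comp_apply, map_add, f.comm, dPre_zero,
      dPre_succ, A.d_d, B.d_d, map_zero, add_zero]
  smul k g x := by
    simp only [AddMonoidHom.add_apply, AddMonoidHom.comp_apply, f.smul, hh, B.d_smul,
      dPre_smul h hh, smul_add]

theorem GHom.addBoundary_zero {φ : G →* G'} {A : GComplex G} {B : GComplex G'} (f : GHom φ A B)
    (h : ∀ k, A.X k →+ B.X (k + 1)) (hh) (x : A.X 0) :
    (f.addBoundary h hh).f 0 x = f.f 0 x + B.d 0 (h 0 x) :=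
  add_zero _

theorem GHom.addBoundary_succ {φ : G →* G'} {A : GComplex G} {B : GComplex G'} (f : GHom φ A B)
    (h : ∀ k, A.X k →+ B.X (k + 1)) (hh) (k : ℕ) (x : A.X (k + 1)) :
    (f.addBoundary h hh).f (k + 1) x =
      f.f (k + 1) x + B.d (k + 1) (h (k + 1) x) + h k (A.d k x) := rfl

/-- The composition of semilinear chain maps. -/
def GHom.comp {G'' : Type*} [Group G''] {φ : G →* G'} {ψ : G' →* G''} {χ : G →* G''}
    {A : GComplex G} {B : GComplex G'} {C : GComplex G''} (b : GHom ψ B C) (a : GHom φ A B)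
    (hχ : ∀ g, ψ (φ g) = χ g) : GHom χ A C where
  f k := (b.f k).comp (a.f k)
  comm k x := (congrArg (b.f k) (a.comm k x)).trans (b.comm k _)
  smul k g x := by simp only [AddMonoidHom.comp_apply, a.smul, b.smul, hχ]

theorem GHom.comp_f {G'' : Type*} [Group G''] {φ : G →* G'} {ψ : G' →* G''} {χ : G →* G''}
    {A : GComplex G} {B : GComplex G'} {C : GComplex G''} (b : GHom ψ B C) (a : GHom φ A B)
    (hχ : ∀ g, ψ (φ g) = χ g) (k : ℕ) (x : A.X k) : (b.comp a hχ).f k x = b.f k (a.f k x) := rfl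

/-- The identity chain map. -/
def GHom.refl (A : GComplex G) : GHom (MonoidHom.id G) A A where
  f k := AddMonoidHom.id (A.X k)
  comm _ _ := rfl
  smul _ _ _ := rfl

theorem GHom.refl_f (A : GComplex G) (k : ℕ) (x : A.X k) : (GHom.refl A).f k x = x := rfl

variable {φ : G →* G'} {φ' : G' →* G} {A : GComplex G} {B : GComplex G'}
  {S : ℕ → Type*} [∀ k, AddCommGroup (S k)] {D : ∀ k, S (k + 1) →+ S k}
  {p : ∀ k, A.X k →+ S k} {q : ∀ k, B.X k →+ S k}

/-- Let `A` and `B` be complexes with chain maps `p` and `q` to a base `S`, and let `f : A → B` be a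
chain homotopy equivalence over `S`. If maps to the base can be lifted to `A` in positive degrees
(`tA` and `tB` are such lifts of `p` and `q`), then the inverse of `f` can be deformed to a chain
map over `S` which is a left inverse up to a chain homotopy that is trivial in the base. -/
theorem exists_left_inverse_over (hφ : ∀ g, φ' (φ g) = g) (hφ' : ∀ g, φ (φ' g) = g)
    (hp : ∀ k x, p k (A.d k x) = D k (p (k + 1) x))
    (tA : ∀ k, A.X (k + 1) →+ A.X (k + 1)) (tA_smul : ∀ k (g : G) x, tA k (g • x) = g • tA k x)
    (p_tA : ∀ k x, p (k + 1) (tA k x) = p (k + 1) x)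
    (tB : ∀ k, B.X (k + 1) →+ A.X (k + 1))
    (tB_smul : ∀ k (g : G') x, tB k (g • x) = φ' g • tB k x)
    (p_tB : ∀ k x, p (k + 1) (tB k x) = q (k + 1) x)
    (hq : ∀ k x, q k (B.d k x) = D k (q (k + 1) x))
    (f : GHom φ A B) (hf : ∀ k x, q k (f.f k x) = p k x) (e : GHom φ' B A)
    (h : GHomotopy (MonoidHom.id G) (A := A) (B := A)
      (fun k => (e.f k).comp (f.f k)) (fun k => AddMonoidHom.id (A.X k)))
    (h' : GHomotopy (MonoidHom.id G') (A := B) (B := B)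
      (fun k => (f.f k).comp (e.f k)) (fun k => AddMonoidHom.id (B.X k))) :
    ∃ e' : GHom φ' B A, (∀ k x, p k (e'.f k x) = q k x) ∧
      (∃ κ : GHomotopy (MonoidHom.id G) (A := A) (B := A)
        (fun k => (e'.f k).comp (f.f k)) (fun k => AddMonoidHom.id (A.X k)),
        ∀ k x, p (k + 1) (κ.h k x) = 0) ∧
      Nonempty (GHomotopy (MonoidHom.id G') (A := B) (B := B)
        (fun k => (f.f k).comp (e'.f k)) (fun k => AddMonoidHom.id (B.X k))) := by
  have h_zero : ∀ x, e.f 0 (f.f 0 x) - x = A.d 0 (h.h 0 x) := h.zero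
  have h_succ : ∀ k x, e.f (k + 1) (f.f (k + 1) x) - x =
    A.d (k + 1) (h.h (k + 1) x) + h.h k (A.d k x) := h.succ
  have h'_zero : ∀ x, f.f 0 (e.f 0 x) - x = B.d 0 (h'.h 0 x) := h'.zero
  have h'_succ : ∀ k x, f.f (k + 1) (e.f (k + 1) x) - x =
    B.d (k + 1) (h'.h (k + 1) x) + h'.h k (B.d k x) := h'.succ
  -- The inverse is deformed to a chain map over the base by lifting the projection of `h'`.
  let n : ∀ k, B.X k →+ A.X (k + 1) := fun k => -(tB k).comp (h'.h k)
  have n_smul : ∀ k (g : G') x, n k (g • x) = φ' g • n k x := fun k g x => by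
    simp only [n, AddMonoidHom.neg_apply, AddMonoidHom.comp_apply, h'.smul, tB_smul,
      MonoidHom.id_apply, smul_neg]
  have p_n : ∀ k x, p (k + 1) (n k x) = - q (k + 1) (h'.h k x) := fun k x => by
    simp only [n, AddMonoidHom.neg_apply, AddMonoidHom.comp_apply, map_neg, p_tB]
  let e₁ := e.addBoundary n n_smul
  have p_e₁ : ∀ k x, p k (e₁.f k x) = q k x := by
    rintro (_ | k) x
    · rw [GHom.addBoundary_zero, map_add, hp, p_n, ← hf, eq_add_of_sub_eq (h'_zero x), map_add,
        map_neg, hq]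
      abel
    · rw [GHom.addBoundary_succ, map_add, map_add, hp, p_n, p_n, ← hf,
        eq_add_of_sub_eq (h'_succ k x), map_add, map_add, map_neg, hq]
      abel
  let u := e₁.comp f (χ := MonoidHom.id G) hφ
  have p_u : ∀ k x, p k (u.f k x) = p k x := fun k x => (p_e₁ k _).trans (hf k x)
  let k₁ : ∀ k, A.X k →+ A.X (k + 1) := fun k => h.h k + (n k).comp (f.f k)
  have k₁_smul : ∀ k (g : G) x, k₁ k (g • x) = g • k₁ k x := fun k g x => by
    simp only [k₁, AddMonoidHom.add_apply, AddMonoidHom.comp_apply, h.smul, f.smul, n_smul, hφ,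
      MonoidHom.id_apply, smul_add]
  have u_zero : ∀ x, u.f 0 x = x + A.d 0 (k₁ 0 x) := fun x => by
    rw [GHom.comp_f, GHom.addBoundary_zero, eq_add_of_sub_eq (h_zero x)]
    simp only [k₁, AddMonoidHom.add_apply, AddMonoidHom.comp_apply, map_add]
    abel
  have u_succ : ∀ k x, u.f (k + 1) x = x + A.d (k + 1) (k₁ (k + 1) x) + k₁ k (A.d k x) :=
    fun k x => by
    rw [GHom.comp_f, GHom.addBoundary_succ, eq_add_of_sub_eq (h_succ k x)]
    simp only [k₁, AddMonoidHom.add_apply, AddMonoidHom.comp_apply, map_add, f.comm]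
    abel
  -- The composition `u = e₁ f` is homotopic to the identity by `k₁`, and the projection of `k₁`
  -- to the base anticommutes with the boundary.
  have pk_zero : ∀ x, D 0 (p 1 (k₁ 0 x)) = 0 := fun x => by
    have := p_u 0 x
    rwa [u_zero, map_add, hp, add_eq_left] at this
  have pk_succ : ∀ k x, D (k + 1) (p (k + 2) (k₁ (k + 1) x)) + p (k + 1) (k₁ k (A.d k x)) = 0 :=
    fun k x => by
    have := p_u (k + 1) x
    rwa [u_succ, map_add, map_add, hp, add_assoc, add_eq_left] at this
  let l : ∀ k, A.X k →+ A.X (k + 1) := fun k => -(tA k).comp (k₁ k)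
  have l_smul : ∀ k (g : G) x, l k (g • x) = g • l k x := fun k g x => by
    simp only [l, AddMonoidHom.neg_apply, AddMonoidHom.comp_apply, k₁_smul, tA_smul, smul_neg]
  have p_l : ∀ k x, p (k + 1) (l k x) = - p (k + 1) (k₁ k x) := fun k x => by
    simp only [l, AddMonoidHom.neg_apply, AddMonoidHom.comp_apply, map_neg, p_tA]
  let v := (GHom.refl A).addBoundary l l_smul
  have p_v : ∀ k x, p k (v.f k x) = p k x := by
    rintro (_ | k) x
    · rw [GHom.addBoundary_zero, map_add, hp, p_l, map_neg, pk_zero, neg_zero, add_zero]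
      rfl
    · rw [GHom.addBoundary_succ, map_add, map_add, hp, p_l, p_l, map_neg, add_assoc, ← neg_add,
        pk_succ, neg_zero, add_zero]
      rfl
  let m : ∀ k, A.X k →+ A.X (k + 2) := fun k => (tA (k + 1)).comp ((k₁ (k + 1)).comp (k₁ k))
  have m_smul : ∀ k (g : G) x, m k (g • x) = g • m k x := fun k g x => by
    simp only [m, AddMonoidHom.comp_apply, k₁_smul, tA_smul]
  have p_m : ∀ k x, p (k + 2) (m k x) = p (k + 2) (k₁ (k + 1) (k₁ k x)) := fun k x => by
    simp only [m, AddMonoidHom.comp_apply, p_tA]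
  let κ : ∀ k, A.X k →+ A.X (k + 1) := fun k =>
    k₁ k + (l k).comp (u.f k) - (A.d (k + 1)).comp (m k) + dPre (U := fun k => A.X (k + 1)) m k
  have κ_zero : ∀ x, κ 0 x = k₁ 0 x + l 0 (u.f 0 x) - A.d 1 (m 0 x) := fun x => add_zero _
  have κ_succ : ∀ k x, κ (k + 1) x = k₁ (k + 1) x + l (k + 1) (u.f (k + 1) x) -
    A.d (k + 2) (m (k + 1) x) + m k (A.d k x) := fun k x => rfl
  refine ⟨v.comp e₁ (χ := φ') (fun _ => rfl), fun k x => (p_v k _).trans (p_e₁ k x),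
    ⟨⟨κ, ?_, ?_, ?_⟩, ?_⟩, ⟨⟨fun k => h'.h k + (f.f (k + 1)).comp (n k + (l k).comp (e₁.f k)),
      ?_, ?_, ?_⟩⟩⟩
  · intro k g x
    simp only [κ, AddMonoidHom.add_apply, AddMonoidHom.sub_apply, AddMonoidHom.comp_apply, k₁_smul,
      u.smul, l_smul, m_smul, A.d_smul,
      dPre_smul (φ := MonoidHom.id G) (U := fun k => A.X (k + 1)) m m_smul,
      MonoidHom.id_apply, smul_add, smul_sub]
  · intro x
    change v.f 0 (u.f 0 x) - x = _
    rw [κ_zero, GHom.addBoundary_zero, GHom.refl_f, map_sub, A.d_d, map_add]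
    conv_lhs => enter [1, 1]; rw [u_zero]
    abel
  · intro k x
    change v.f (k + 1) (u.f (k + 1) x) - x = _
    rw [κ_succ, GHom.addBoundary_succ, GHom.refl_f, map_add, map_sub, A.d_d, map_add, ← u.comm]
    have : κ k (A.d k x) =
        k₁ k (A.d k x) + l k (u.f k (A.d k x)) - A.d (k + 1) (m k (A.d k x)) := by
      cases k with
      | zero => exact κ_zero _
      | succ k => rw [κ_succ, A.d_d, map_zero, add_zero]
    rw [this]
    conv_lhs => enter [1, 1, 1]; rw [u_succ]
    abel
  · rintro (_ | k) x
    · change p 1 (κ 0 x) = 0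
      rw [κ_zero, map_sub, map_add, p_l, hp, p_m, u_zero, map_add, map_add]
      have := pk_succ 0 (k₁ 0 x)
      rw [eq_neg_of_add_eq_zero_left this]
      abel
    · change p (k + 2) (κ (k + 1) x) = 0
      rw [κ_succ, map_add, map_sub, map_add, p_l, hp, p_m, p_m, u_succ, map_add, map_add, map_add,
        map_add]
      have := pk_succ (k + 1) (k₁ (k + 1) x)
      rw [eq_neg_of_add_eq_zero_left this]
      abel
  · intro k g x
    simp only [AddMonoidHom.add_apply, AddMonoidHom.comp_apply, h'.smul, n_smul, e₁.smul, l_smul,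
      ← smul_add, f.smul, hφ', MonoidHom.id_apply]
  · intro x
    change f.f 0 (v.f 0 (e₁.f 0 x)) - x = B.d 0 (h'.h 0 x + f.f 1 (n 0 x + l 0 (e₁.f 0 x)))
    rw [GHom.addBoundary_zero, GHom.refl_f]
    conv_lhs => enter [1, 2, 1]; rw [GHom.addBoundary_zero]
    simp only [map_add, ← f.comm, ← h'_zero]
    abel
  · intro k x
    change f.f (k + 1) (v.f (k + 1) (e₁.f (k + 1) x)) - x =
      B.d (k + 1) (h'.h (k + 1) x + f.f (k + 2) (n (k + 1) x + l (k + 1) (e₁.f (k + 1) x))) +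
      (h'.h k (B.d k x) + f.f (k + 1) (n k (B.d k x) + l k (e₁.f k (B.d k x))))
    rw [GHom.addBoundary_succ, GHom.refl_f]
    conv_lhs => enter [1, 2, 1, 1]; rw [GHom.addBoundary_succ]
    have := h'_succ k x
    simp only [map_add, ← f.comm, e₁.comm]
    rw [eq_sub_of_add_eq this.symm]
    abel

/-- A chain homotopy equivalence of complexes over a base is a chain homotopy equivalence relative
to the base, if maps to the base can be lifted in positive degrees. This is the algebraic form of
Dold's theorem on fibre homotopy equivalences; the maps `tAA`, `tBA`, `tBB`, `tAB` lift the
projections `p`, `q`, `q`, `p` to the complexes `A`, `A`, `B`, `B`. -/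
theorem exists_inverse_over (hφ : ∀ g, φ' (φ g) = g) (hφ' : ∀ g, φ (φ' g) = g)
    (hp : ∀ k x, p k (A.d k x) = D k (p (k + 1) x))
    (hq : ∀ k x, q k (B.d k x) = D k (q (k + 1) x))
    (tAA : ∀ k, A.X (k + 1) →+ A.X (k + 1)) (tAA_smul : ∀ k (g : G) x, tAA k (g • x) = g • tAA k x)
    (p_tAA : ∀ k x, p (k + 1) (tAA k x) = p (k + 1) x)
    (tBA : ∀ k, B.X (k + 1) →+ A.X (k + 1))
    (tBA_smul : ∀ k (g : G') x, tBA k (g • x) = φ' g • tBA k x)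
    (p_tBA : ∀ k x, p (k + 1) (tBA k x) = q (k + 1) x)
    (tBB : ∀ k, B.X (k + 1) →+ B.X (k + 1))
    (tBB_smul : ∀ k (g : G') x, tBB k (g • x) = g • tBB k x)
    (q_tBB : ∀ k x, q (k + 1) (tBB k x) = q (k + 1) x)
    (tAB : ∀ k, A.X (k + 1) →+ B.X (k + 1))
    (tAB_smul : ∀ k (g : G) x, tAB k (g • x) = φ g • tAB k x)
    (q_tAB : ∀ k x, q (k + 1) (tAB k x) = p (k + 1) x)
    (f : GHom φ A B) (hf : ∀ k x, q k (f.f k x) = p k x) (e : GHom φ' B A)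
    (h : GHomotopy (MonoidHom.id G) (A := A) (B := A)
      (fun k => (e.f k).comp (f.f k)) (fun k => AddMonoidHom.id (A.X k)))
    (h' : GHomotopy (MonoidHom.id G') (A := B) (B := B)
      (fun k => (f.f k).comp (e.f k)) (fun k => AddMonoidHom.id (B.X k))) :
    ∃ e' : GHom φ' B A, (∀ k x, p k (e'.f k x) = q k x) ∧
      (∃ κ : GHomotopy (MonoidHom.id G) (A := A) (B := A)
        (fun k => (e'.f k).comp (f.f k)) (fun k => AddMonoidHom.id (A.X k)),
        ∀ k x, p (k + 1) (κ.h k x) = 0) ∧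
      (∃ κ : GHomotopy (MonoidHom.id G') (A := B) (B := B)
        (fun k => (f.f k).comp (e'.f k)) (fun k => AddMonoidHom.id (B.X k)),
        ∀ k x, q (k + 1) (κ.h k x) = 0) := by
  obtain ⟨e', he', ⟨κ, hκ⟩, ⟨μ⟩⟩ := exists_left_inverse_over hφ hφ' hp tAA tAA_smul p_tAA tBA
    tBA_smul p_tBA hq f hf e h h'
  obtain ⟨f', hf', ⟨ν, hν⟩, -⟩ := exists_left_inverse_over hφ' hφ hq tBB tBB_smul q_tBB tAB
    tAB_smul q_tAB hp e' he' f μ κ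
  refine ⟨e', he', ⟨κ, hκ⟩, ?_⟩
  have κ_zero : ∀ x, e'.f 0 (f.f 0 x) - x = A.d 0 (κ.h 0 x) := κ.zero
  have κ_succ : ∀ k x, e'.f (k + 1) (f.f (k + 1) x) - x =
    A.d (k + 1) (κ.h (k + 1) x) + κ.h k (A.d k x) := κ.succ
  have ν_zero : ∀ x, f'.f 0 (e'.f 0 x) - x = B.d 0 (ν.h 0 x) := ν.zero
  have ν_succ : ∀ k x, f'.f (k + 1) (e'.f (k + 1) x) - x =
    B.d (k + 1) (ν.h (k + 1) x) + ν.h k (B.d k x) := ν.succ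
  -- Both `f` and the left inverse `f'` of `e'` are homotopic to `f' e' f` over the base.
  refine ⟨⟨fun k => ((f'.f (k + 1)).comp (κ.h k) - (ν.h k).comp (f.f k)).comp (e'.f k) + ν.h k,
    ?_, ?_, ?_⟩, ?_⟩
  all_goals
    simp only [AddMonoidHom.add_apply, AddMonoidHom.sub_apply, AddMonoidHom.comp_apply,
      AddMonoidHom.id_apply]
  · intro k g x
    simp only [e'.smul, κ.smul, f'.smul, f.smul, ν.smul, hφ', MonoidHom.id_apply, smul_add,
      smul_sub]
  · intro x
    have h₁ := congrArg (f'.f 0) (κ_zero (e'.f 0 x))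
    have h₂ := ν_zero (f.f 0 (e'.f 0 x))
    have h₃ := ν_zero x
    simp only [map_add, map_sub, ← f'.comm] at h₁ ⊢
    rw [← h₁, ← h₂, ← h₃]
    abel
  · intro k x
    have h₁ := congrArg (f'.f (k + 1)) (κ_succ k (e'.f (k + 1) x))
    have h₂ := ν_succ k (f.f (k + 1) (e'.f (k + 1) x))
    have h₃ := ν_succ k x
    simp only [map_add, map_sub, ← f'.comm, ← e'.comm, ← f.comm] at h₁ h₂ ⊢
    rw [eq_sub_of_add_eq h₁.symm, eq_sub_of_add_eq h₂.symm, eq_sub_of_add_eq h₃.symm]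
    abel
  · intro k x
    rw [map_add, map_sub, hf', hκ, hν, hν, sub_zero, add_zero]

end dold

/-! ### Collars and the boundary map of relative chains -/

section collar

variable {X Y : Type*} [TopologicalSpace X] [TopologicalSpace Y] {G : Type*} [Group G]
  {C : Cov X G} {i : C(Y, X)}

/-- The first barycentric coordinate of a simplex. -/
def firstCoord (k : ℕ) : C(Δ k, I) :=
  ⟨fun u => ⟨u 0, stdSimplex.zero_le u 0, stdSimplex.le_one u 0⟩,
    (continuous_stdSimplex_apply 0).subtype_mk _⟩

/-- The degeneracy of standard simplices that identifies the first two vertices. -/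
def firstDegeneracy (k : ℕ) : C(Δ (k + 1), Δ k) :=
  ⟨stdSimplex.map (Fin.predAbove 0), stdSimplex.continuous_map _⟩

theorem firstDegeneracy_face (k : ℕ) (t : Δ k) :
    firstDegeneracy k (stdSimplex.map (Fin.succAbove 0) t) = t := by
  change stdSimplex.map (Fin.predAbove 0) (stdSimplex.map (Fin.succAbove 0) t) = t
  rw [stdSimplex.map_comp_apply]
  have : Fin.predAbove (0 : Fin (k + 1)) ∘ Fin.succAbove 0 = id := by
    funext j
    simp
  rw [this, stdSimplex.map_id_apply]

/-- The simplex of dimension `k + 1` that is spanned by a simplex of the subspace and by the end of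
the collar over its first vertex. -/
def collarSimplex (c : C(Y × I, X)) (hc : ∀ y, c (y, 0) = i y) {k : ℕ}
    (s : Simplex (C.restrict i) k) : Simplex C (k + 1) :=
  Simplex.lift C
    (c.comp ((ContinuousMap.comp ⟨_, s.cont⟩ (firstDegeneracy k)).prodMk (firstCoord (k + 1))))
    (stdSimplex.vertex 1) (x := i (s.toFun (stdSimplex.vertex 0)).1) (by
      have e₁ : firstDegeneracy k (stdSimplex.vertex 1) = stdSimplex.vertex 0 := by
        have h := firstDegeneracy_face k (stdSimplex.vertex 0)
        rwa [stdSimplex.map_vertex] at h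
      have e₂ : firstCoord (k + 1) (stdSimplex.vertex 1) = 0 :=
        Subtype.ext (Pi.single_eq_of_ne (i := (1 : Fin (k + 2))) (i' := 0) (by simp) (1 : ℝ))
      change _ = c ((s.toFun (firstDegeneracy k (stdSimplex.vertex 1))).1,
        firstCoord (k + 1) (stdSimplex.vertex 1))
      rw [e₁, e₂, hc]) (s.toFun (stdSimplex.vertex 0)).2

variable (c : C(Y × I, X)) (hc : ∀ y, c (y, 0) = i y)

theorem collarSimplex_fst {k : ℕ} (s : Simplex (C.restrict i) k) (t : Δ (k + 1)) :
    ((collarSimplex c hc s).toFun t).1 =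
      c ((s.toFun (firstDegeneracy k t)).1, firstCoord (k + 1) t) := rfl

theorem face_zero_collarSimplex {k : ℕ} (s : Simplex (C.restrict i) k) :
    (collarSimplex c hc s).face 0 = s.push i := by
  refine Simplex.ext_point (fun v => ?_) (stdSimplex.vertex 0) ?_
  · change c ((s.toFun (firstDegeneracy k (stdSimplex.map (Fin.succAbove 0) v))).1,
      firstCoord (k + 1) (stdSimplex.map (Fin.succAbove 0) v)) = i (s.toFun v).1
    have e : firstCoord (k + 1) (stdSimplex.map (Fin.succAbove 0) v) = 0 :=
      Subtype.ext (stdSimplex_face_same 0 v)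
    rw [firstDegeneracy_face, e, hc]
  · change (collarSimplex c hc s).toFun (stdSimplex.map (Fin.succAbove 0) _) = _
    rw [stdSimplex.map_vertex]
    exact Simplex.lift_self ..

theorem collarSimplex_smul {k : ℕ} (g : G) (s : Simplex (C.restrict i) k) :
    collarSimplex c hc (g • s) = g • collarSimplex c hc s := by
  refine Simplex.ext_point (fun v => rfl) (stdSimplex.vertex 1) ?_
  refine (Simplex.lift_self ..).trans ?_
  change _ = (⟨((collarSimplex c hc s).toFun _).1, g • ((collarSimplex c hc s).toFun _).2⟩ : C.Tot)
  have h : (collarSimplex c hc s).toFun (stdSimplex.vertex 1) =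
    ⟨i (s.toFun (stdSimplex.vertex 0)).1, (s.toFun (stdSimplex.vertex 0)).2⟩ := Simplex.lift_self ..
  rw [h]
  rfl

theorem collarSimplex_vertex (hc' : ∀ y t, 0 < t → c (y, t) ∉ Set.range i)
    {k : ℕ} (s : Simplex (C.restrict i) k) :
    ((collarSimplex c hc s).toFun (stdSimplex.vertex 0)).1 ∉ Set.range i := by
  rw [collarSimplex_fst]
  refine hc' _ _ ?_
  change (0 : ℝ) < (Pi.single 0 1 : Fin (k + 2) → ℝ) 0
  rw [Pi.single_eq_same]
  exact one_pos

theorem notMem_range_push {k : ℕ} {s : Simplex C k} {t : Δ k} (h : (s.toFun t).1 ∉ Set.range i) :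
    s ∉ Set.range (Simplex.push i : Simplex (C.restrict i) k → Simplex C k) := by
  rintro ⟨y, rfl⟩
  exact h ⟨_, rfl⟩

theorem face_collarSimplex_notMem (hc' : ∀ y t, 0 < t → c (y, t) ∉ Set.range i)
    {k : ℕ} (j : Fin (k + 1)) (s : Simplex (C.restrict i) k) :
    (collarSimplex c hc s).face j.succ ∉
      Set.range (Simplex.push i : Simplex (C.restrict i) k → Simplex C k) := by
  refine notMem_range_push (t := stdSimplex.vertex 0) ?_
  change ((collarSimplex c hc s).toFun (stdSimplex.map (Fin.succAbove j.succ) _)).1 ∉ _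
  rw [stdSimplex.map_vertex, Fin.succ_succAbove_zero]
  exact collarSimplex_vertex c hc hc' s

theorem relSub_basis_push (hi : IsEmbedding i) {k : ℕ} (s : Simplex (C.restrict i) k) :
    relSub C hi k (chainBasis C (s.push i)) = chainBasis _ s := by
  have h := relSub_push (C := C) (hi := hi) k (chainBasis _ s)
  rwa [show (chainsPush C i).f k (chainBasis _ s) = chainBasis C (s.push i) from
    Finsupp.mapDomain_single] at h

theorem relSub_basis_of_notMem (hi : IsEmbedding i) {k : ℕ} {s : Simplex C k}
    (h : s ∉ Set.range (Simplex.push i : Simplex (C.restrict i) k → Simplex C k)) :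
    relSub C hi k (chainBasis C s) = 0 := by
  refine Finsupp.ext fun t => ?_
  change Finsupp.single s 1 (t.push i) = 0
  exact Finsupp.single_eq_of_ne fun e => h ⟨t, e⟩

/-- A section of the boundary map from relative chains to chains of the subspace, in the presence
of a collar. -/
def collarSection (hc' : ∀ y t, 0 < t → c (y, t) ∉ Set.range i)
    (hi : IsEmbedding i) (k : ℕ) :
    (chains (C.restrict i)).X k →+ (relChains C hi).X (k + 1) :=
  Finsupp.mapDomain.addMonoidHom fun s : Simplex (C.restrict i) k =>
    (⟨collarSimplex c hc s, notMem_range_push (collarSimplex_vertex c hc hc' s)⟩ :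
      RelSimplex C i (k + 1))

theorem collarSection_smul (hc' : ∀ y t, 0 < t → c (y, t) ∉ Set.range i)
    (hi : IsEmbedding i) (k : ℕ) (g : G) (x : (chains (C.restrict i)).X k) :
    collarSection c hc hc' hi k (g • x) = g • collarSection c hc hc' hi k x :=
  mapDomain_comm _ (g • ·) (g • ·) _ (fun s => Subtype.ext (collarSimplex_smul c hc g s)) x

theorem relSubBdry_collarSection (hc' : ∀ y t, 0 < t → c (y, t) ∉ Set.range i)
    (hi : IsEmbedding i) (k : ℕ) (x : (chains (C.restrict i)).X k) :
    relSubBdry C hi k (collarSection c hc hc' hi k x) = x := by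
  suffices h : (relSubBdry C hi k).comp (collarSection c hc hc' hi k) = AddMonoidHom.id _ from
    DFunLike.congr_fun h x
  refine Finsupp.addHom_ext' fun s => AddMonoidHom.ext_int ?_
  change relSubBdry C hi k (collarSection c hc hc' hi k (chainBasis _ s)) = chainBasis _ s
  have e₁ : relSubBdry C hi k (collarSection c hc hc' hi k (chainBasis _ s)) =
      relSub C hi k ((chains C).d k (chainBasis C (collarSimplex c hc s))) := by
    change prSub C hi k (bdry C k (extRel C i (k + 1) (Finsupp.mapDomain _ (Finsupp.single s 1)))) =
      prSub C hi k (bdry C k (Finsupp.single _ 1))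
    rw [Finsupp.mapDomain_single]
    exact congrArg (fun y => prSub C hi k (bdry C k y)) Finsupp.mapDomain_single
  have e₂ : (chains C).d k (chainBasis C (collarSimplex c hc s)) =
      ∑ j : Fin (k + 2), (-1 : ℤ) ^ (j : ℕ) • chainBasis C ((collarSimplex c hc s).face j) := by
    refine (bdry_apply C k _).trans (Finset.sum_congr rfl fun j _ => ?_)
    exact congrArg ((-1 : ℤ) ^ (j : ℕ) • ·) Finsupp.mapDomain_single
  rw [e₁, e₂, map_sum, Fin.sum_univ_succ, Finset.sum_eq_zero, add_zero, map_zsmul,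
    face_zero_collarSimplex, relSub_basis_push, Fin.val_zero, pow_zero, one_smul]
  intro j _
  rw [map_zsmul, relSub_basis_of_notMem hi (face_collarSimplex_notMem c hc hc' j s), smul_zero]

end collar

/-! ### Equivalences of pullbacks -/

section pullback

variable {G G' H H' : Type*} [Group G] [Group G'] [Group H] [Group H']

/-- The first component of a pullback. -/
def pullbackFst {l : H →* G} {A C : GComplex G} {B : GComplex H}
    (a : GHom (MonoidHom.id G) A C) (b : GHom l B C) : GHom l (pullback a b) A where
  f k := (AddMonoidHom.fst _ _).comp (pullbackSub a b k).subtype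
  comm _ _ := rfl
  smul _ _ _ := rfl

/-- The second component of a pullback. -/
def pullbackSnd {l : H →* G} {A C : GComplex G} {B : GComplex H}
    (a : GHom (MonoidHom.id G) A C) (b : GHom l B C) :
    GHom (MonoidHom.id H) (pullback a b) B where
  f k := (AddMonoidHom.snd _ _).comp (pullbackSub a b k).subtype
  comm _ _ := rfl
  smul _ _ _ := rfl

/-- The chain map of pullbacks that is given by compatible maps of the components. -/
def pullbackMap {φ : G →* G'} {χ : H →* H'} {l : H →* G} {l' : H' →* G'} {A C : GComplex G}
    {B : GComplex H} {A' C' : GComplex G'} {B' : GComplex H'}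
    (a : GHom (MonoidHom.id G) A C) (b : GHom l B C) (a' : GHom (MonoidHom.id G') A' C')
    (b' : GHom l' B' C') (hl : ∀ h, l' (χ h) = φ (l h)) (f : GHom φ A A') (t : GHom χ B B')
    (hft : ∀ k x y, a.f k x = b.f k y → a'.f k (f.f k x) = b'.f k (t.f k y)) :
    GHom χ (pullback a b) (pullback a' b') :=
  pullbackLift a' b' (α := φ.comp l) hl (f.comp (pullbackFst a b) fun _ => rfl)
    (t.comp (pullbackSnd a b) fun _ => rfl) fun k x => hft k x.1.1 x.1.2 x.2

/-- A self map of a pullback is homotopic to the identity if its second component is the identity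
and its first component is homotopic to the identity relative to the base. -/
def pullbackHomotopy {l : H →* G} {A C : GComplex G} {B : GComplex H}
    (a : GHom (MonoidHom.id G) A C) (b : GHom l B C)
    {u : ∀ k, (pullback a b).X k →+ (pullback a b).X k} {v : ∀ k, A.X k →+ A.X k}
    (h₁ : ∀ k (x : (pullback a b).X k), (u k x).1.1 = v k x.1.1)
    (h₂ : ∀ k (x : (pullback a b).X k), (u k x).1.2 = x.1.2)
    (κ : GHomotopy (MonoidHom.id G) (A := A) (B := A) v (fun k => AddMonoidHom.id (A.X k)))
    (hκ : ∀ k x, a.f (k + 1) (κ.h k x) = 0) :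
    GHomotopy (MonoidHom.id H) (A := pullback a b) (B := pullback a b) u
      (fun k => AddMonoidHom.id ((pullback a b).X k)) where
  h k := (((κ.h k).comp ((pullbackFst a b).f k)).prod 0).codRestrict (pullbackSub a b (k + 1))
    fun _ => (hκ k _).trans (map_zero (b.f (k + 1))).symm
  smul k g x := Subtype.ext (Prod.ext (κ.smul k (l g) x.1.1) (smul_zero g).symm)
  zero x := Subtype.ext (Prod.ext ((congrArg (· - x.1.1) (h₁ 0 x)).trans (κ.zero x.1.1))
    ((congrArg (· - x.1.2) (h₂ 0 x)).trans ((sub_self _).trans (map_zero (B.d 0)).symm)))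
  succ k x := Subtype.ext (Prod.ext
    ((congrArg (· - x.1.1) (h₁ (k + 1) x)).trans (κ.succ k x.1.1))
    ((congrArg (· - x.1.2) (h₂ (k + 1) x)).trans ((sub_self _).trans
      ((add_zero _).trans (map_zero (B.d (k + 1)))).symm)))

/-- A map of pullbacks is a chain homotopy equivalence if its first component is a chain homotopy
equivalence relative to the base and its second component is an isomorphism. -/
theorem pullbackMap_isEquivalence {φ : G ≃* G'} {χ : H ≃* H'} {l : H →* G} {l' : H' →* G'}
    {A C : GComplex G} {B : GComplex H} {A' C' : GComplex G'} {B' : GComplex H'}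
    {a : GHom (MonoidHom.id G) A C} {b : GHom l B C} {a' : GHom (MonoidHom.id G') A' C'}
    {b' : GHom l' B' C'} (hl : ∀ h, l' (χ h) = φ (l h)) (f : GHom φ.toMonoidHom A A')
    (t : GHom χ.toMonoidHom B B')
    (hft : ∀ k x y, a.f k x = b.f k y → a'.f k (f.f k x) = b'.f k (t.f k y))
    (e : GHom φ.symm.toMonoidHom A' A) (s : GHom χ.symm.toMonoidHom B' B)
    (hes : ∀ k x y, a'.f k x = b'.f k y → a.f k (e.f k x) = b.f k (s.f k y))
    (hst : ∀ k x, s.f k (t.f k x) = x) (hts : ∀ k x, t.f k (s.f k x) = x)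
    (κ : GHomotopy (MonoidHom.id G) (A := A) (B := A)
      (fun k => (e.f k).comp (f.f k)) (fun k => AddMonoidHom.id (A.X k)))
    (hκ : ∀ k x, a.f (k + 1) (κ.h k x) = 0)
    (μ : GHomotopy (MonoidHom.id G') (A := A') (B := A')
      (fun k => (f.f k).comp (e.f k)) (fun k => AddMonoidHom.id (A'.X k)))
    (hμ : ∀ k x, a'.f (k + 1) (μ.h k x) = 0) :
    (pullbackMap (φ := φ.toMonoidHom) (χ := χ.toMonoidHom) a b a' b' hl f t hft).IsEquivalence := by
  have hl' : ∀ h, l (χ.symm h) = φ.symm (l' h) := fun h => by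
    rw [MulEquiv.eq_symm_apply, ← hl, χ.apply_symm_apply]
  exact ⟨pullbackMap (φ := φ.symm.toMonoidHom) (χ := χ.symm.toMonoidHom) a' b' a b hl' e s hes,
    ⟨pullbackHomotopy a b (fun _ _ => rfl) (fun k x => hst k x.1.2) κ hκ⟩,
    ⟨pullbackHomotopy a' b' (fun _ _ => rfl) (fun k x => hts k x.1.2) μ hμ⟩⟩

end pullback

/-! ### Augmentation -/

section augmentation

/-- The sum of the coefficients. -/
def coeffSum (α : Type*) : (α →₀ ℤ) →+ ℤ := Finsupp.liftAddHom fun _ => AddMonoidHom.id ℤ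

theorem coeffSum_single {α : Type*} (a : α) (m : ℤ) : coeffSum α (.single a m) = m :=
  Finsupp.liftAddHom_apply_single _ a m

theorem coeffSum_mapDomain {α β : Type*} (f : α → β) (x : α →₀ ℤ) :
    coeffSum β (Finsupp.mapDomain f x) = coeffSum α x := by
  suffices h : (coeffSum β).comp (Finsupp.mapDomain.addMonoidHom f) = coeffSum α from
    DFunLike.congr_fun h x
  refine Finsupp.addHom_ext' fun a => AddMonoidHom.ext_int ?_
  change coeffSum β (Finsupp.mapDomain f (.single a 1)) = coeffSum α (.single a 1)
  rw [Finsupp.mapDomain_single, coeffSum_single, coeffSum_single]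

variable {X Y : Type*} [TopologicalSpace X] [TopologicalSpace Y] {G : Type*} [Group G]
  {C : Cov X G} {i : C(Y, X)}

/-- The augmentation of singular `0`-chains. -/
def aug (C : Cov X G) : (chains C).X 0 →+ ℤ := coeffSum _

/-- The augmentation of relative singular `0`-chains. -/
def augRel (C : Cov X G) (hi : IsEmbedding i) : (relChains C hi).X 0 →+ ℤ := coeffSum _

theorem aug_basis (s : Simplex C 0) : aug C (chainBasis C s) = 1 := coeffSum_single s 1

theorem aug_d (x : (chains C).X 1) : aug C ((chains C).d 0 x) = 0 := by
  suffices h : (aug C).comp ((chains C).d 0) = 0 from DFunLike.congr_fun h x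
  refine Finsupp.addHom_ext' fun s => AddMonoidHom.ext_int ?_
  obtain ⟨x, y, r, a, rfl⟩ := exists_pathSimplex s
  refine (congrArg (aug C) (bdry_pathSimplex r a)).trans ?_
  refine (map_sub (aug C) (chainBasis C _) (chainBasis C _)).trans ?_
  rw [aug_basis, aug_basis, sub_self]
  rfl

theorem aug_bd (ξ : (chains C).Cl) : aug C ((chains C).bd ξ) = 0 := by
  obtain ⟨x, rfl⟩ := (chains C).cl_surjective ξ
  exact aug_d x

theorem relExt_toRel_of_isEmpty [IsEmpty Y] (hi : IsEmbedding i) (x : (chains C).X 0) :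
    relExt C hi 0 ((toRel C hi).f 0 x) = x := by
  have h := relExt_add_push (hi := hi) 0 x
  have : IsEmpty (Simplex (C.restrict i) 0) :=
    ⟨fun s => IsEmpty.false (s.toFun (stdSimplex.vertex 0)).1⟩
  have e : relSub C hi 0 x = 0 := Finsupp.ext fun s => this.elim s
  rwa [e, map_zero, add_zero] at h

theorem aug_relExt (hi : IsEmbedding i) (x : (relChains C hi).X 0) :
    aug C (relExt C hi 0 x) = augRel C hi x :=
  coeffSum_mapDomain _ _

theorem augRel_toRel [IsEmpty Y] (hi : IsEmbedding i) (x : (chains C).X 0) :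
    augRel C hi ((toRel C hi).f 0 x) = aug C x := by
  rw [← aug_relExt, relExt_toRel_of_isEmpty]

theorem augRel_d [IsEmpty Y] (hi : IsEmbedding i) (x : (relChains C hi).X 1) :
    augRel C hi ((relChains C hi).d 0 x) = 0 := by
  rw [← toRel_relExt (C := C) (hi := hi) 1 x, ← (toRel C hi).comm, augRel_toRel, aug_d]

/-- Every `0`-chain of the covering is homologous to a multiple of the base point. -/
theorem bd_repClass {w : X} (K : Subgroup (FundamentalGroup X w)) [K.Normal]
    (x : (chains (pathCov w K)).X 0) :
    (chains (pathCov w K)).bd (repClass K x) =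
      aug _ x • chainBasis _ (Simplex.point ⟨w, pathCovBase w K⟩) - x := by
  suffices h : (chains (pathCov w K)).bd.comp (repClass K) =
      ((zmultiplesHom _ (chainBasis _ (Simplex.point ⟨w, pathCovBase w K⟩))).comp (aug _)) -
        AddMonoidHom.id _ from DFunLike.congr_fun h x
  refine Finsupp.addHom_ext' fun s => AddMonoidHom.ext_int ?_
  obtain ⟨⟨y, z⟩, rfl⟩ : ∃ z, s = Simplex.point z :=
    ⟨s.toFun (stdSimplex.vertex 0), Simplex.ext' fun v => congrArg s.toFun (Subsingleton.elim _ _)⟩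
  change (chains (pathCov w K)).bd (repClass K (chainBasis _ (Simplex.point ⟨y, z⟩))) =
    aug _ (chainBasis _ (Simplex.point ⟨y, z⟩)) • chainBasis _ (Simplex.point _) - chainBasis _ _
  rw [repClass_point, bd_pathClass, aug_basis, one_smul, pull_pathCovBase, pathCovMk_pathRep]

end augmentation

variable {N : Type*} [TopologicalSpace N] [ChartedSpace (EuclideanHalfSpace 4) N]
  {Γ π : Type*} [Group Γ] [Group π] {B : BoundaryData N Γ π}

/-! ### Paths and collars in a `Γ` decomposition -/

namespace GammaDecomposition

variable (D : GammaDecomposition B) (n : ℕ)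

instance : PathConnectedSpace D.W :=
  isPathConnected_iff_pathConnectedSpace.1 D.pathConnected

instance (x : D.W) : Nonempty ((D.cov n).fib x) :=
  ⟨pathCovMk D.w (D.K n) (.mk (PathConnectedSpace.somePath x D.w))⟩

theorem nonempty_covB (y : B.dW) : Nonempty ((D.covB n).fib y) :=
  inferInstanceAs (Nonempty ((D.cov n).fib (D.inclW y)))

theorem skel_subset : D.handlesW.skel 0 ⊆ D.W := by
  have h (k : Fin 3) : D.handlesW.skel k ⊆ D.handlesW.skel (k + 1) := by
    rw [D.handlesW.skel_succ k]
    exact Set.subset_union_left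
  exact (((h 0).trans (h 1)).trans (h 2)).trans D.handlesW.skel_three.subset

/-- The collar of `∂₀W` in `W`. -/
def collarMap : C(B.dW × I, D.W) where
  toFun p := ⟨D.handlesW.collar (p.1, p.2), D.skel_subset (by
    rw [D.handlesW.skel_zero]
    exact ⟨_, ⟨p.1.2, p.2.2⟩, rfl⟩)⟩
  continuous_toFun := Continuous.subtype_mk
    (D.handlesW.collar_cont.comp_continuous (f := fun p : B.dW × I => ((p.1 : N), (p.2 : ℝ)))
      (by fun_prop) fun p => ⟨p.1.2, p.2.2⟩) _

theorem collarMap_zero (y : B.dW) : D.collarMap (y, 0) = D.inclW y :=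
  Subtype.ext (D.handlesW.collar_zero y y.2)

/-- Away from its beginning, the collar lies in the interior of `N`, hence not in `∂₀W`. -/
theorem collarMap_notMem (y : B.dW) (t : I) (ht : 0 < t) :
    D.collarMap (y, t) ∉ Set.range D.inclW := by
  rintro ⟨z, hz⟩
  have hz' : (z : N) = D.handlesW.collar (y, t) := congrArg Subtype.val hz
  have hb : (z : N) ∈ D.W ∩ (𝓡∂ 4).boundary N := by
    rw [D.W_boundary]
    exact z.2
  exact D.handlesW.collar_interior y y.2 t ⟨ht, t.2.2⟩ (hz' ▸ hb.2)

/-- The section of `C_{k+1}(W, ∂₀W) → C_k(∂₀W)` that is given by the collar. -/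
def bdSection (k : ℕ) : (chains (D.covB n)).X k →+ (D.rel n).X (k + 1) :=
  collarSection D.collarMap D.collarMap_zero D.collarMap_notMem D.inclW_emb k

theorem bdSection_smul (k : ℕ) (g : D.Gam n) (x : (chains (D.covB n)).X k) :
    D.bdSection n k (g • x) = g • D.bdSection n k x :=
  collarSection_smul ..

/-- The component in `∂₀W` of the boundary of a relative chain. -/
def subBd (k : ℕ) : (D.rel n).X (k + 1) →+ (chains (D.covB n)).X k :=
  relSubBdry (D.cov n) D.inclW_emb k

theorem subBd_bdSection (k : ℕ) (x : (chains (D.covB n)).X k) :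
    D.subBd n k (D.bdSection n k x) = x :=
  relSubBdry_collarSection ..

theorem subBd_smul (k : ℕ) (g : D.Gam n) (x : (D.rel n).X (k + 1)) :
    D.subBd n k (g • x) = g • D.subBd n k x :=
  (bdMap (D.cov n) D.inclW_emb).smul (k + 1) g x

theorem subBd_d (k : ℕ) (x : (D.rel n).X (k + 2)) :
    D.subBd n k ((D.rel n).d (k + 1) x) = - (chains (D.covB n)).d k (D.subBd n (k + 1) x) :=
  subBdry_relBdry ..

/-- The chain class in the `Γ_n` covering of a path in the `Γ_{n+1}` covering from the given point
to the base point. -/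
def ptClass {x : D.W} (z : (D.cov (n + 1)).fib x) : (chains (D.cov n)).Cl :=
  liftClass (K := D.K n) (L := D.K (n + 1)) rfl z

/-- The `0`-chain of a point of the `Γ_n` covering. -/
def pt {x : D.W} (z : (D.cov n).fib x) : (chains (D.cov n)).X 0 :=
  chainBasis _ (Simplex.point ⟨x, z⟩)

theorem smul_pt {x : D.W} (g : D.Gam n) (z : (D.cov n).fib x) : g • D.pt n z = D.pt n (g • z) :=
  smul_chainBasis _ _

theorem bd_ptClass {x : D.W} (z : (D.cov (n + 1)).fib x) :
    (chains (D.cov n)).bd (D.ptClass n z) = D.pt n (D.base n) - D.pt n ((D.redCov n).f z) :=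
  bd_liftClass rfl z

theorem ptClass_smul {x : D.W} (a : D.Gam (n + 1)) (z : (D.cov (n + 1)).fib x) :
    D.ptClass n (a • z) = D.ptClass n (a • D.base (n + 1)) + D.red n a • D.ptClass n z :=
  liftClass_smul rfl a z

theorem ptClass_base : D.ptClass n (D.base (n + 1)) = 0 := liftClass_base rfl

theorem ptClass_pull {x y : D.W} (r : Path.Homotopic.Quotient x y) (z : (D.cov (n + 1)).fib y) :
    D.ptClass n ((D.cov (n + 1)).pull r z) =
      pathClass (D.cov n) r ((D.redCov n).f z) + D.ptClass n z :=
  liftClass_pull rfl r z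

theorem ptClass_injective {x : D.W} {z z' : (D.cov (n + 1)).fib x}
    (h : D.ptClass n z = D.ptClass n z') : z = z' :=
  liftClass_injective rfl h

theorem exists_ptClass {x : D.W} {ξ : (chains (D.cov n)).Cl} {z : (D.cov n).fib x}
    (h : (chains (D.cov n)).bd ξ = D.pt n (D.base n) - D.pt n z) :
    ∃ y : (D.cov (n + 1)).fib x, D.ptClass n y = ξ ∧ (D.redCov n).f y = z :=
  exists_liftClass rfl h

theorem redCov_base : (D.redCov n).f (D.base (n + 1)) = D.base n := rfl

theorem smul_base_injective {a b : D.Gam n} (h : a • D.base n = b • D.base n) : a = b :=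
  ((D.cov n).torsor (D.base n) (b • D.base n)).unique h rfl

theorem exists_smul_base (z : (D.cov n).fib D.w) : ∃ a : D.Gam n, a • D.base n = z :=
  ((D.cov n).torsor (D.base n) z).exists

theorem red_surjective : Function.Surjective (D.red n) := by
  rintro ⟨a⟩
  exact ⟨QuotientGroup.mk a, rfl⟩

theorem exists_smul_base_ptClass {ξ : (chains (D.cov n)).Cl} {b : D.Gam n}
    (h : (chains (D.cov n)).bd ξ = D.pt n (D.base n) - D.pt n (b • D.base n)) :
    ∃ a : D.Gam (n + 1), D.ptClass n (a • D.base (n + 1)) = ξ ∧ D.red n a = b := by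
  obtain ⟨y, hy, hy'⟩ := D.exists_ptClass n h
  obtain ⟨a, rfl⟩ := D.exists_smul_base (n + 1) y
  refine ⟨a, hy, D.smul_base_injective n ?_⟩
  rw [← hy', (D.redCov n).smul, D.redCov_base]

open HomologicalEquivalence in
theorem cl_pathChain {S : Simplex (D.cov (n + 1)) 1} {x : D.W} {z : (D.cov (n + 1)).fib x}
    (h : IsPathFrom D n S ⟨x, z⟩) : (chains (D.cov n)).cl (pathChain D n S) = D.ptClass n z := by
  obtain ⟨x', y', r, a, rfl⟩ := exists_pathSimplex S
  obtain ⟨h₀, h₁⟩ := h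
  rw [pathSimplex_zero] at h₀
  rw [pathSimplex_one] at h₁
  simp only [Sigma.mk.injEq] at h₀ h₁
  obtain ⟨rfl, h₁⟩ := h₁
  obtain rfl := eq_of_heq h₁
  obtain ⟨rfl, h₀⟩ := h₀
  obtain rfl := eq_of_heq h₀
  rw [ptClass_pull, ptClass_base, add_zero, pathChain, map_pathSimplex, pathClass_mk]

open HomologicalEquivalence in
theorem exists_isPathFrom {x : D.W} (z : (D.cov (n + 1)).fib x) :
    ∃ S, IsPathFrom D n S ⟨x, z⟩ := by
  obtain ⟨p, rfl⟩ := pathCovMk_surjective (D.K (n + 1)) x z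
  induction p using Path.Homotopic.Quotient.ind with | mk r => ?_
  refine ⟨pathSimplex _ r (D.base (n + 1)), ?_, pathSimplex_one _ _⟩
  rw [pathSimplex_zero]
  exact congrArg (Sigma.mk x) (pull_pathCovBase (D.K (n + 1)) (.mk r))

end GammaDecomposition

variable {D D' : GammaDecomposition B} {n : ℕ}

namespace HomologicalEquivalence

/-! ### The absolute chain map -/

/-- The second component of the homotopy between the two maps to the stratified chains of `N`: the
map `f` commutes with the boundary maps to the chains of `∂₀W` up to a chain homotopy. -/
theorem exists_boundary_homotopy (E : HomologicalEquivalence D D' n) :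
    ∃ ψ : ∀ k, (D.rel n).X k →+ (chains (D'.covB n)).X k,
      (∀ k (g : D.Gam n) x, ψ k (g • x) = E.φ g • ψ k x) ∧
      ∀ k x, D'.subBd n k (E.f.f (k + 1) x) - (chainsMap E.θ).f k (D.subBd n k x) =
        - (chains (D'.covB n)).d k (ψ (k + 1) x) + ψ k ((D.rel n).d k x) := by
  obtain ⟨h⟩ := E.f_comm
  let s (k : ℕ) : (D'.stratN n).X (k + 1) →+ (chains (D'.covB n)).X k :=
    (pullbackSnd (bdMap B.univCov B.inclN_emb) (chainsMap (D'.covBToN n)).susp).f (k + 1)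
  exact ⟨fun k => (s k).comp (h.h k), fun k g x => congrArg (s k) (h.smul k g x),
    fun k x => congrArg (s k) (h.succ k x)⟩

variable (E : HomologicalEquivalence D D' n)

/-- The absolute map is assembled from `f` and `θ`, and from the homotopy between their boundary
maps. -/
theorem nonempty_absoluteMap : Nonempty (AbsoluteMap E) := by
  obtain ⟨ψ, hψ, hd⟩ := E.exists_boundary_homotopy
  exact ⟨⟨absoluteMap E.f E.θ ψ hψ hd, absoluteMap_push E.f E.θ ψ hψ hd,
    toRel_absoluteMap E.f E.θ ψ hψ hd⟩⟩

variable {E}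

theorem AbsoluteMap.shortExactMap (g : AbsoluteMap E) :
    ShortExactMap (chainsPush (D.cov n) D.inclW) (toRel (D.cov n) D.inclW_emb)
      (chainsPush (D'.cov n) D'.inclW) (toRel (D'.cov n) D'.inclW_emb) (chainsMap E.θ) g.g E.f where
  surj := toRel_surjective _ _
  exact := exists_push_of_toRel_eq_zero
  zero := toRel_push
  inj' := chainsPush_injective D'.inclW_emb
  surj' := toRel_surjective _ _
  exact' := exists_push_of_toRel_eq_zero
  zero' := toRel_push
  sub := g.sub
  rel := g.rel

theorem AbsoluteMap.cl_injective (g : AbsoluteMap E) {ξ : (chains (D.cov n)).Cl}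
    (h₀ : (chains (D.cov n)).bd ξ = 0) (h₁ : g.g.cl ξ = 0) : ξ = 0 :=
  g.shortExactMap.cl_injective (chainsMap_bijective E.θ (D.nonempty_covB n)) E.f_equivalence h₀ h₁

theorem AbsoluteMap.cl_surjective (g : AbsoluteMap E) {ξ : (chains (D'.cov n)).Cl}
    (h₀ : (chains (D'.cov n)).bd ξ = 0) : ∃ ζ, (chains (D.cov n)).bd ζ = 0 ∧ g.g.cl ζ = ξ :=
  g.shortExactMap.cl_surjective (chainsMap_bijective E.θ (D.nonempty_covB n)) E.f_equivalence h₀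

theorem AbsoluteMap.g_pt (g : AbsoluteMap E) {y : B.dW} (b : (D.covB n).fib y) :
    g.g.f 0 (D.pt n (x := D.inclW y) b) = D'.pt n (x := D'.inclW y) (E.θ.f b) := by
  have h := g.sub 0 (chainBasis _ (Simplex.point ⟨y, b⟩))
  have e₁ : (chainsPush (D.cov n) D.inclW).f 0 (chainBasis _ (Simplex.point ⟨y, b⟩)) =
      D.pt n (x := D.inclW y) b := Finsupp.mapDomain_single
  have e₂ : (chainsMap E.θ).f 0 (chainBasis _ (Simplex.point ⟨y, b⟩)) =
      chainBasis _ (Simplex.point ⟨y, E.θ.f b⟩) := Finsupp.mapDomain_single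
  rw [e₁, e₂] at h
  exact h.trans Finsupp.mapDomain_single

theorem AbsoluteMap.g_pathClass (g : AbsoluteMap E) {y z : B.dW}
    (r : Path.Homotopic.Quotient y z) (b : (D.covB n).fib z) :
    g.g.cl (pathClass (D.cov n) (r.map D.inclW) b) =
      pathClass (D'.cov n) (r.map D'.inclW) (E.θ.f b) := by
  induction r using Path.Homotopic.Quotient.ind with | mk r => ?_
  refine congrArg (chains (D'.cov n)).cl
    (?_ : g.g.f 1 (chainBasis _ (pathSimplex (D.cov n) (r.map D.inclW.continuous) b)) =
      chainBasis _ (pathSimplex (D'.cov n) (r.map D'.inclW.continuous) (E.θ.f b)))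
  have h := g.sub 1 (chainBasis _ (pathSimplex _ r b))
  have e₁ : (chainsPush (D.cov n) D.inclW).f 1 (chainBasis _ (pathSimplex _ r b)) =
      chainBasis _ ((pathSimplex (D.covB n) r b).push D.inclW) := Finsupp.mapDomain_single
  have e₂ : (chainsMap E.θ).f 1 (chainBasis _ (pathSimplex _ r b)) =
      chainBasis _ ((pathSimplex (D.covB n) r b).map E.θ) := Finsupp.mapDomain_single
  rw [e₁, e₂, push_pathSimplex, map_pathSimplex] at h
  refine h.trans (Finsupp.mapDomain_single.trans ?_)
  rw [push_pathSimplex]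
  rfl

/-- The image of the base point has augmentation one. If `∂₀W` is empty, this holds because `f`
commutes up to homotopy with the maps to the chains of `N`; otherwise, the base point can be joined
to `∂₀W`, where `g` is given by `θ`. -/
theorem AbsoluteMap.aug_base (g : AbsoluteMap E) :
    aug (D'.cov n) (g.g.f 0 (D.pt n (D.base n))) = 1 := by
  rcases isEmpty_or_nonempty B.dW with hB | ⟨⟨y⟩⟩
  · obtain ⟨h⟩ := E.f_comm
    have h₀ := congrArg (fun x : (D'.stratN n).X 0 => x.1.1)
      (h.zero ((toRel (D.cov n) D.inclW_emb).f 0 (D.pt n (D.base n))))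
    change (D'.relToN n).f 0 (E.f.f 0 _) - (D.relToN n).f 0 _ =
      (relChains B.univCov B.inclN_emb).d 0 _ at h₀
    have h₁ := congrArg (augRel B.univCov B.inclN_emb) h₀
    rw [augRel_d, map_sub, sub_eq_zero, ← g.rel] at h₁
    have e (D₁ : GammaDecomposition B) (x : (D₁.rel n).X 0) :
        augRel B.univCov B.inclN_emb ((D₁.relToN n).f 0 x) = augRel (D₁.cov n) D₁.inclW_emb x :=
      coeffSum_mapDomain _ _
    rw [e, e, augRel_toRel, augRel_toRel] at h₁
    rw [h₁]
    exact aug_basis _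
  · obtain ⟨b⟩ := D.nonempty_covB (n + 1) y
    have h := congrArg (fun x => aug (D'.cov n) (g.g.f 0 x)) (D.bd_ptClass n (x := D.inclW y) b)
    simp only [← GHom.bd_cl, aug_bd, map_sub] at h
    rw [eq_comm, sub_eq_zero] at h
    rw [h]
    refine (congrArg _ (g.g_pt ((D.redCov n).f (x := D.inclW y) b))).trans ?_
    exact aug_basis _

theorem AbsoluteMap.isConnecting_iff (g : AbsoluteMap E) (c : (chains (D'.cov n)).X 1) :
    g.IsConnecting c ↔ (chains (D'.cov n)).bd ((chains (D'.cov n)).cl c) =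
      g.g.f 0 (D.pt n (D.base n)) - D'.pt n (D'.base n) :=
  Iff.rfl

/-- A `0`-chain of augmentation one is homologous to the base point. -/
theorem AbsoluteMap.exists_isConnecting (g : AbsoluteMap E) : ∃ c, g.IsConnecting c := by
  have h := bd_repClass (D'.K n) (g.g.f 0 (D.pt n (D.base n)))
  rw [g.aug_base, one_smul] at h
  obtain ⟨c, hc⟩ := (chains (D'.cov n)).cl_surjective
    (-repClass (D'.K n) (g.g.f 0 (D.pt n (D.base n))))
  refine ⟨c, (g.isConnecting_iff c).2 ?_⟩
  rw [hc, map_neg, h, neg_sub]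
  rfl

/-! ### The induced lift -/

theorem cl_eq_iff {G : Type*} [Group G] (A : GComplex G) (x y : A.X 1) :
    (∃ z, x - y = A.d 1 z) ↔ A.cl x = A.cl y := by
  rw [← sub_eq_zero (a := A.cl x), ← map_sub, A.cl_eq_zero]
  exact exists_congr fun z => eq_comm

/-- In terms of chain classes, a lift is induced by `g` if it satisfies the equations that
determine the classes of the images of points. -/
theorem Lift.isInduced_iff (L : Lift E) (g : AbsoluteMap E) (c : (chains (D'.cov n)).X 1) :
    L.IsInduced g c ↔
      (∀ a, D'.ptClass n (L.φ a • D'.base (n + 1)) = g.g.cl (D.ptClass n (a • D.base (n + 1))) -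
        (chains (D'.cov n)).cl c + E.φ (D.red n a) • (chains (D'.cov n)).cl c) ∧
      ∀ (y : B.dW) (b : (D.covB (n + 1)).fib y), D'.ptClass n (x := D'.inclW y) (L.θ.f b) =
        g.g.cl (D.ptClass n (x := D.inclW y) b) - (chains (D'.cov n)).cl c := by
  constructor
  · rintro ⟨h₁, h₂⟩
    constructor
    · intro a
      obtain ⟨S, hS⟩ := D.exists_isPathFrom n (a • D.base (n + 1))
      obtain ⟨S', hS'⟩ := D'.exists_isPathFrom n (L.φ a • D'.base (n + 1))
      have h := (cl_eq_iff _ _ _).1 (h₁ a S S' hS hS')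
      rw [← GHom.cl_cl, D.cl_pathChain n hS, map_sub, map_add, D'.cl_pathChain n hS'] at h
      rw [h, GComplex.smul_cl]
      abel
    · intro y b
      obtain ⟨S, hS⟩ := D.exists_isPathFrom n (x := D.inclW y) b
      obtain ⟨S', hS'⟩ := D'.exists_isPathFrom n (x := D'.inclW y) (L.θ.f b)
      have h := (cl_eq_iff _ _ _).1 (h₂ y b S S' hS hS')
      rw [← GHom.cl_cl, D.cl_pathChain n hS, map_add, D'.cl_pathChain n hS'] at h
      rw [h, add_sub_cancel_right]
  · rintro ⟨h₁, h₂⟩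
    constructor
    · intro a S S' hS hS'
      refine (cl_eq_iff _ _ _).2 ?_
      rw [← GHom.cl_cl, D.cl_pathChain n hS, map_sub, map_add, D'.cl_pathChain n hS', h₁,
        GComplex.smul_cl]
      abel
    · intro y b S S' hS hS'
      refine (cl_eq_iff _ _ _).2 ?_
      rw [← GHom.cl_cl, D.cl_pathChain n hS, map_add, D'.cl_pathChain n hS', h₂]
      abel

theorem Lift.ext' {L L' : Lift E} (hφ : ∀ a, L.φ a = L'.φ a)
    (hθ : ∀ (y : B.dW) (b : (D.covB (n + 1)).fib y), L.θ.f b = L'.θ.f b) : L = L' := by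
  obtain ⟨φ, hl, ⟨θ, hs, hp⟩, ht⟩ := L
  obtain ⟨φ', hl', ⟨θ', hs', hp'⟩, ht'⟩ := L'
  obtain rfl : φ = φ' := MulEquiv.ext hφ
  obtain rfl : @θ = @θ' := by
    funext y b
    exact hθ y b
  rfl

theorem Lift.IsInduced.unique {L L' : Lift E} {g : AbsoluteMap E} {c : (chains (D'.cov n)).X 1}
    (h : L.IsInduced g c) (h' : L'.IsInduced g c) : L = L' := by
  rw [Lift.isInduced_iff] at h h'
  exact Lift.ext'
    (fun a => D'.smul_base_injective (n + 1) (D'.ptClass_injective n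
      ((h.1 a).trans (h'.1 a).symm)))
    (fun y b => D'.ptClass_injective n (x := D'.inclW y) ((h.2 y b).trans (h'.2 y b).symm))

section existence

variable (g : AbsoluteMap E) {c : (chains (D'.cov n)).X 1}

/-- The class that the image of `a` must have bounds the points that it should join, so that it is
the class of a point of the `Γ_{n+1}` covering over the base point. -/
theorem AbsoluteMap.exists_liftφ (hc : g.IsConnecting c) (a : D.Gam (n + 1)) :
    ∃ a' : D'.Gam (n + 1), D'.ptClass n (a' • D'.base (n + 1)) =
      g.g.cl (D.ptClass n (a • D.base (n + 1))) -
        (chains (D'.cov n)).cl c + E.φ (D.red n a) • (chains (D'.cov n)).cl c ∧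
      D'.red n a' = E.φ (D.red n a) := by
  apply D'.exists_smul_base_ptClass
  rw [map_add, map_sub, GHom.bd_cl, GComplex.bd_smul, (g.isConnecting_iff c).1 hc, D.bd_ptClass,
    (D.redCov n).smul, D.redCov_base, map_sub, ← D.smul_pt, g.g.smul, smul_sub, ← D'.smul_pt]
  simp only [MulEquiv.toMonoidHom_eq_coe, MonoidHom.coe_coe]
  abel

/-- The lift of `φ` to `Γ_{n+1}` that is induced by `g` and `c`. -/
def AbsoluteMap.liftφ (hc : g.IsConnecting c) (a : D.Gam (n + 1)) : D'.Gam (n + 1) :=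
  (g.exists_liftφ hc a).choose

theorem AbsoluteMap.ptClass_liftφ (hc : g.IsConnecting c) (a : D.Gam (n + 1)) :
    D'.ptClass n (g.liftφ hc a • D'.base (n + 1)) =
      g.g.cl (D.ptClass n (a • D.base (n + 1))) -
        (chains (D'.cov n)).cl c + E.φ (D.red n a) • (chains (D'.cov n)).cl c :=
  (g.exists_liftφ hc a).choose_spec.1

theorem AbsoluteMap.red_liftφ (hc : g.IsConnecting c) (a : D.Gam (n + 1)) :
    D'.red n (g.liftφ hc a) = E.φ (D.red n a) :=
  (g.exists_liftφ hc a).choose_spec.2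

theorem AbsoluteMap.liftφ_mul (hc : g.IsConnecting c) (a b : D.Gam (n + 1)) :
    g.liftφ hc (a * b) = g.liftφ hc a * g.liftφ hc b := by
  apply D'.smul_base_injective (n + 1)
  apply D'.ptClass_injective n
  rw [g.ptClass_liftφ, mul_smul, mul_smul, D.ptClass_smul, D'.ptClass_smul n (g.liftφ hc a),
    g.ptClass_liftφ, g.ptClass_liftφ, g.red_liftφ, map_add, g.g.cl_smul, map_mul, map_mul,
    smul_add, smul_sub, mul_smul]
  simp only [MulEquiv.toMonoidHom_eq_coe, MonoidHom.coe_coe]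
  abel

/-- Bijectivity over `Γ_n` amounts to bijectivity of the map of first homology groups that is
induced by `g`, which holds by the five lemma. -/
theorem AbsoluteMap.liftφ_bijective (hc : g.IsConnecting c) :
    Function.Bijective (g.liftφ hc) := by
  constructor
  · refine (injective_iff_map_eq_one (MonoidHom.mk' (g.liftφ hc) (g.liftφ_mul hc))).2 fun a ha => ?_
    have ha' : g.liftφ hc a = 1 := ha
    have h₁ := g.red_liftφ hc a
    have h₂ := g.ptClass_liftφ hc a
    rw [ha', map_one, eq_comm, map_eq_one_iff E.φ E.φ.injective] at h₁
    rw [ha', one_smul, D'.ptClass_base, h₁, map_one, one_smul, sub_add_cancel] at h₂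
    have h₃ : D.ptClass n (a • D.base (n + 1)) = 0 := by
      refine g.cl_injective ?_ h₂.symm
      rw [D.bd_ptClass, (D.redCov n).smul, h₁, one_smul, D.redCov_base, sub_self]
    refine D.smul_base_injective (n + 1) (D.ptClass_injective n ?_)
    rw [h₃, one_smul, D.ptClass_base]
  · intro a'
    obtain ⟨a₀, ha₀⟩ := D.red_surjective n (E.φ.symm (D'.red n a'))
    have ha₀' : E.φ (D.red n a₀) = D'.red n a' := by rw [ha₀, E.φ.apply_symm_apply]
    obtain ⟨ζ, hζ, hζ'⟩ := g.cl_surjective (ξ := D'.ptClass n (a' • D'.base (n + 1)) -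
        D'.ptClass n (g.liftφ hc a₀ • D'.base (n + 1))) (by
      rw [map_sub, D'.bd_ptClass, D'.bd_ptClass, (D'.redCov n).smul, (D'.redCov n).smul,
        g.red_liftφ, ha₀', sub_self])
    obtain ⟨a, ha, ha'⟩ := D.exists_smul_base_ptClass n
      (ξ := ζ + D.ptClass n (a₀ • D.base (n + 1))) (b := D.red n a₀) (by
        rw [map_add, hζ, zero_add, D.bd_ptClass, (D.redCov n).smul, D.redCov_base])
    refine ⟨a, D'.smul_base_injective (n + 1) (D'.ptClass_injective n ?_)⟩
    rw [g.ptClass_liftφ, ha, ha', map_add, hζ', g.ptClass_liftφ]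
    abel

theorem AbsoluteMap.exists_liftθ (hc : g.IsConnecting c) {y : B.dW}
    (b : (D.covB (n + 1)).fib y) :
    ∃ b' : (D'.covB (n + 1)).fib y, D'.ptClass n (x := D'.inclW y) b' =
      g.g.cl (D.ptClass n (x := D.inclW y) b) - (chains (D'.cov n)).cl c ∧
      (D'.redCov n).f (x := D'.inclW y) b' = E.θ.f ((D.redCov n).f (x := D.inclW y) b) := by
  refine D'.exists_ptClass n (x := D'.inclW y) ?_
  rw [map_sub, GHom.bd_cl, (g.isConnecting_iff c).1 hc]
  refine (congrArg (· - (g.g.f 0 (D.pt n (D.base n)) - D'.pt n (D'.base n)))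
    ((congrArg (g.g.f 0) (D.bd_ptClass n (x := D.inclW y) b)).trans ((map_sub _ _ _).trans
      (congrArg (g.g.f 0 (D.pt n (D.base n)) - ·) (g.g_pt _))))).trans ?_
  abel

/-- The lift of `θ` to the `Γ_{n+1}` coverings that is induced by `g` and `c`. -/
def AbsoluteMap.liftθ (hc : g.IsConnecting c) {y : B.dW} (b : (D.covB (n + 1)).fib y) :
    (D'.covB (n + 1)).fib y :=
  (g.exists_liftθ hc b).choose

theorem AbsoluteMap.ptClass_liftθ (hc : g.IsConnecting c) {y : B.dW}
    (b : (D.covB (n + 1)).fib y) : D'.ptClass n (x := D'.inclW y) (g.liftθ hc b) =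
      g.g.cl (D.ptClass n (x := D.inclW y) b) - (chains (D'.cov n)).cl c :=
  (g.exists_liftθ hc b).choose_spec.1

theorem AbsoluteMap.red_liftθ (hc : g.IsConnecting c) {y : B.dW} (b : (D.covB (n + 1)).fib y) :
    (D'.redCov n).f (x := D'.inclW y) (g.liftθ hc b) =
      E.θ.f ((D.redCov n).f (x := D.inclW y) b) :=
  (g.exists_liftθ hc b).choose_spec.2

/-- The lift of `(φ, θ)` that is induced by `g` and `c`. -/
def AbsoluteMap.lift (hc : g.IsConnecting c) : Lift E where
  φ := MulEquiv.ofBijective (MonoidHom.mk' (g.liftφ hc) (g.liftφ_mul hc)) (g.liftφ_bijective hc)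
  φ_lift := g.red_liftφ hc
  θ :=
    { f := g.liftθ hc
      smul := fun {y} a b => by
        refine D'.ptClass_injective n (x := D'.inclW y) ?_
        refine (g.ptClass_liftθ hc _).trans (Eq.trans ?_
          (D'.ptClass_smul n (x := D'.inclW y) (g.liftφ hc a) (g.liftθ hc b)).symm)
        rw [g.ptClass_liftθ, g.ptClass_liftφ, g.red_liftφ, smul_sub]
        refine (congrArg (g.g.cl · - (chains (D'.cov n)).cl c)
          (D.ptClass_smul n (x := D.inclW y) a b)).trans ?_
        rw [map_add]
        refine (congrArg (g.g.cl (D.ptClass n (a • D.base (n + 1))) + · - (chains (D'.cov n)).cl c)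
          (g.g.cl_smul (D.red n a) (D.ptClass n (x := D.inclW y) b))).trans ?_
        simp only [MulEquiv.toMonoidHom_eq_coe, MonoidHom.coe_coe]
        abel
      pull := fun {y z} p b => by
        refine D'.ptClass_injective n (x := D'.inclW y) ?_
        refine (g.ptClass_liftθ hc _).trans (Eq.trans ?_
          (D'.ptClass_pull n (p.map D'.inclW) (g.liftθ hc b)).symm)
        rw [g.ptClass_liftθ, g.red_liftθ]
        refine (congrArg (g.g.cl · - (chains (D'.cov n)).cl c)
          (D.ptClass_pull n (p.map D.inclW) b)).trans ?_
        rw [map_add, add_sub_assoc]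
        exact congrArg (· + _) (g.g_pathClass p _) }
  θ_lift _ b := g.red_liftθ hc b

theorem AbsoluteMap.lift_isInduced (hc : g.IsConnecting c) : (g.lift hc).IsInduced g c :=
  (Lift.isInduced_iff _ _ _).2 ⟨g.ptClass_liftφ hc, fun _ => g.ptClass_liftθ hc⟩

end existence

/-! ### The dependence on the connecting chain -/

/-- The difference `c - c'` of two connecting chains is a cycle, and `κ` is the element of the
kernel of `Γ_{n+1} → Γ_n` with this class. -/
theorem Lift.IsInduced.exists_conj {L L' : Lift E} {g : AbsoluteMap E}
    {c c' : (chains (D'.cov n)).X 1} (hc : g.IsConnecting c) (hc' : g.IsConnecting c')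
    (h : L.IsInduced g c) (h' : L'.IsInduced g c') :
    ∃ κ ∈ (D'.red n).ker, (∀ a, L'.φ a = κ * L.φ a * κ⁻¹) ∧
      ∀ (y : B.dW) (b : (D.covB (n + 1)).fib y), L'.θ.f b = κ • L.θ.f b := by
  rw [Lift.isInduced_iff] at h h'
  rw [g.isConnecting_iff] at hc hc'
  obtain ⟨κ, hκ, hκ'⟩ := D'.exists_smul_base_ptClass n
    (ξ := (chains (D'.cov n)).cl c - (chains (D'.cov n)).cl c') (b := 1) (by
      rw [map_sub, hc, hc', one_smul, sub_self, sub_self])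
  have hinv : D'.ptClass n (κ⁻¹ • D'.base (n + 1)) =
      (chains (D'.cov n)).cl c' - (chains (D'.cov n)).cl c := by
    have e := D'.ptClass_smul n κ (κ⁻¹ • D'.base (n + 1))
    rw [smul_inv_smul, D'.ptClass_base, hκ, hκ', one_smul] at e
    rw [← neg_sub, eq_neg_iff_add_eq_zero, add_comm, ← e]
  refine ⟨κ, hκ', fun a => ?_, fun y b => ?_⟩
  · apply D'.smul_base_injective (n + 1)
    apply D'.ptClass_injective n
    rw [h'.1, mul_smul, mul_smul, D'.ptClass_smul n κ, D'.ptClass_smul n (L.φ a), hκ, hκ', one_smul,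
      hinv, h.1, L.φ_lift, smul_sub]
    abel
  · refine D'.ptClass_injective n (x := D'.inclW y) ?_
    refine (h'.2 y b).trans (Eq.trans ?_ (D'.ptClass_smul n (x := D'.inclW y) κ (L.θ.f b)).symm)
    rw [h.2, hκ, hκ', one_smul]
    abel

/-! ### The lift to stratified chains -/

/-- `θ̂` covers `θ`, on the suspended chains of `∂₀W`. -/
theorem Lift.susp_θ (L : Lift E) : ∀ k (y : (susp (chains (D.covB (n + 1)))).X k),
    (chainsMap ((D'.redCov n).restrict D'.inclW)).susp.f k ((chainsMap L.θ).susp.f k y) =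
      (chainsMap E.θ).susp.f k ((chainsMap ((D.redCov n).restrict D.inclW)).susp.f k y)
  | 0, _ => rfl
  | k + 1, y => by
    refine (Finsupp.mapDomain_comp (f := Simplex.map L.θ)
      (g := Simplex.map ((D'.redCov n).restrict D'.inclW))
      (v := (y : Simplex (D.covB (n + 1)) k →₀ ℤ))).symm.trans (Eq.trans ?_
      (Finsupp.mapDomain_comp (f := Simplex.map ((D.redCov n).restrict D.inclW))
        (g := Simplex.map E.θ) (v := (y : Simplex (D.covB (n + 1)) k →₀ ℤ))))
    refine congrArg (fun F => Finsupp.mapDomain F (y : Simplex (D.covB (n + 1)) k →₀ ℤ)) ?_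
    funext s
    exact Simplex.ext' fun v => Sigma.ext rfl (heq_of_eq (L.θ_lift _ (s.toFun v).2))

theorem susp_comp_of_inverse {G G' : Type*} [Group G] [Group G'] {φ : G →* G'} {φ' : G' →* G}
    {A : GComplex G} {B : GComplex G'} (f : GHom φ A B) (f' : GHom φ' B A)
    (h : ∀ k x, f'.f k (f.f k x) = x) : ∀ k x, f'.susp.f k (f.susp.f k x) = x
  | 0, _ => rfl
  | k + 1, x => h k x

/-- Every lift of `(φ, θ)` extends `f` to the stratified chains: after a deformation, `f` is a chain
map over the suspended chains of `∂₀W`, and it is an equivalence relative to these chains. -/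
theorem Lift.hasStratifiedLift (L : Lift E) : L.HasStratifiedLift := by
  obtain ⟨ψ, hψ, hd⟩ := E.exists_boundary_homotopy
  -- `f` is deformed to a chain map that commutes strictly with the boundary maps to `∂₀W`.
  let m : ∀ k, (D.rel n).X k →+ (D'.rel n).X (k + 1) := fun k => -(D'.bdSection n k).comp (ψ k)
  have m_smul : ∀ k (g : D.Gam n) x, m k (g • x) = E.φ.toMonoidHom g • m k x := fun k g x => by
    simp only [m, AddMonoidHom.neg_apply, AddMonoidHom.comp_apply, hψ, D'.bdSection_smul, smul_neg]
    rfl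
  have sub_m : ∀ k x, D'.subBd n k (m k x) = - ψ k x := fun k x => by
    simp only [m, AddMonoidHom.neg_apply, AddMonoidHom.comp_apply, map_neg, D'.subBd_bdSection]
  let f' := E.f.addBoundary m m_smul
  have f'_zero : ∀ x, f'.f 0 x = E.f.f 0 x + (D'.rel n).d 0 (m 0 x) := E.f.addBoundary_zero m m_smul
  have f'_succ : ∀ k x, f'.f (k + 1) x = E.f.f (k + 1) x + (D'.rel n).d (k + 1) (m (k + 1) x) +
    m k ((D.rel n).d k x) := E.f.addBoundary_succ m m_smul
  have sub_f' : ∀ k x, D'.subBd n k (f'.f (k + 1) x) = (chainsMap E.θ).f k (D.subBd n k x) := by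
    intro k x
    rw [f'_succ, map_add, map_add, D'.subBd_d, sub_m, sub_m, map_neg, neg_neg, eq_comm,
      ← sub_eq_zero]
    have := hd k x
    rw [sub_eq_iff_eq_add] at this
    rw [this]
    abel
  have bd_f' : ∀ k x, (bdMap (D'.cov n) D'.inclW_emb).f k (f'.f k x) =
      (chainsMap E.θ).susp.f k ((bdMap (D.cov n) D.inclW_emb).f k x)
    | 0, _ => rfl
    | k + 1, x => sub_f' k x
  obtain ⟨e, ⟨h⟩, ⟨h'⟩⟩ := E.f_equivalence
  have h_zero : ∀ x, e.f 0 (E.f.f 0 x) - x = (D.rel n).d 0 (h.h 0 x) := h.zero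
  have h_succ : ∀ k x, e.f (k + 1) (E.f.f (k + 1) x) - x =
    (D.rel n).d (k + 1) (h.h (k + 1) x) + h.h k ((D.rel n).d k x) := h.succ
  have h'_zero : ∀ x, E.f.f 0 (e.f 0 x) - x = (D'.rel n).d 0 (h'.h 0 x) := h'.zero
  have h'_succ : ∀ k x, E.f.f (k + 1) (e.f (k + 1) x) - x =
    (D'.rel n).d (k + 1) (h'.h (k + 1) x) + h'.h k ((D'.rel n).d k x) := h'.succ
  have hφ : ∀ a, E.φ.symm.toMonoidHom (E.φ.toMonoidHom a) = a := E.φ.symm_apply_apply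
  have hφ' : ∀ a, E.φ.toMonoidHom (E.φ.symm.toMonoidHom a) = a := E.φ.apply_symm_apply
  let j : GHomotopy (MonoidHom.id _) (A := D.rel n) (B := D.rel n)
      (fun k => (e.f k).comp (f'.f k)) (fun k => AddMonoidHom.id _) :=
    { h := fun k => h.h k + (e.f (k + 1)).comp (m k)
      smul := fun k g x => by
        simp only [AddMonoidHom.add_apply, AddMonoidHom.comp_apply, h.smul, m_smul, e.smul, hφ,
          MonoidHom.id_apply, smul_add]
      zero := fun x => by
        simp only [AddMonoidHom.add_apply, AddMonoidHom.comp_apply, AddMonoidHom.id_apply, f'_zero,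
          map_add, ← h_zero, e.comm]
        abel
      succ := fun k x => by
        simp only [AddMonoidHom.add_apply, AddMonoidHom.comp_apply, AddMonoidHom.id_apply, f'_succ,
          map_add, eq_sub_of_add_eq (h_succ k x).symm, ← e.comm]
        abel }
  let j' : GHomotopy (MonoidHom.id _) (A := D'.rel n) (B := D'.rel n)
      (fun k => (f'.f k).comp (e.f k)) (fun k => AddMonoidHom.id _) :=
    { h := fun k => h'.h k + (m k).comp (e.f k)
      smul := fun k g x => by
        simp only [AddMonoidHom.add_apply, AddMonoidHom.comp_apply, h'.smul, m_smul, e.smul, hφ',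
          MonoidHom.id_apply, smul_add]
      zero := fun x => by
        simp only [AddMonoidHom.add_apply, AddMonoidHom.comp_apply, AddMonoidHom.id_apply, f'_zero,
          map_add, ← h'_zero]
        abel
      succ := fun k x => by
        simp only [AddMonoidHom.add_apply, AddMonoidHom.comp_apply, AddMonoidHom.id_apply, f'_succ,
          map_add, eq_sub_of_add_eq (h'_succ k x).symm, e.comm]
        abel }
  let θi := E.θ.inv (D.nonempty_covB n)
  have hθ : ∀ k x, (chainsMap θi).f k ((chainsMap E.θ).f k x) = x :=
    chainsMap_comp_of_inverse _ _ (E.θ.inv_f _)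
  have hθ' : ∀ k x, (chainsMap E.θ).f k ((chainsMap θi).f k x) = x :=
    chainsMap_comp_of_inverse _ _ (E.θ.f_inv _)
  have p_θ : ∀ k x, (chainsMap θi).susp.f k ((chainsMap E.θ).susp.f k x) = x :=
    susp_comp_of_inverse _ _ hθ
  -- The base is the suspension of the chains of `∂₀W` in the covering of `W'`, to which those of `W`
  -- are mapped by `θ`. The collar lifts its chains to relative chains in positive degrees.
  obtain ⟨e', he', ⟨κ, hκ⟩, ⟨μ, hμ⟩⟩ := exists_inverse_over (A := D.rel n) (B := D'.rel n)
    (φ := E.φ.toMonoidHom) (φ' := E.φ.symm.toMonoidHom)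
    (S := fun k => (susp (chains (D'.covB n))).X k) (D := (susp (chains (D'.covB n))).d)
    (p := fun k => ((chainsMap E.θ).susp.f k).comp ((bdMap (D.cov n) D.inclW_emb).f k))
    (q := (bdMap (D'.cov n) D'.inclW_emb).f) hφ hφ'
    (fun k x => (congrArg ((chainsMap E.θ).susp.f k) ((bdMap _ D.inclW_emb).comm k x)).trans
      ((chainsMap E.θ).susp.comm k _))
    (bdMap _ D'.inclW_emb).comm
    (fun k => (D.bdSection n k).comp (D.subBd n k))
    (fun k g x => by simp only [AddMonoidHom.comp_apply, D.subBd_smul, D.bdSection_smul])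
    (fun k x => congrArg ((chainsMap E.θ).f k) (D.subBd_bdSection n k _))
    (fun k => (D.bdSection n k).comp (((chainsMap θi).f k).comp (D'.subBd n k)))
    (fun k g x => by
      simp only [AddMonoidHom.comp_apply, D'.subBd_smul, (chainsMap θi).smul, D.bdSection_smul])
    (fun k x => (congrArg ((chainsMap E.θ).f k) (D.subBd_bdSection n k _)).trans (hθ' k _))
    (fun k => (D'.bdSection n k).comp (D'.subBd n k))
    (fun k g x => by simp only [AddMonoidHom.comp_apply, D'.subBd_smul, D'.bdSection_smul])
    (fun k x => D'.subBd_bdSection n k _)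
    (fun k => (D'.bdSection n k).comp (((chainsMap E.θ).f k).comp (D.subBd n k)))
    (fun k g x => by
      simp only [AddMonoidHom.comp_apply, D.subBd_smul, (chainsMap E.θ).smul, D'.bdSection_smul])
    (fun k x => D'.subBd_bdSection n k _)
    f' bd_f' e j j'
  have hτ : ∀ k x, (chainsMap (L.θ.inv (D.nonempty_covB (n + 1)))).susp.f k
      ((chainsMap L.θ).susp.f k x) = x :=
    susp_comp_of_inverse _ _ (chainsMap_comp_of_inverse _ _ (L.θ.inv_f _))
  have hτ' : ∀ k x, (chainsMap L.θ).susp.f k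
      ((chainsMap (L.θ.inv (D.nonempty_covB (n + 1)))).susp.f k x) = x :=
    susp_comp_of_inverse _ _ (chainsMap_comp_of_inverse _ _ (L.θ.f_inv _))
  have hft : ∀ k x y, (bdMap (D.cov n) D.inclW_emb).f k x =
      (chainsMap ((D.redCov n).restrict D.inclW)).susp.f k y →
      (bdMap (D'.cov n) D'.inclW_emb).f k (f'.f k x) =
        (chainsMap ((D'.redCov n).restrict D'.inclW)).susp.f k ((chainsMap L.θ).susp.f k y) :=
    fun k x y hxy => (bd_f' k x).trans
      ((congrArg ((chainsMap E.θ).susp.f k) hxy).trans (L.susp_θ k y).symm)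
  refine ⟨f', ⟨⟨m, m_smul, fun x => ?_, fun k x => ?_⟩⟩,
    pullbackMap (φ := E.φ.toMonoidHom) (χ := L.φ.toMonoidHom) _ _ _ _ L.φ_lift f'
      (chainsMap L.θ).susp hft, fun k x => ⟨rfl, rfl⟩,
    pullbackMap_isEquivalence L.φ_lift f' (chainsMap L.θ).susp hft e'
      (chainsMap (L.θ.inv (D.nonempty_covB (n + 1)))).susp (fun k x y hxy => ?_) hτ hτ' κ
      (fun k x => ?_) μ hμ⟩
  · rw [f'_zero]
    abel
  · rw [f'_succ]
    abel
  · refine (Function.LeftInverse.injective (p_θ k)) ?_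
    refine (he' k x).trans (hxy.trans (Eq.trans ?_ (L.susp_θ k _)))
    rw [hτ']
  · exact (Function.LeftInverse.injective (p_θ (k + 1))) ((hκ k x).trans (map_zero _).symm)

end HomologicalEquivalence

end

end DualDec

open DualDec DualDec.HomologicalEquivalence in
theorem mainTheorem7 {N : Type*} [TopologicalSpace N] [T2Space N] [CompactSpace N]
    [ConnectedSpace N] [ChartedSpace (EuclideanHalfSpace 4) N] [IsManifold (𝓡∂ 4) ∞ N]
    {Γ π : Type*} [Group Γ] [Group π] (B : BoundaryData N Γ π)
    (D D' : GammaDecomposition B) (n : ℕ) (E : HomologicalEquivalence D D' n) :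
    Nonempty (AbsoluteMap E) ∧
    ∀ g : AbsoluteMap E,
      (∃ c, g.IsConnecting c) ∧
      (∀ c, g.IsConnecting c →
        (∃! L : Lift E, L.IsInduced g c) ∧
        ∀ L : Lift E, L.IsInduced g c → L.HasStratifiedLift) ∧
      (∀ c c', g.IsConnecting c → g.IsConnecting c' →
        ∀ L L' : Lift E, L.IsInduced g c → L'.IsInduced g c' →
          ∃ κ ∈ (D'.red n).ker,
            (∀ a, L'.φ a = κ * L.φ a * κ⁻¹) ∧
            ∀ (y : B.dW) (b : (D.covB (n + 1)).fib y), L'.θ.f b = κ • L.θ.f b) :=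
  ⟨E.nonempty_absoluteMap, fun g => ⟨g.exists_isConnecting,
    fun _ hc => ⟨⟨g.lift hc, g.lift_isInduced hc, fun _ hL => hL.unique (g.lift_isInduced hc)⟩,
      fun L _ => L.hasStratifiedLift⟩,
    fun _ _ hc hc' _ _ h h' => h.exists_conj hc hc' h'⟩⟩
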